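/- Let $\Omega\subset\mathbb{R}^2$ be a bounded domain (nonempty, open, connected), and let $\psi$ be the stream function of a steady flow in $\Omega$ with vorticity $\omega=\Delta\psi$, that is, $\{\psi,\omega\}=\partial_1\psi\,\partial_2\omega-\partial_2\psi\,\partial_1\omega=0$ a.e. in $\Omega$ and $\psi$ is constant on $\partial\Omega$, in the sense that $\psi-b\in H_0^1(\Omega)$ for some $b\in\mathbb{R}$. Assume that the flow satisfies Arnold's stability criterion: $\psi\in W^{3,1}(\Omega)$, there is $C>0$ with $$C^{-1}|\nabla\psi|\le|\nabla\Delta\psi|\le C|\nabla\psi|\quad\text{a.e. in }\Omega,$$ and one of the following holds: (1) $\nabla\psi\cdot\nabla\Delta\psi=|\nabla\psi|\,|\nabla\Delta\psi|$ a.e. in $\Omega$; (2) $-\nabla\psi\cdot\nabla\Delta\psi=|\nabla\psi|\,|\nabla\Delta\psi|$ a.e. in $\Omega$, and there is a nonincreasing Lipschitz function $f:\mathbb{R}\to\mathbb{R}$ with $\omega=f(\psi)$ a.e. in $\Omega$ and $$\operatorname*{ess\,inf}_{s\in[\inf\psi,\,\sup\psi]}f'(s)>-\lambda_1(-\Delta,\Omega),$$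 where $\inf\psi,\sup\psi$ are the essential infimum and supremum of $\psi$ over $\Omega$ and $\lambda_1(-\Delta,\Omega)$ is the first eigenvalue of $-\Delta$ on $\Omega$ with Dirichlet boundary condition. Then $\omega\ge0$ a.e. in $\Omega$ or $\omega\le0$ a.e. in $\Omega$. -/

import Mathlib

open MeasureTheory Filter Topology TopologicalSpace
open scoped ENNReal NNReal Distributions

/-- The plane with its Euclidean norm and inner product. -/
abbrev Plane : Type := EuclideanSpace ℝ (Fin 2)

noncomputable section

/-- The classical partial derivative `∂ᵢφ`. -/
def partialD (i : Fin 2) (φ : Plane → ℝ) (x : Plane) : ℝ :=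
  fderiv ℝ φ x (EuclideanSpace.single i 1)

/-- `g` is the weak partial derivative `∂ᵢu` on the open set `Ω`. -/
def HasWeakPartial (Ω : Opens Plane) (i : Fin 2) (u g : Plane → ℝ) : Prop :=
  LocallyIntegrableOn u Ω ∧ LocallyIntegrableOn g Ω ∧
    ∀ φ : 𝓓(Ω, ℝ), ∫ x in Ω, u x * partialD i φ x = -∫ x in Ω, g x * φ x

/-- `G` is the weak gradient `∇u` on the open set `Ω`. -/
def HasWeakGradient (Ω : Opens Plane) (u : Plane → ℝ) (G : Plane → Plane) : Prop :=
  ∀ i, HasWeakPartial Ω i u (fun x => G x i)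

/-- `w` is the distributional Laplacian `Δu` on the open set `Ω`. -/
def HasWeakLaplacian (Ω : Opens Plane) (u w : Plane → ℝ) : Prop :=
  LocallyIntegrableOn u Ω ∧ LocallyIntegrableOn w Ω ∧
    ∀ φ : 𝓓(Ω, ℝ), ∫ x in Ω, u x * ∑ i, partialD i (partialD i φ) x = ∫ x in Ω, w x * φ x

/-- Membership in the Sobolev space `W^{k,p}(Ω)`. -/
def MemSobolev (Ω : Opens Plane) (p : ℝ≥0∞) : ℕ → (Plane → ℝ) → Prop
  | 0, u => MemLp u p (volume.restrict Ω)
  | k + 1, u => MemLp u p (volume.restrict Ω) ∧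
      ∀ i, ∃ g, HasWeakPartial Ω i u g ∧ MemSobolev Ω p k g

/-- Membership in `H₀¹(Ω)`, the closure of the test functions in `W^{1,2}(Ω)`. -/
def MemH10 (Ω : Opens Plane) (u : Plane → ℝ) : Prop :=
  MemLp u 2 (volume.restrict Ω) ∧
    ∃ G : Plane → Plane, HasWeakGradient Ω u G ∧
      (∀ i, MemLp (fun x => G x i) 2 (volume.restrict Ω)) ∧
      ∃ φ : ℕ → 𝓓(Ω, ℝ),
        Tendsto (fun n => eLpNorm (fun x => φ n x - u x) 2 (volume.restrict Ω)) atTop (𝓝 0) ∧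
        ∀ i, Tendsto (fun n => eLpNorm (fun x => partialD i (φ n) x - G x i) 2
          (volume.restrict Ω)) atTop (𝓝 0)

/-- `μ` is an eigenvalue of `-Δ` on `Ω` with Dirichlet boundary condition: `-Δu = μu` in the sense
of distributions for some nonzero `u ∈ H₀¹(Ω)`. -/
def IsDirichletEigenvalue (Ω : Opens Plane) (μ : ℝ) : Prop :=
  ∃ u : Plane → ℝ, MemH10 Ω u ∧ ¬ (∀ᵐ x ∂(volume.restrict (Ω : Set Plane)), u x = 0) ∧
    HasWeakLaplacian Ω u (fun x => -μ * u x)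

/-- The first Dirichlet eigenvalue `λ₁(-Δ, Ω)`. -/
def firstDirichletEigenvalue (Ω : Opens Plane) : ℝ :=
  sInf {μ : ℝ | IsDirichletEigenvalue Ω μ}

/-- `ψ` is the stream function, and `ω` the vorticity, of a steady flow in `Ω`: `ω = Δψ`,
`{ψ, ω} = ∂₁ψ ∂₂ω - ∂₂ψ ∂₁ω = 0`, and `ψ` is constant on the boundary. -/
structure IsSteadyFlow (Ω : Opens Plane) (ψ ω : Plane → ℝ) : Prop where
  vorticity : HasWeakLaplacian Ω ψ ω
  boundary : ∃ b : ℝ, MemH10 Ω (fun x => ψ x - b)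
  steady : ∃ Gψ Gω : Plane → Plane, HasWeakGradient Ω ψ Gψ ∧ HasWeakGradient Ω ω Gω ∧
    ∀ᵐ x ∂(volume.restrict (Ω : Set Plane)), Gψ x 0 * Gω x 1 - Gψ x 1 * Gω x 0 = 0

/-- The interval `[inf ψ, sup ψ] ⊆ ℝ`, with the essential infimum and supremum over `Ω` taken in
the extended reals. -/
def essRangeInterval (Ω : Opens Plane) (ψ : Plane → ℝ) : Set ℝ :=
  {s : ℝ | essInf (fun x => (ψ x : EReal)) (volume.restrict (Ω : Set Plane)) ≤ (s : EReal) ∧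
    (s : EReal) ≤ essSup (fun x => (ψ x : EReal)) (volume.restrict (Ω : Set Plane))}

/-- Arnold's stability criterion for the stream function `ψ` with vorticity `ω = Δψ`. The derivative
of the Lipschitz function `f` exists almost everywhere, and its infimum is the essential one. -/
def ArnoldStable (Ω : Opens Plane) (ψ ω : Plane → ℝ) : Prop :=
  MemSobolev Ω 1 3 ψ ∧
  ∃ Gψ Gω : Plane → Plane, HasWeakGradient Ω ψ Gψ ∧ HasWeakGradient Ω ω Gω ∧
    (∃ C : ℝ, 0 < C ∧ ∀ᵐ x ∂(volume.restrict (Ω : Set Plane)),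
      C⁻¹ * ‖Gψ x‖ ≤ ‖Gω x‖ ∧ ‖Gω x‖ ≤ C * ‖Gψ x‖) ∧
    ((∀ᵐ x ∂(volume.restrict (Ω : Set Plane)), inner ℝ (Gψ x) (Gω x) = ‖Gψ x‖ * ‖Gω x‖) ∨
     ((∀ᵐ x ∂(volume.restrict (Ω : Set Plane)), -inner ℝ (Gψ x) (Gω x) = ‖Gψ x‖ * ‖Gω x‖) ∧
      ∃ f : ℝ → ℝ, Antitone f ∧ (∃ K : ℝ≥0, LipschitzWith K f) ∧
        (∀ᵐ x ∂(volume.restrict (Ω : Set Plane)), ω x = f (ψ x)) ∧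
        ((-firstDirichletEigenvalue Ω : ℝ) : EReal) <
          essInf (fun s => ((deriv f s : ℝ) : EReal)) (volume.restrict (essRangeInterval Ω ψ))))

end

/-! Put u = ψ - b, an element of H₀¹(Ω) with Δu = ω. The two cases of the criterion have separate
proofs.

In case (1), ∇u · ∇ω ≥ 0, and the two-sided bound makes ∇u vanish wherever ∇ω does. Let T be smooth
and nondecreasing, zero on (-∞, 0] and positive on (0, ∞). Testing Δu = ω with T(ω) T(u) gives ∫
T(ω) T'(u) |∇u|² + ∫ T(u) T'(ω) ∇u · ∇ω = -∫ ω T(ω) T(u). The left side is nonnegative and the right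
side nonpositive, so ω ≤ 0 a.e. where u > 0 (`H10Approx.laplacian_nonpos_of_pos`); replacing u by
-u, ω ≥ 0 a.e. where u < 0. Testing instead with η k(ω), where η ≥ 0 and k is a nonincreasing
approximation of the indicator of (-∞, 0), gives ∫ ∇u · ∇η ≥ 0 over {ω < 0}. A weak gradient
vanishes a.e. on the zero set of its function. Hence ∇u = 0 a.e. on {u = 0}, and on {ω = 0} first ∇ω
and then ∇u vanishes. So 1_{ω<0} ∇u = 1_{u>0} ∇u = ∇u⁺ a.e., and u⁺ is superharmonic
(`H10Approx.superharmonic_posPart`). By the strong minimum principle on a connected domain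
(`IsWeaklySuperharmonic.ae_eq_zero_or_ae_pos`), either u > 0 a.e., whence ω ≤ 0, or u ≤ 0 a.e.
Applying this to -u as well leaves only u = 0, where ω = 0 (`H10Approx.laplacian_sign`).

In case (2), the sign of ω is that of f(b). An element of H₀¹ cannot stay away from 0, so b lies in
the interval on which the slope of f is controlled. If f(b) ≥ 0, then Δu = f(ψ) ≥ m u where u > 0,
for some m > -λ₁. The maximum principle below the first eigenvalue
(`H10Approx.ae_nonpos_of_lt_eigenvalue`) gives ψ ≤ b, and since f is nonincreasing, ω ≥ f(b) ≥ 0.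
The case f(b) ≤ 0 is symmetric. The maximum principle rests on Poincaré's inequality with constant
λ₁. As λ₁ is defined through eigenvalues, this requires the infimum of the Rayleigh quotient to be
an eigenvalue (`isDirichletEigenvalue_rayleighInf`), which follows from Rellich compactness. -/

/-! ### Test functions, Green's formula and uniqueness of weak derivatives -/

section TestFunctions

variable {Ω : Opens Plane}

/-- A smooth function whose support lies in that of a test function, as a test function. -/
def TestFunction.ofSupport (φ : 𝓓(Ω, ℝ)) (g : Plane → ℝ) (hg : ContDiff ℝ (⊤ : ℕ∞) g)
    (h : Function.support g ⊆ tsupport φ) : 𝓓(Ω, ℝ) :=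
  ⟨g, hg, φ.hasCompactSupport.mono' h,
    (closure_minimal h (isClosed_tsupport _)).trans φ.tsupport_subset⟩

theorem contDiff_partialD {φ : Plane → ℝ} (hφ : ContDiff ℝ (⊤ : ℕ∞) φ) (i : Fin 2) :
    ContDiff ℝ (⊤ : ℕ∞) (partialD i φ) := by
  unfold partialD
  exact (hφ.fderiv_right (m := (⊤ : ℕ∞)) (by simp)).clm_apply contDiff_const

theorem support_partialD_subset (φ : Plane → ℝ) (i : Fin 2) :
    Function.support (partialD i φ) ⊆ tsupport φ := by
  intro x hx
  apply support_fderiv_subset ℝ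
  intro h
  apply hx
  simp [partialD, h]

/-- The partial derivative of a test function, as a test function. -/
noncomputable def TestFunction.partial (i : Fin 2) (φ : 𝓓(Ω, ℝ)) : 𝓓(Ω, ℝ) :=
  φ.ofSupport (partialD i φ) (contDiff_partialD φ.contDiff i) (support_partialD_subset _ _)

@[simp] theorem TestFunction.coe_partial (i : Fin 2) (φ : 𝓓(Ω, ℝ)) :
    ⇑(φ.partial i) = partialD i φ := rfl

/-- The product of a test function and a smooth function, as a test function. -/
noncomputable def TestFunction.mulSmooth (φ : 𝓓(Ω, ℝ)) (g : Plane → ℝ) (hg : ContDiff ℝ (⊤ : ℕ∞) g) : 𝓓(Ω, ℝ) :=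
  φ.ofSupport (fun x => φ x * g x) (φ.contDiff.mul hg) fun x hx =>
    subset_tsupport _ fun h => hx (by simp [h])

@[simp] theorem TestFunction.coe_mulSmooth (φ : 𝓓(Ω, ℝ)) (g : Plane → ℝ)
    (hg : ContDiff ℝ (⊤ : ℕ∞) g) : ⇑(φ.mulSmooth g hg) = fun x => φ x * g x := rfl

/-- The composition of a smooth function vanishing at `0` with a test function. -/
noncomputable def TestFunction.comp (φ : 𝓓(Ω, ℝ)) (h : ℝ → ℝ) (hh : ContDiff ℝ (⊤ : ℕ∞) h) (h0 : h 0 = 0) :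
    𝓓(Ω, ℝ) :=
  φ.ofSupport (fun x => h (φ x)) (hh.comp φ.contDiff) fun x hx =>
    subset_tsupport _ fun h' => hx (by simp [h', h0])

@[simp] theorem TestFunction.coe_comp (φ : 𝓓(Ω, ℝ)) (h : ℝ → ℝ) (hh : ContDiff ℝ (⊤ : ℕ∞) h)
    (h0 : h 0 = 0) : ⇑(φ.comp h hh h0) = fun x => h (φ x) := rfl

theorem TestFunction.differentiable (φ : 𝓓(Ω, ℝ)) : Differentiable ℝ φ :=
  φ.contDiff.differentiable (by simp)

theorem partialD_mul {f g : Plane → ℝ} {x : Plane} (hf : DifferentiableAt ℝ f x)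
    (hg : DifferentiableAt ℝ g x) (i : Fin 2) :
    partialD i (fun y => f y * g y) x = partialD i f x * g x + f x * partialD i g x := by
  simp only [partialD]
  rw [fderiv_fun_mul hf hg]
  simp
  ring

theorem partialD_comp {h : ℝ → ℝ} {g : Plane → ℝ} {x : Plane} (hh : DifferentiableAt ℝ h (g x))
    (hg : DifferentiableAt ℝ g x) (i : Fin 2) :
    partialD i (fun y => h (g y)) x = deriv h (g x) * partialD i g x := by
  simp only [partialD]
  have := (hh.hasDerivAt.comp_hasFDerivAt x hg.hasFDerivAt).fderiv
  simp only [Function.comp_def] at this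
  rw [this]
  simp

theorem partialD_add {f g : Plane → ℝ} {x : Plane} (hf : DifferentiableAt ℝ f x)
    (hg : DifferentiableAt ℝ g x) (i : Fin 2) :
    partialD i (fun y => f y + g y) x = partialD i f x + partialD i g x := by
  simp only [partialD]
  rw [fderiv_fun_add hf hg]
  simp

theorem partialD_const_mul {f : Plane → ℝ} {x : Plane} (hf : DifferentiableAt ℝ f x)
    (c : ℝ) (i : Fin 2) :
    partialD i (fun y => c * f y) x = c * partialD i f x := by
  simp only [partialD]
  rw [fderiv_const_mul hf]
  simp

theorem TestFunction.memLp (φ : 𝓓(Ω, ℝ)) (p : ℝ≥0∞) (μ : Measure Plane)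
    [IsFiniteMeasureOnCompacts μ] : MemLp φ p μ :=
  φ.continuous.memLp_of_hasCompactSupport φ.hasCompactSupport

theorem TestFunction.exists_bound (φ : 𝓓(Ω, ℝ)) : ∃ C : ℝ, ∀ x, ‖φ x‖ ≤ C :=
  φ.continuous.bounded_above_of_compact_support φ.hasCompactSupport

theorem MeasureTheory.LocallyIntegrableOn.integrable_mul_testFunction {u : Plane → ℝ}
    (hu : LocallyIntegrableOn u Ω) (φ : 𝓓(Ω, ℝ)) :
    Integrable (fun x => u x * φ x) (volume.restrict (Ω : Set Plane)) := by
  have h1 : IntegrableOn (fun x => u x * φ x) (tsupport φ) :=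
    (hu.integrableOn_compact_subset φ.tsupport_subset φ.hasCompactSupport).mul_continuousOn
      φ.continuous.continuousOn φ.hasCompactSupport
  refine (h1.of_forall_sdiff_eq_zero Ω.isOpen.measurableSet ?_)
  intro x hx
  simp [image_eq_zero_of_notMem_tsupport hx.2]

theorem MeasureTheory.MemLp.locallyIntegrableOn_opens {u : Plane → ℝ} {p : ℝ≥0∞} (hp : 1 ≤ p)
    (hu : MemLp u p (volume.restrict (Ω : Set Plane))) : LocallyIntegrableOn u Ω := by
  rw [locallyIntegrableOn_iff Ω.isOpen.isLocallyClosed]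
  intro K hK hKc
  have : MemLp u p (volume.restrict K) := hu.mono_measure (Measure.restrict_mono hK le_rfl)
  have : IsFiniteMeasure (volume.restrict K) := ⟨by simpa using hKc.measure_lt_top⟩
  exact MemLp.integrable hp ‹MemLp u p (volume.restrict K)›

theorem MeasureTheory.MemLp.integrable_mul_two {α : Type*} [MeasurableSpace α] {μ : Measure α}
    {f g : α → ℝ} (hf : MemLp f 2 μ)
    (hg : MemLp g 2 μ) : Integrable (fun x => f x * g x) μ :=
  hf.integrable_mul hg

/-- Green's formula for a weak Laplacian. -/
theorem HasWeakLaplacian.integral_gradient {u w : Plane → ℝ} {G : Plane → Plane}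
    (hw : HasWeakLaplacian Ω u w) (hG : HasWeakGradient Ω u G) (φ : 𝓓(Ω, ℝ)) :
    ∫ x in Ω, ∑ i, G x i * partialD i φ x = -∫ x in Ω, w x * φ x := by
  rw [← hw.2.2 φ]
  simp only [Finset.mul_sum]
  rw [integral_finsetSum, integral_finsetSum, ← Finset.sum_neg_distrib]
  · refine Finset.sum_congr rfl fun i _ => ?_
    have := (hG i).2.2 (φ.partial i)
    simp only [TestFunction.coe_partial] at this
    rw [this, neg_neg]
  · intro i _
    exact LocallyIntegrableOn.integrable_mul_testFunction hw.1 ((φ.partial i).partial i)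
  · intro i _
    exact LocallyIntegrableOn.integrable_mul_testFunction (hG i).2.1 (φ.partial i)

theorem MeasureTheory.LocallyIntegrableOn.ae_eq_zero_of_integral_testFunction {f : Plane → ℝ}
    (hf : LocallyIntegrableOn f Ω) (h : ∀ φ : 𝓓(Ω, ℝ), ∫ x in Ω, f x * φ x = 0) :
    ∀ᵐ x ∂(volume.restrict (Ω : Set Plane)), f x = 0 := by
  rw [ae_restrict_iff' Ω.isOpen.measurableSet]
  refine Ω.isOpen.ae_eq_zero_of_integral_contDiff_smul_eq_zero hf fun g hg hgc hgs => ?_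
  have := h ⟨g, hg, hgc, hgs⟩
  rw [← this, ← integral_indicator Ω.isOpen.measurableSet]
  congr 1
  ext x
  by_cases hx : x ∈ (Ω : Set Plane)
  · simp [hx, mul_comm, DFunLike.coe]
  · have : x ∉ tsupport g := fun h' => hx (hgs h')
    simp [hx, image_eq_zero_of_notMem_tsupport this]

theorem HasWeakPartial.ae_unique {u g g' : Plane → ℝ} {i : Fin 2} (h : HasWeakPartial Ω i u g)
    (h' : HasWeakPartial Ω i u g') : ∀ᵐ x ∂(volume.restrict (Ω : Set Plane)), g x = g' x := by
  have : ∀ᵐ x ∂(volume.restrict (Ω : Set Plane)), (g - g') x = 0 := by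
    refine LocallyIntegrableOn.ae_eq_zero_of_integral_testFunction (h.2.1.sub h'.2.1) fun φ => ?_
    simp only [Pi.sub_apply, sub_mul]
    rw [integral_sub (LocallyIntegrableOn.integrable_mul_testFunction h.2.1 φ)
      (LocallyIntegrableOn.integrable_mul_testFunction h'.2.1 φ)]
    have h1 := h.2.2 φ
    have h2 := h'.2.2 φ
    linarith
  filter_upwards [this] with x hx
  simpa [sub_eq_zero] using hx

theorem HasWeakGradient.ae_unique {u : Plane → ℝ} {G G' : Plane → Plane}
    (h : HasWeakGradient Ω u G) (h' : HasWeakGradient Ω u G') :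
    ∀ᵐ x ∂(volume.restrict (Ω : Set Plane)), G x = G' x := by
  have : ∀ᵐ x ∂(volume.restrict (Ω : Set Plane)), ∀ i, G x i = G' x i :=
    ae_all_iff.2 fun i => (h i).ae_unique (h' i)
  filter_upwards [this] with x hx
  ext i
  exact hx i

end TestFunctions

/-! ### Mollification and its convergence in Lᵖ -/

section Mollification

open scoped Convolution
open ContinuousLinearMap

/-- A bump function at the origin, with radii `1 / (n + 1)` and `2 / (n + 1)`. -/
noncomputable def shrinkingBump (n : ℕ) : ContDiffBump (0 : Plane) where
  rIn := 1 / (n + 1)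
  rOut := 2 / (n + 1)
  rIn_pos := by positivity
  rIn_lt_rOut := by gcongr; norm_num

/-- The mollification of `g` at scale `1 / (n + 1)`. -/
noncomputable def mollify (n : ℕ) (g : Plane → ℝ) : Plane → ℝ :=
  (shrinkingBump n).normed volume ⋆[lsmul ℝ ℝ, volume] g

theorem tendsto_rOut_shrinkingBump : Tendsto (fun n => (shrinkingBump n).rOut) atTop (𝓝 0) := by
  have := (tendsto_one_div_add_atTop_nhds_zero_nat (𝕜 := ℝ)).const_mul 2
  simp only [mul_zero] at this
  refine this.congr fun n => ?_
  simp only [shrinkingBump]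
  ring

theorem mollify_apply (n : ℕ) (g : Plane → ℝ) (x : Plane) :
    mollify n g x = ∫ t, (shrinkingBump n).normed volume t * g (x - t) := rfl

theorem contDiff_mollify {g : Plane → ℝ} (hg : LocallyIntegrable g) (n : ℕ) :
    ContDiff ℝ (⊤ : ℕ∞) (mollify n g) :=
  ((shrinkingBump n).hasCompactSupport_normed).contDiff_convolution_left _
    (shrinkingBump n).contDiff_normed hg

theorem ae_tendsto_mollify {g : Plane → ℝ} (hg : LocallyIntegrable g) :
    ∀ᵐ x, Tendsto (fun n => mollify n g x) atTop (𝓝 (g x)) := by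
  -- The outer radius is twice the inner one; a bounded ratio of radii is what Lebesgue
  -- differentiation requires.
  refine ContDiffBump.ae_convolution_tendsto_right_of_locallyIntegrable (K := 2)
    tendsto_rOut_shrinkingBump (Eventually.of_forall fun n => ?_) hg
  simp only [shrinkingBump]
  apply le_of_eq
  ring

theorem mollify_sub {g h : Plane → ℝ} (hg : LocallyIntegrable g) (hh : LocallyIntegrable h)
    (n : ℕ) (x : Plane) : mollify n (fun y => g y - h y) x = mollify n g x - mollify n h x := by
  have e : ∀ {k : Plane → ℝ}, LocallyIntegrable k → Integrable (fun t =>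
      (shrinkingBump n).normed volume t * k (x - t)) := fun {k} hk =>
    (((shrinkingBump n).hasCompactSupport_normed (μ := volume)).convolutionExists_left (lsmul ℝ ℝ)
      (shrinkingBump n).continuous_normed hk x)
  simp only [mollify_apply, mul_sub]
  rw [integral_sub (e hg) (e hh)]

theorem lintegral_normed_bump (b : ContDiffBump (0 : Plane)) :
    ∫⁻ t, ENNReal.ofReal (b.normed volume t) = 1 := by
  rw [← ofReal_integral_eq_lintegral_ofReal b.integrable_normed
    (Eventually.of_forall b.nonneg_normed), b.integral_normed, ENNReal.ofReal_one]

/-- The normalized bump is the density of a probability measure, so Jensen's inequality bounds the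
p-th power of the mollification by the average of |g|ᵖ over translates. Tonelli's theorem and
translation invariance finish. -/
theorem eLpNorm_mollify_le {g : Plane → ℝ} {p : ℝ} (hp : 1 ≤ p)
    (hg : AEStronglyMeasurable g volume) (n : ℕ) :
    eLpNorm (mollify n g) (ENNReal.ofReal p) volume ≤ eLpNorm g (ENNReal.ofReal p) volume := by
  set b := shrinkingBump n
  set ν : Measure Plane := volume.withDensity fun t => ENNReal.ofReal (b.normed volume t) with hν
  have hbm : Measurable fun t => ENNReal.ofReal (b.normed volume t) :=
    (b.continuous_normed.measurable).ennreal_ofReal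
  have hprob : IsProbabilityMeasure ν := ⟨by
    rw [hν, withDensity_apply _ MeasurableSet.univ, Measure.restrict_univ, lintegral_normed_bump]⟩
  have hac : ν ≪ volume := withDensity_absolutelyContinuous _ _
  have p0 : 0 < p := by linarith
  have hp0 : ENNReal.ofReal p ≠ 0 := by simpa using p0
  have hpt : ENNReal.ofReal p ≠ ⊤ := ENNReal.ofReal_ne_top
  have hpr : (ENNReal.ofReal p).toReal = p := ENNReal.toReal_ofReal p0.le
  have hgx : ∀ x, AEStronglyMeasurable (fun t => g (x - t)) volume := fun x =>
    hg.comp_quasiMeasurePreserving (quasiMeasurePreserving_sub_left volume x)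
  have key : ∀ x, ‖mollify n g x‖ₑ ^ p ≤ ∫⁻ t, ‖g (x - t)‖ₑ ^ p ∂ν := by
    intro x
    have h1 : ‖mollify n g x‖ₑ ≤ ∫⁻ t, ‖g (x - t)‖ₑ ∂ν := by
      rw [mollify_apply, lintegral_withDensity_eq_lintegral_mul₀ hbm.aemeasurable (hgx x).enorm]
      refine (enorm_integral_le_lintegral_enorm _).trans (le_of_eq ?_)
      refine lintegral_congr fun t => ?_
      simp only [Pi.mul_apply, enorm_mul]
      rw [Real.enorm_of_nonneg (b.nonneg_normed t)]
    have h2 := eLpNorm_le_eLpNorm_of_exponent_le (μ := ν) (p := 1) (q := ENNReal.ofReal p)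
      (by simpa using hp) ((hgx x).mono_ac hac)
    rw [eLpNorm_one_eq_lintegral_enorm, eLpNorm_eq_lintegral_rpow_enorm_toReal hp0 hpt, hpr] at h2
    calc ‖mollify n g x‖ₑ ^ p ≤ ((∫⁻ t, ‖g (x - t)‖ₑ ^ p ∂ν) ^ (1 / p)) ^ p :=
          ENNReal.rpow_le_rpow (h1.trans h2) p0.le
      _ = _ := by rw [← ENNReal.rpow_mul, one_div, inv_mul_cancel₀ p0.ne', ENNReal.rpow_one]
  rw [eLpNorm_eq_lintegral_rpow_enorm_toReal hp0 hpt, eLpNorm_eq_lintegral_rpow_enorm_toReal hp0 hpt,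
    hpr]
  refine ENNReal.rpow_le_rpow ?_ (by positivity)
  calc ∫⁻ x, ‖mollify n g x‖ₑ ^ p ≤ ∫⁻ x, ∫⁻ t, ‖g (x - t)‖ₑ ^ p ∂ν := lintegral_mono key
    _ = ∫⁻ t, ∫⁻ x, ‖g (x - t)‖ₑ ^ p ∂volume ∂ν := by
        refine lintegral_lintegral_swap ?_
        have : AEStronglyMeasurable (fun z : Plane × Plane => g (z.1 - z.2)) (volume.prod ν) :=
          hg.comp_quasiMeasurePreserving
            ((quasiMeasurePreserving_sub_of_right_invariant volume volume).mono_left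
              (Measure.AbsolutelyContinuous.prod Measure.AbsolutelyContinuous.rfl hac))
        exact this.enorm.pow_const p
    _ = ∫⁻ t, ∫⁻ x, ‖g x‖ₑ ^ p ∂volume ∂ν := by
        refine lintegral_congr fun t => ?_
        exact lintegral_sub_right_eq_self (fun x => ‖g x‖ₑ ^ p) t
    _ = _ := by simp

theorem tendsto_eLpNorm_mollify_of_continuous {h : Plane → ℝ} {p : ℝ} (hp : 1 ≤ p)
    (hc : Continuous h) (hs : HasCompactSupport h) :
    Tendsto (fun n => eLpNorm (fun x => mollify n h x - h x) (ENNReal.ofReal p) volume)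
      atTop (𝓝 0) := by
  have p0 : 0 < p := by linarith
  -- The outer radius 2 / (n + 1) is at most 2, so every mollification of `h` is supported in this
  -- one compact set, and uniform convergence on it gives convergence in Lᵖ.
  set K := Metric.cthickening 2 (tsupport h)
  have hK : IsCompact K := hs.isCompact.cthickening
  have hKm : MeasurableSet K := hK.measurableSet
  have hKv : volume K ≠ ⊤ := hK.measure_lt_top.ne
  have hcoef : (volume K) ^ (ENNReal.ofReal p).toReal⁻¹ ≠ ⊤ :=
    ENNReal.rpow_ne_top_of_nonneg (by positivity) hKv
  have huc : UniformContinuous h := hs.uniformContinuous_of_continuous hc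
  have hzero : ∀ n, ∀ x ∉ K, mollify n h x - h x = 0 := by
    intro n x hx
    have hr : (shrinkingBump n).rOut ≤ 2 := by
      simp only [shrinkingBump]
      rw [div_le_iff₀ (by positivity)]
      have : (0 : ℝ) ≤ n := by positivity
      linarith
    have h0 : ∀ y ∈ Metric.ball x (shrinkingBump n).rOut, h y = 0 := by
      intro y hy
      apply image_eq_zero_of_notMem_tsupport
      intro hy'
      apply hx
      exact Metric.mem_cthickening_of_dist_le x y 2 _ hy'
        (by rw [dist_comm]; exact (Metric.mem_ball.1 hy).le.trans hr)
    have hx0 : h x = 0 := h0 x (Metric.mem_ball_self (shrinkingBump n).rOut_pos)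
    have := ContDiffBump.normed_convolution_eq_right (μ := volume) (φ := shrinkingBump n) (g := h)
      (x₀ := x) (fun y hy => by rw [h0 y hy, hx0])
    rw [mollify, this, sub_self]
  rw [ENNReal.tendsto_nhds_zero]
  intro ε hε
  obtain ⟨δ, hδ0, hδ⟩ : ∃ δ : ℝ, 0 < δ ∧
      (volume K) ^ (ENNReal.ofReal p).toReal⁻¹ * ENNReal.ofReal δ ≤ ε := by
    have : Tendsto (fun δ : ℝ => (volume K) ^ (ENNReal.ofReal p).toReal⁻¹ * ENNReal.ofReal δ)
        (𝓝[>] 0) (𝓝 0) := by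
      have := ENNReal.Tendsto.const_mul (a := (volume K) ^ (ENNReal.ofReal p).toReal⁻¹)
        (ENNReal.continuous_ofReal.tendsto (0 : ℝ)) (Or.inr hcoef)
      simp only [ENNReal.ofReal_zero, mul_zero] at this
      exact this.mono_left nhdsWithin_le_nhds
    have h1 := (ENNReal.tendsto_nhds_zero.1 this) ε hε
    obtain ⟨δ, h2, h3⟩ := (h1.and self_mem_nhdsWithin).exists
    exact ⟨δ, h3, h2⟩
  obtain ⟨r, hr0, hr⟩ := Metric.uniformContinuous_iff.1 huc δ hδ0
  have hev : ∀ᶠ n in atTop, (shrinkingBump n).rOut < r :=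
    tendsto_rOut_shrinkingBump.eventually (gt_mem_nhds hr0)
  filter_upwards [hev] with n hn
  have hbd : ∀ x, ‖mollify n h x - h x‖ ≤ δ := by
    intro x
    rw [← dist_eq_norm]
    refine ContDiffBump.dist_normed_convolution_le hc.aestronglyMeasurable fun y hy => ?_
    exact (hr ((Metric.mem_ball.1 hy).trans hn)).le
  have : eLpNorm (fun x => mollify n h x - h x) (ENNReal.ofReal p) volume =
      eLpNorm (fun x => mollify n h x - h x) (ENNReal.ofReal p) (volume.restrict K) := by
    rw [← eLpNorm_indicator_eq_eLpNorm_restrict hKm]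
    congr 1
    ext x
    by_cases hx : x ∈ K
    · simp [hx]
    · simp [hx, hzero n x hx]
  rw [this]
  refine (eLpNorm_le_of_ae_bound (C := δ) (Eventually.of_forall hbd)).trans ?_
  simpa using hδ

/-- Continuous functions of compact support are dense in Lᵖ, and mollification is an Lᵖ contraction;
the error splits into three parts of size ε / 3. -/
theorem tendsto_eLpNorm_mollify {g : Plane → ℝ} {p : ℝ} (hp : 1 ≤ p)
    (hg : MemLp g (ENNReal.ofReal p) volume) :
    Tendsto (fun n => eLpNorm (fun x => mollify n g x - g x) (ENNReal.ofReal p) volume)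
      atTop (𝓝 0) := by
  have hp1 : 1 ≤ ENNReal.ofReal p := by simpa using hp
  rw [ENNReal.tendsto_nhds_zero]
  intro ε hε
  have hε3 : ε / 3 ≠ 0 := (ENNReal.div_pos hε.ne' (by norm_num)).ne'
  obtain ⟨h, hs, hgh, hc, hh⟩ := hg.exists_hasCompactSupport_eLpNorm_sub_le
    ENNReal.ofReal_ne_top hε3
  have hev := (ENNReal.tendsto_nhds_zero.1 (tendsto_eLpNorm_mollify_of_continuous hp hc hs))
    (ε / 3) (pos_iff_ne_zero.2 hε3)
  filter_upwards [hev] with n hn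
  have hgl : LocallyIntegrable g := hg.locallyIntegrable hp1
  have hhl : LocallyIntegrable h := hh.locallyIntegrable hp1
  have hm1 : AEStronglyMeasurable (mollify n (fun y => g y - h y)) volume :=
    (contDiff_mollify (hgl.sub hhl) n).continuous.aestronglyMeasurable
  have hm2 : AEStronglyMeasurable (fun x => mollify n h x - h x) volume :=
    ((contDiff_mollify hhl n).continuous.sub hc).aestronglyMeasurable
  have hm3 : AEStronglyMeasurable (fun x => g x - h x) volume := (hg.sub hh).1
  have e : (fun x => mollify n g x - g x) =
      (mollify n (fun y => g y - h y) + fun x => mollify n h x - h x) - fun x => g x - h x := by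
    ext x
    simp only [Pi.add_apply, Pi.sub_apply, mollify_sub hgl hhl]
    ring
  rw [e]
  refine (eLpNorm_sub_le (hm1.add hm2) hm3 hp1).trans ?_
  refine (add_le_add (eLpNorm_add_le hm1 hm2 hp1) le_rfl).trans ?_
  have h1 : eLpNorm (mollify n (fun y => g y - h y)) (ENNReal.ofReal p) volume ≤ ε / 3 :=
    (eLpNorm_mollify_le hp hm3 n).trans hgh
  calc _ ≤ ε / 3 + ε / 3 + ε / 3 := add_le_add (add_le_add h1 hn) hgh
    _ = ε := ENNReal.add_thirds ε

end Mollification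

/-! ### Limits of integrals of products -/

section LimitLemmas

variable {α : Type*} [MeasurableSpace α] {μ : Measure α}

/-- Write aₙfₙ = aₙf₀ + aₙ(fₙ - f₀): the first term converges by domination, the second is bounded
by M ‖fₙ - f₀‖₁. Most passages to the limit below have this form, with a bounded nonlinear factor
converging a.e. and a factor converging in L¹. -/
theorem tendsto_integral_bdd_mul_L1 {a : ℕ → α → ℝ} {a₀ : α → ℝ} {f : ℕ → α → ℝ} {f₀ : α → ℝ}
    {M : ℝ} (ha : ∀ n, AEStronglyMeasurable (a n) μ) (hM : ∀ n x, |a n x| ≤ M)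
    (hlim : ∀ᵐ x ∂μ, Tendsto (fun n => a n x) atTop (𝓝 (a₀ x)))
    (hf : ∀ n, Integrable (f n) μ) (hf₀ : Integrable f₀ μ)
    (hL : Tendsto (fun n => eLpNorm (fun x => f n x - f₀ x) 1 μ) atTop (𝓝 0)) :
    Tendsto (fun n => ∫ x, a n x * f n x ∂μ) atTop (𝓝 (∫ x, a₀ x * f₀ x ∂μ)) := by
  have hb : ∀ n, ∀ᵐ x ∂μ, ‖a n x‖ ≤ M := fun n => Eventually.of_forall (hM n)
  have h1 : Tendsto (fun n => ∫ x, a n x * f₀ x ∂μ) atTop (𝓝 (∫ x, a₀ x * f₀ x ∂μ)) := by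
    refine tendsto_integral_of_dominated_convergence (fun x => M * ‖f₀ x‖)
      (fun n => (ha n).mul hf₀.1) (hf₀.norm.const_mul M) (fun n => ?_) ?_
    · refine Eventually.of_forall fun x => ?_
      rw [norm_mul]
      exact mul_le_mul_of_nonneg_right (hM n x) (norm_nonneg _)
    · filter_upwards [hlim] with x hx
      exact hx.mul_const _
  have h2 : Tendsto (fun n => ∫ x, a n x * (f n x - f₀ x) ∂μ) atTop (𝓝 0) := by
    have := tendsto_integral_of_L1 (μ := μ) (fun _ => (0 : ℝ)) aestronglyMeasurable_const
      (F := fun n x => a n x * (f n x - f₀ x)) (l := atTop)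
      (Eventually.of_forall fun n => ((hf n).sub hf₀).bdd_mul (ha n) (hb n)) ?_
    · simpa using this
    · have hz : Tendsto (fun n => ENNReal.ofReal M * eLpNorm (fun x => f n x - f₀ x) 1 μ) atTop
          (𝓝 0) := by
        simpa using ENNReal.Tendsto.const_mul (a := ENNReal.ofReal M) hL (Or.inr ENNReal.ofReal_ne_top)
      refine tendsto_of_tendsto_of_tendsto_of_le_of_le tendsto_const_nhds hz (fun _ => zero_le)
        fun n => ?_
      simp only [sub_zero, eLpNorm_one_eq_lintegral_enorm]
      rw [← lintegral_const_mul' _ _ ENNReal.ofReal_ne_top]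
      refine lintegral_mono fun x => ?_
      rw [enorm_mul]
      gcongr
      rw [← ofReal_norm]
      exact ENNReal.ofReal_le_ofReal (hM n x)
  have h3 := h1.add h2
  rw [add_zero] at h3
  refine h3.congr fun n => ?_
  have hInt : Integrable (fun x => a n x * (f n x - f₀ x)) μ :=
    ((hf n).sub hf₀).bdd_mul (ha n) (hb n)
  rw [← integral_add (hf₀.bdd_mul (ha n) (hb n)) hInt]
  refine integral_congr_ae (Eventually.of_forall fun x => ?_)
  ring

theorem tendsto_eLpNorm_one_mul {f : ℕ → α → ℝ} {f₀ g : α → ℝ}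
    (hf : ∀ n, AEStronglyMeasurable (fun x => f n x - f₀ x) μ) (hg : MemLp g 2 μ)
    (hL : Tendsto (fun n => eLpNorm (fun x => f n x - f₀ x) 2 μ) atTop (𝓝 0)) :
    Tendsto (fun n => eLpNorm (fun x => f n x * g x - f₀ x * g x) 1 μ) atTop (𝓝 0) := by
  have hz : Tendsto (fun n => eLpNorm (fun x => f n x - f₀ x) 2 μ * eLpNorm g 2 μ) atTop (𝓝 0) := by
    simpa using ENNReal.Tendsto.mul_const (b := eLpNorm g 2 μ) hL (Or.inr hg.2.ne)
  refine tendsto_of_tendsto_of_tendsto_of_le_of_le tendsto_const_nhds hz (fun _ => zero_le)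
    fun n => ?_
  have := eLpNorm_smul_le_mul_eLpNorm (p := 2) (q := 2) (r := 1) hg.1 (hf n)
  refine le_trans (le_of_eq ?_) this
  congr 1
  ext x
  simp [sub_mul]

end LimitLemmas

/-! ### Local smooth approximation of weakly differentiable functions -/

section WeakApproximation

open scoped Convolution
open ContinuousLinearMap

variable {Ω : Opens Plane}

/-- When the ball about `x` lies in `K'`, the kernel y ↦ ρ(x - y) is itself a test function on Ω and
does not see the cut-off at `K'`. Differentiating the kernel and using the definition of the weak
derivative moves the derivative onto `u`. -/
theorem partialD_mollify {u g : Plane → ℝ} {i : Fin 2} (h : HasWeakPartial Ω i u g)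
    {K' : Set Plane} (hK' : IsCompact K') (hK'Ω : K' ⊆ Ω) {n : ℕ} {x : Plane}
    (hx : Metric.closedBall x (shrinkingBump n).rOut ⊆ K') :
    partialD i (mollify n (K'.indicator u)) x = mollify n (K'.indicator g) x := by
  set ρ : Plane → ℝ := (shrinkingBump n).normed volume with hρ
  have hρs : ContDiff ℝ (⊤ : ℕ∞) ρ := (shrinkingBump n).contDiff_normed
  have hρc : HasCompactSupport ρ := (shrinkingBump n).hasCompactSupport_normed
  have hρd : Differentiable ℝ ρ := hρs.differentiable (by simp)
  have hloc : ∀ {f : Plane → ℝ}, LocallyIntegrableOn f Ω → LocallyIntegrable (K'.indicator f) :=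
    fun hf => ((hf.integrableOn_compact_subset hK'Ω hK').integrable_indicator
      hK'.measurableSet).locallyIntegrable
  have hsupp : Function.support (fun y => ρ (x - y)) ⊆ Metric.closedBall x (shrinkingBump n).rOut := by
    intro y hy
    have : x - y ∈ Function.support ρ := hy
    rw [hρ, ContDiffBump.support_normed_eq, mem_ball_zero_iff] at this
    rw [mem_closedBall_iff_norm, norm_sub_rev]
    exact this.le
  have hts : tsupport (fun y => ρ (x - y)) ⊆ Metric.closedBall x (shrinkingBump n).rOut :=
    closure_minimal hsupp Metric.isClosed_closedBall
  set φ : 𝓓(Ω, ℝ) := ⟨fun y => ρ (x - y), hρs.comp (contDiff_const.sub contDiff_id),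
    HasCompactSupport.of_support_subset_isCompact (isCompact_closedBall _ _) hsupp,
    hts.trans (hx.trans hK'Ω)⟩ with hφ
  have hφv : ∀ y, φ y = ρ (x - y) := fun y => rfl
  have hφd : ∀ y, partialD i φ y = -fderiv ℝ ρ (x - y) (EuclideanSpace.single i 1) := by
    intro y
    have h1 : HasFDerivAt (fun y => ρ (x - y)) ((fderiv ℝ ρ (x - y)).comp (-ContinuousLinearMap.id ℝ Plane)) y :=
      (hρd (x - y)).hasFDerivAt.comp y ((hasFDerivAt_id y).const_sub x)
    have h2 : fderiv ℝ φ y = _ := h1.fderiv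
    simp [partialD, h2]
  have hzero : ∀ y ∉ K', φ y = 0 := fun y hy => by
    by_contra hne
    exact hy (hx (hsupp hne))
  have hzero' : ∀ y ∉ K', partialD i φ y = 0 := fun y hy => by
    by_contra hne
    exact hy (hx (hts (support_partialD_subset _ _ hne)))
  have hext : ∀ (f k : Plane → ℝ), (∀ y ∉ K', k y = 0) →
      ∫ t in Ω, f t * k t = ∫ t, K'.indicator f t * k t := by
    intro f k hk
    rw [← integral_indicator Ω.isOpen.measurableSet]
    congr 1
    ext t
    by_cases ht : t ∈ K'
    · simp [ht, hK'Ω ht]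
    · by_cases ht' : t ∈ (Ω : Set Plane) <;> simp [ht, hk t ht]
  have hder : HasFDerivAt (mollify n (K'.indicator u))
      ((K'.indicator u ⋆[((lsmul ℝ ℝ : ℝ →L[ℝ] ℝ →L[ℝ] ℝ).flip).precompR Plane, volume] fderiv ℝ ρ) x) x := by
    have := hρc.hasFDerivAt_convolution_right (lsmul ℝ ℝ : ℝ →L[ℝ] ℝ →L[ℝ] ℝ).flip (hloc h.1)
      (hρs.of_le (by simp)) x
    rw [convolution_flip] at this
    exact this
  have e1 : partialD i (mollify n (K'.indicator u)) x =
      ∫ t, K'.indicator u t * fderiv ℝ ρ (x - t) (EuclideanSpace.single i 1) := by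
    rw [partialD, hder.fderiv, convolution_precompR_apply _ (hloc h.1) (hρc.fderiv ℝ)
      (hρs.continuous_fderiv (by simp)), convolution_def]
    refine integral_congr_ae (Eventually.of_forall fun t => ?_)
    simp [mul_comm]
  have e2 : mollify n (K'.indicator g) x = ∫ t, K'.indicator g t * ρ (x - t) := by
    rw [mollify, ← convolution_flip, convolution_def]
    refine integral_congr_ae (Eventually.of_forall fun t => ?_)
    simp [mul_comm, hρ]
  have e3 := h.2.2 φ
  rw [hext u _ hzero', hext g _ hzero] at e3
  simp only [hφd, mul_neg, integral_neg, neg_inj] at e3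
  rw [e1, e2, e3]
  rfl

/-- Smooth approximation of a function, together with its weak derivatives, on a compact set. -/
theorem exists_smooth_approx {u : Plane → ℝ} (hu : LocallyIntegrableOn u Ω) {K : Set Plane}
    (hK : IsCompact K) (hKΩ : K ⊆ Ω) : ∃ v : ℕ → Plane → ℝ,
    (∀ n, ContDiff ℝ (⊤ : ℕ∞) (v n)) ∧
    (∀ᵐ x ∂(volume.restrict K), Tendsto (fun n => v n x) atTop (𝓝 (u x))) ∧
    Tendsto (fun n => eLpNorm (fun x => v n x - u x) 1 (volume.restrict K)) atTop (𝓝 0) ∧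
    ∀ i g, HasWeakPartial Ω i u g → ∀ p : ℝ, 1 ≤ p →
      (∀ L : Set Plane, IsCompact L → L ⊆ Ω → MemLp g (ENNReal.ofReal p) (volume.restrict L)) →
      Tendsto (fun n => eLpNorm (fun x => partialD i (v n) x - g x) (ENNReal.ofReal p)
        (volume.restrict K)) atTop (𝓝 0) := by
  -- Once the bump radius is below δ, mollification at points of `K` uses only values on the compact
  -- thickening, on which `u` is integrable and may be extended by zero.
  obtain ⟨δ, hδ, hδΩ⟩ := hK.exists_cthickening_subset_open Ω.isOpen hKΩ
  set K' := Metric.cthickening δ K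
  have hK' : IsCompact K' := hK.cthickening
  have hKK' : K ⊆ K' := Metric.self_subset_cthickening K
  have hui : Integrable (K'.indicator u) :=
    (hu.integrableOn_compact_subset hδΩ hK').integrable_indicator hK'.measurableSet
  have main : ∀ (f : Plane → ℝ) (p : ℝ), 1 ≤ p →
      MemLp f (ENNReal.ofReal p) (volume.restrict K') →
      Tendsto (fun n => eLpNorm (fun x => mollify n (K'.indicator f) x - f x) (ENNReal.ofReal p)
        (volume.restrict K)) atTop (𝓝 0) := by
    intro f p hp hf
    have h1 := tendsto_eLpNorm_mollify hp ((memLp_indicator_iff_restrict hK'.measurableSet).2 hf)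
    refine tendsto_of_tendsto_of_tendsto_of_le_of_le tendsto_const_nhds h1 (fun _ => zero_le)
      fun n => ?_
    refine le_trans (le_of_eq ?_) (eLpNorm_restrict_le _ _ _ K)
    refine eLpNorm_congr_ae ?_
    filter_upwards [ae_restrict_mem hK.measurableSet] with x hx
    rw [Set.indicator_of_mem (hKK' hx)]
  refine ⟨fun n => mollify n (K'.indicator u), fun n => contDiff_mollify hui.locallyIntegrable n,
    ?_, ?_, ?_⟩
  · filter_upwards [ae_restrict_of_ae (ae_tendsto_mollify hui.locallyIntegrable),
      ae_restrict_mem hK.measurableSet] with x hx hxK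
    rwa [Set.indicator_of_mem (hKK' hxK)] at hx
  · have := main u 1 le_rfl (by
      rw [ENNReal.ofReal_one, memLp_one_iff_integrable]
      exact hu.integrableOn_compact_subset hδΩ hK')
    simpa using this
  · intro i g hg p hp hgL
    refine (main g p hp (hgL K' hK' hδΩ)).congr' ?_
    have hev : ∀ᶠ n in atTop, (shrinkingBump n).rOut < δ :=
      tendsto_rOut_shrinkingBump.eventually (gt_mem_nhds hδ)
    filter_upwards [hev] with n hn
    refine eLpNorm_congr_ae ?_
    filter_upwards [ae_restrict_mem hK.measurableSet] with x hx
    rw [partialD_mollify hg hK' hδΩ]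
    intro y hy
    exact Metric.mem_cthickening_of_dist_le y x δ K hx ((Metric.mem_closedBall.1 hy).trans hn.le)

end WeakApproximation

/-! ### The chain rule for weak derivatives -/

section ChainRule

variable {Ω : Opens Plane}

theorem MeasureTheory.LocallyIntegrableOn.of_norm_le {u f : Plane → ℝ} (hu : LocallyIntegrableOn u Ω)
    (hf : AEStronglyMeasurable f (volume.restrict (Ω : Set Plane))) {M : ℝ}
    (h : ∀ x, |f x| ≤ M * |u x|) : LocallyIntegrableOn f Ω := by
  rw [locallyIntegrableOn_iff Ω.isOpen.isLocallyClosed]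
  intro K hK hKc
  have h1 := ((hu.integrableOn_compact_subset hK hKc).norm.const_mul M)
  refine h1.mono' (hf.mono_measure (Measure.restrict_mono hK le_rfl)) ?_
  exact Eventually.of_forall h

theorem setIntegral_eq_setIntegral_tsupport (φ : 𝓓(Ω, ℝ)) {f : Plane → ℝ}
    (hf : ∀ x ∉ tsupport φ, f x = 0) :
    ∫ x in Ω, f x = ∫ x in tsupport φ, f x :=
  setIntegral_eq_of_subset_of_forall_sdiff_eq_zero Ω.isOpen.measurableSet φ.tsupport_subset
    fun x hx => hf x hx.2

theorem integral_mul_partialD (φ : 𝓓(Ω, ℝ)) {f : Plane → ℝ} (hf : ContDiff ℝ 1 f) (i : Fin 2) :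
    ∫ x, f x * partialD i φ x = -∫ x, partialD i f x * φ x := by
  have hpc : Continuous (partialD i f) :=
    (hf.continuous_fderiv (by simp)).clm_apply continuous_const
  refine integral_mul_fderiv_eq_neg_fderiv_mul_of_integrable ?_ ?_ ?_ ?_ ?_
  · exact (hpc.mul φ.continuous).integrable_of_hasCompactSupport φ.hasCompactSupport.mul_left
  · exact (hf.continuous.mul (φ.partial i).continuous).integrable_of_hasCompactSupport
      (φ.partial i).hasCompactSupport.mul_left
  · exact (hf.continuous.mul φ.continuous).integrable_of_hasCompactSupport
      φ.hasCompactSupport.mul_left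
  · exact fun x _ => hf.differentiable (by simp) x
  · exact fun x _ => φ.differentiable x

theorem abs_le_mul_abs_of_deriv_le {F : ℝ → ℝ} {M : ℝ} (hF : ContDiff ℝ 1 F)
    (hM : ∀ s, |deriv F s| ≤ M) (a b : ℝ) : |F a - F b| ≤ M * |a - b| := by
  have := Convex.norm_image_sub_le_of_norm_deriv_le (f := F) (C := M) (s := Set.univ) (x := b) (y := a)
    (fun x _ => hF.differentiable (by simp) x) (fun x _ => hM x) convex_univ trivial trivial
  simpa [Real.norm_eq_abs] using this

/-- The chain rule for a weak derivative and a `C¹` function with bounded derivative. -/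
theorem HasWeakPartial.comp {u g : Plane → ℝ} {i : Fin 2} (h : HasWeakPartial Ω i u g)
    {F : ℝ → ℝ} {M : ℝ} (hF : ContDiff ℝ 1 F) (hM : ∀ s, |deriv F s| ≤ M) (hF0 : F 0 = 0) :
    HasWeakPartial Ω i (fun x => F (u x)) (fun x => deriv F (u x) * g x) := by
  have hF'c : Continuous (deriv F) := hF.continuous_deriv (by simp)
  have hFd : Differentiable ℝ F := hF.differentiable (by simp)
  have hum := h.1.aestronglyMeasurable
  have hgm := h.2.1.aestronglyMeasurable
  have hM0 : 0 ≤ M := (abs_nonneg _).trans (hM 0)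
  refine ⟨h.1.of_norm_le (M := M) (hF.continuous.comp_aestronglyMeasurable hum) fun x => ?_,
    h.2.1.of_norm_le (M := M) ((hF'c.comp_aestronglyMeasurable hum).mul hgm) fun x => ?_, ?_⟩
  · simpa [hF0] using abs_le_mul_abs_of_deriv_le hF hM (u x) 0
  · rw [abs_mul]
    exact mul_le_mul_of_nonneg_right (hM _) (abs_nonneg _)
  intro φ
  set K := tsupport φ
  have hK : IsCompact K := φ.hasCompactSupport
  have hKΩ : K ⊆ Ω := φ.tsupport_subset
  have hμ : volume.restrict K ≤ volume.restrict (Ω : Set Plane) := Measure.restrict_mono hKΩ le_rfl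
  obtain ⟨v, hvs, hva, hv1, hvd⟩ := exists_smooth_approx h.1 hK hKΩ
  obtain ⟨A, hA⟩ := φ.exists_bound
  obtain ⟨B, hB⟩ := (φ.partial i).exists_bound
  have hgi := h.2.1.integrableOn_compact_subset hKΩ hK
  have hui := h.1.integrableOn_compact_subset hKΩ hK
  have hvd1 := hvd i g h 1 le_rfl fun L hL hLΩ => by
    rw [ENNReal.ofReal_one, memLp_one_iff_integrable]
    exact h.2.1.integrableOn_compact_subset hLΩ hL
  rw [ENNReal.ofReal_one] at hvd1
  have hFv : ∀ n, ContDiff ℝ 1 (fun x => F (v n x)) := fun n => hF.comp ((hvs n).of_le (by simp))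
  have hpd : ∀ n x, partialD i (fun y => F (v n y)) x = deriv F (v n x) * partialD i (v n) x :=
    fun n x => partialD_comp (hFd _) ((hvs n).differentiable (by simp) x) i
  have hFui : IntegrableOn (fun x => F (u x)) K := by
    refine (hui.norm.const_mul M).mono' ((hF.continuous.comp_aestronglyMeasurable hum).mono_measure hμ) ?_
    exact Eventually.of_forall fun x => by
      simpa [hF0] using abs_le_mul_abs_of_deriv_le hF hM (u x) 0
  have lim1 : Tendsto (fun n => ∫ x in K, partialD i φ x * F (v n x)) atTop
      (𝓝 (∫ x in K, partialD i φ x * F (u x))) := by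
    refine tendsto_integral_bdd_mul_L1 (M := B)
      (fun n => (φ.partial i).continuous.aestronglyMeasurable) (fun n x => hB x)
      (Eventually.of_forall fun x => tendsto_const_nhds)
      (fun n => (hFv n).continuous.continuousOn.integrableOn_compact hK) hFui ?_
    have hz : Tendsto (fun n => ENNReal.ofReal M *
        eLpNorm (fun x => v n x - u x) 1 (volume.restrict K)) atTop (𝓝 0) := by
      simpa using ENNReal.Tendsto.const_mul (a := ENNReal.ofReal M) hv1 (Or.inr ENNReal.ofReal_ne_top)
    refine tendsto_of_tendsto_of_tendsto_of_le_of_le tendsto_const_nhds hz (fun _ => zero_le)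
      fun n => ?_
    refine eLpNorm_le_mul_eLpNorm_of_ae_le_mul (Eventually.of_forall fun x => ?_) 1
    exact abs_le_mul_abs_of_deriv_le hF hM _ _
  -- The factor F'(vₙ) is bounded and converges a.e., while ∂ᵢvₙ converges only in L¹.
  have lim2 : Tendsto (fun n => ∫ x in K, (φ x * deriv F (v n x)) * partialD i (v n) x) atTop
      (𝓝 (∫ x in K, (φ x * deriv F (u x)) * g x)) := by
    refine tendsto_integral_bdd_mul_L1 (M := A * M)
      (fun n => (φ.continuous.mul (hF'c.comp (hvs n).continuous)).aestronglyMeasurable)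
      (fun n x => ?_) ?_
      (fun n => (contDiff_partialD (hvs n) i).continuous.continuousOn.integrableOn_compact hK)
      hgi hvd1
    · rw [abs_mul]
      exact mul_le_mul (hA x) (hM _) (abs_nonneg _) ((norm_nonneg _).trans (hA x))
    · filter_upwards [hva] with x hx
      exact ((hF'c.tendsto _).comp hx).const_mul _
  have key : ∀ n, ∫ x in K, partialD i φ x * F (v n x) =
      -∫ x in K, (φ x * deriv F (v n x)) * partialD i (v n) x := by
    intro n
    have h1 := integral_mul_partialD φ (hFv n) i
    rw [setIntegral_eq_integral_of_forall_compl_eq_zero, setIntegral_eq_integral_of_forall_compl_eq_zero]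
    · rw [← integral_neg] at h1 ⊢
      refine Eq.trans (integral_congr_ae (Eventually.of_forall fun x => ?_)) (h1.trans
        (integral_congr_ae (Eventually.of_forall fun x => ?_)))
      · simp only; ring
      · simp only [hpd]; ring
    · intro x hx
      rw [image_eq_zero_of_notMem_tsupport hx]; simp
    · intro x hx
      rw [show partialD i φ x = 0 from by
        by_contra hne
        exact hx (support_partialD_subset _ _ hne)]
      simp
  have e := tendsto_nhds_unique (lim1.congr key) lim2.neg
  rw [setIntegral_eq_setIntegral_tsupport φ, setIntegral_eq_setIntegral_tsupport φ]
  · refine Eq.trans (integral_congr_ae (Eventually.of_forall fun x => ?_)) (e.trans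
      (congrArg _ (integral_congr_ae (Eventually.of_forall fun x => ?_))))
    · simp only; ring
    · simp only; ring
  · intro x hx
    rw [image_eq_zero_of_notMem_tsupport hx]; simp
  · intro x hx
    rw [show partialD i φ x = 0 from by
      by_contra hne
      exact hx (support_partialD_subset _ _ hne)]
    simp

/-- The chain rule for a weak derivative and a pointwise limit of uniformly Lipschitz `C¹`
functions whose derivatives converge pointwise. -/
theorem HasWeakPartial.comp_of_tendsto {u g : Plane → ℝ} {i : Fin 2} (h : HasWeakPartial Ω i u g)
    {F : ℕ → ℝ → ℝ} {F₀ F₀' : ℝ → ℝ} {M : ℝ} (hF : ∀ n, ContDiff ℝ 1 (F n))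
    (hM : ∀ n s, |deriv (F n) s| ≤ M) (hF0 : ∀ n, F n 0 = 0)
    (hlim : ∀ s, Tendsto (fun n => F n s) atTop (𝓝 (F₀ s)))
    (hlim' : ∀ s, Tendsto (fun n => deriv (F n) s) atTop (𝓝 (F₀' s))) :
    HasWeakPartial Ω i (fun x => F₀ (u x)) (fun x => F₀' (u x) * g x) := by
  have hum := h.1.aestronglyMeasurable
  have hgm := h.2.1.aestronglyMeasurable
  have hFb : ∀ n s, |F n s| ≤ M * |s| := fun n s => by
    simpa [hF0] using abs_le_mul_abs_of_deriv_le (hF n) (hM n) s 0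
  have hFm : ∀ n, AEStronglyMeasurable (fun x => F n (u x)) (volume.restrict (Ω : Set Plane)) :=
    fun n => (hF n).continuous.comp_aestronglyMeasurable hum
  have hFm' : ∀ n, AEStronglyMeasurable (fun x => deriv (F n) (u x) * g x)
      (volume.restrict (Ω : Set Plane)) :=
    fun n => (((hF n).continuous_deriv (by simp)).comp_aestronglyMeasurable hum).mul hgm
  refine ⟨h.1.of_norm_le (M := M) (aestronglyMeasurable_of_tendsto_ae atTop hFm
    (Eventually.of_forall fun x => hlim _)) fun x => ?_,
    h.2.1.of_norm_le (M := M) (aestronglyMeasurable_of_tendsto_ae atTop hFm'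
    (Eventually.of_forall fun x => (hlim' _).mul_const _)) fun x => ?_, fun φ => ?_⟩
  · exact le_of_tendsto (hlim _).abs (Eventually.of_forall fun n => hFb n _)
  · rw [abs_mul]
    exact mul_le_mul_of_nonneg_right
      (le_of_tendsto (hlim' _).abs (Eventually.of_forall fun n => hM n _)) (abs_nonneg _)
  have lim1 : Tendsto (fun n => ∫ x in Ω, F n (u x) * partialD i φ x) atTop
      (𝓝 (∫ x in Ω, F₀ (u x) * partialD i φ x)) := by
    refine tendsto_integral_of_dominated_convergence (fun x => M * ‖u x * partialD i φ x‖)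
      (fun n => (hFm n).mul (φ.partial i).continuous.aestronglyMeasurable)
      ((h.1.integrable_mul_testFunction (φ.partial i)).norm.const_mul M)
      (fun n => Eventually.of_forall fun x => ?_)
      (Eventually.of_forall fun x => (hlim _).mul_const _)
    rw [norm_mul, norm_mul, ← mul_assoc]
    exact mul_le_mul_of_nonneg_right (hFb _ _) (norm_nonneg _)
  have lim2 : Tendsto (fun n => ∫ x in Ω, (deriv (F n) (u x) * g x) * φ x) atTop
      (𝓝 (∫ x in Ω, (F₀' (u x) * g x) * φ x)) := by
    refine tendsto_integral_of_dominated_convergence (fun x => M * ‖g x * φ x‖)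
      (fun n => (hFm' n).mul φ.continuous.aestronglyMeasurable)
      ((h.2.1.integrable_mul_testFunction φ).norm.const_mul M)
      (fun n => Eventually.of_forall fun x => ?_)
      (Eventually.of_forall fun x => ((hlim' _).mul_const _).mul_const _)
    rw [mul_assoc, norm_mul]
    exact mul_le_mul_of_nonneg_right (hM _ _) (norm_nonneg _)
  exact tendsto_nhds_unique (lim1.congr fun n => (h.comp (hF n) (hM n) (hF0 n)).2.2 φ) lim2.neg

/-- A weak derivative vanishes almost everywhere on the zero set of the function. -/
theorem HasWeakPartial.ae_eq_zero_of_eq_zero {u g : Plane → ℝ} {i : Fin 2}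
    (h : HasWeakPartial Ω i u g) :
    ∀ᵐ x ∂(volume.restrict (Ω : Set Plane)), u x = 0 → g x = 0 := by
  -- The functions arctan((n+1)s) / (n+1) tend to 0, while their derivatives tend to the indicator
  -- of {0}. The chain rule in the limit then makes 1_{u=0} g a weak derivative of the zero
  -- function, and uniqueness makes it vanish.
  have hder : ∀ (n : ℕ) (s : ℝ), HasDerivAt
      (fun s => ((n : ℝ) + 1)⁻¹ * Real.arctan (((n : ℝ) + 1) * s)) (1 / (1 + (((n : ℝ) + 1) * s) ^ 2)) s := by
    intro n s
    have h1 : HasDerivAt (fun s : ℝ => ((n : ℝ) + 1) * s) ((n : ℝ) + 1) s := by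
      simpa using (hasDerivAt_id s).const_mul ((n : ℝ) + 1)
    have h2 := (h1.arctan).const_mul (((n : ℝ) + 1)⁻¹)
    have hn : (n : ℝ) + 1 ≠ 0 := by positivity
    rwa [mul_comm (((n : ℝ) + 1)⁻¹) (_ * _), mul_assoc, mul_inv_cancel₀ hn, mul_one] at h2
  have key := h.comp_of_tendsto (M := 1)
    (F := fun n s => ((n : ℝ) + 1)⁻¹ * Real.arctan (((n : ℝ) + 1) * s)) (F₀ := fun _ => 0)
    (F₀' := fun s => if s = 0 then 1 else 0) ?_ ?_ ?_ ?_ ?_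
  · have hz := key.ae_unique (g' := fun _ => 0)
      ⟨key.1, (locallyIntegrable_const (0 : ℝ)).locallyIntegrableOn _, fun φ => by simp⟩
    filter_upwards [hz] with x hx hux
    simpa [hux] using hx
  · intro n
    exact contDiff_const.mul (Real.contDiff_arctan.comp (contDiff_const.mul contDiff_id))
  · intro n s
    rw [(hder n s).deriv, abs_of_nonneg (by positivity)]
    rw [div_le_one (by positivity)]
    nlinarith [sq_nonneg (((n : ℝ) + 1) * s)]
  · intro n
    simp
  · intro s
    have h1 : Tendsto (fun n : ℕ => ((n : ℝ) + 1)⁻¹ * (Real.pi / 2)) atTop (𝓝 0) := by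
      have := (tendsto_one_div_add_atTop_nhds_zero_nat (𝕜 := ℝ)).mul_const (Real.pi / 2)
      simpa using this
    refine squeeze_zero_norm (fun n => ?_) h1
    rw [norm_mul, Real.norm_of_nonneg (by positivity : (0 : ℝ) ≤ ((n : ℝ) + 1)⁻¹)]
    refine mul_le_mul_of_nonneg_left ?_ (by positivity)
    rw [Real.norm_eq_abs, abs_le]
    exact ⟨(Real.neg_pi_div_two_lt_arctan _).le, (Real.arctan_lt_pi_div_two _).le⟩
  · intro s
    simp only [fun n => (hder n s).deriv]
    by_cases hs : s = 0
    · simp [hs]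
    · simp only [hs, if_false]
      have h1 : Tendsto (fun n : ℕ => ((n : ℝ) + 1)) atTop atTop :=
        tendsto_atTop_add_const_right _ _ tendsto_natCast_atTop_atTop
      have h2 : Tendsto (fun n : ℕ => 1 + (((n : ℝ) + 1) * s) ^ 2) atTop atTop := by
        refine tendsto_atTop_add_const_left _ _ ?_
        simp only [mul_pow]
        exact ((tendsto_pow_atTop two_ne_zero).comp h1).atTop_mul_const (by positivity)
      simpa only [one_div] using! h2.inv_tendsto_atTop

end ChainRule

/-! ### The positive part and its weak derivative -/

section SmoothPositivePart

/-- A smooth approximation of the positive part, with derivative `smoothTransition (c * s)`. -/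
noncomputable def smoothPos (c s : ℝ) : ℝ := ∫ t in (0 : ℝ)..s, Real.smoothTransition (c * t)

theorem hasDerivAt_smoothPos (c s : ℝ) :
    HasDerivAt (smoothPos c) (Real.smoothTransition (c * s)) s := by
  have hc : Continuous fun t => Real.smoothTransition (c * t) :=
    Real.smoothTransition.continuous.comp (continuous_const.mul continuous_id)
  exact intervalIntegral.integral_hasDerivAt_right (hc.intervalIntegrable _ _)
    (hc.stronglyMeasurableAtFilter _ _) hc.continuousAt

theorem deriv_smoothPos (c : ℝ) :
    deriv (smoothPos c) = fun s => Real.smoothTransition (c * s) :=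
  funext fun s => (hasDerivAt_smoothPos c s).deriv

theorem contDiff_smoothPos (c : ℝ) : ContDiff ℝ (⊤ : ℕ∞) (smoothPos c) := by
  rw [contDiff_infty_iff_deriv, deriv_smoothPos]
  exact ⟨fun s => (hasDerivAt_smoothPos c s).differentiableAt,
    Real.smoothTransition.contDiff.comp (contDiff_const.mul contDiff_id)⟩

@[simp] theorem smoothPos_zero (c : ℝ) : smoothPos c 0 = 0 := by simp [smoothPos]

theorem smoothPos_of_nonpos {c s : ℝ} (hc : 0 ≤ c) (hs : s ≤ 0) : smoothPos c s = 0 := by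
  unfold smoothPos
  rw [intervalIntegral.integral_congr (g := fun _ => (0 : ℝ)), intervalIntegral.integral_zero]
  intro t ht
  rw [Set.uIcc_of_ge hs] at ht
  exact Real.smoothTransition.zero_of_nonpos (mul_nonpos_of_nonneg_of_nonpos hc ht.2)

theorem smoothPos_nonneg {c : ℝ} (hc : 0 ≤ c) (s : ℝ) : 0 ≤ smoothPos c s := by
  rcases le_total s 0 with hs | hs
  · rw [smoothPos_of_nonpos hc hs]
  · exact intervalIntegral.integral_nonneg hs fun t _ => Real.smoothTransition.nonneg _

theorem abs_deriv_smoothPos_le (c s : ℝ) : |deriv (smoothPos c) s| ≤ 1 := by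
  rw [deriv_smoothPos, abs_of_nonneg (Real.smoothTransition.nonneg _)]
  exact Real.smoothTransition.le_one _

theorem abs_smoothPos_le (c s : ℝ) : |smoothPos c s| ≤ |s| := by
  simpa using abs_le_mul_abs_of_deriv_le ((contDiff_smoothPos c).of_le (by simp))
    (abs_deriv_smoothPos_le c) s 0

theorem tendsto_smoothTransition_mul (s : ℝ) :
    Tendsto (fun n : ℕ => Real.smoothTransition ((n : ℝ) * s)) atTop
      (𝓝 (if 0 < s then 1 else 0)) := by
  by_cases hs : 0 < s
  · rw [if_pos hs]
    have h1 : Tendsto (fun n : ℕ => (n : ℝ) * s) atTop atTop :=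
      tendsto_natCast_atTop_atTop.atTop_mul_const hs
    refine tendsto_const_nhds.congr' ?_
    filter_upwards [h1.eventually_ge_atTop 1] with n hn
    exact (Real.smoothTransition.one_of_one_le hn).symm
  · rw [if_neg hs]
    refine tendsto_const_nhds.congr fun n => ?_
    exact (Real.smoothTransition.zero_of_nonpos
      (mul_nonpos_of_nonneg_of_nonpos (by positivity) (not_lt.1 hs))).symm

theorem tendsto_smoothPos (s : ℝ) :
    Tendsto (fun n : ℕ => smoothPos n s) atTop (𝓝 (max s 0)) := by
  rcases le_total s 0 with hs | hs
  · rw [max_eq_right hs]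
    exact tendsto_const_nhds.congr fun n => (smoothPos_of_nonpos (by positivity) hs).symm
  · rw [max_eq_left hs]
    have : s = ∫ t in (0 : ℝ)..s, (1 : ℝ) := by simp
    nth_rewrite 2 [this]
    refine intervalIntegral.tendsto_integral_filter_of_dominated_convergence (fun _ => (1 : ℝ))
      (Eventually.of_forall fun n => ?_) (Eventually.of_forall fun n => ?_) (by simp) ?_
    · exact (Real.smoothTransition.continuous.comp
        (continuous_const.mul continuous_id)).aestronglyMeasurable
    · refine Eventually.of_forall fun t _ => ?_
      rw [Real.norm_of_nonneg (Real.smoothTransition.nonneg _)]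
      exact Real.smoothTransition.le_one _
    · refine Eventually.of_forall fun t ht => ?_
      rw [Set.uIoc_of_le hs] at ht
      simpa [ht.1] using tendsto_smoothTransition_mul t

theorem HasWeakPartial.posPart {Ω : Opens Plane} {u g : Plane → ℝ} {i : Fin 2}
    (h : HasWeakPartial Ω i u g) :
    HasWeakPartial Ω i (fun x => max (u x) 0) (fun x => (if 0 < u x then 1 else 0) * g x) := by
  refine h.comp_of_tendsto (M := 1) (F := fun n => smoothPos n) (F₀ := fun s => max s 0)
    (F₀' := fun s => if 0 < s then 1 else 0) (fun n => (contDiff_smoothPos n).of_le (by simp))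
    (fun n => abs_deriv_smoothPos_le n) (fun n => smoothPos_zero _) tendsto_smoothPos fun s => ?_
  simp only [deriv_smoothPos]
  exact tendsto_smoothTransition_mul s

end SmoothPositivePart

/-! ### Approximating sequences in H₀¹ -/

section H10

variable {Ω : Opens Plane}

/-- The test functions `φ n` approximate `u` in `W^{1,2}(Ω)` and almost everywhere, and `G` is the
weak gradient of `u`. -/
structure H10Approx (Ω : Opens Plane) (u : Plane → ℝ) (G : Plane → Plane) (φ : ℕ → 𝓓(Ω, ℝ)) :
    Prop where
  memLp : MemLp u 2 (volume.restrict (Ω : Set Plane))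
  grad : HasWeakGradient Ω u G
  memLp_grad : ∀ i, MemLp (fun x => G x i) 2 (volume.restrict (Ω : Set Plane))
  tendsto : Tendsto (fun n => eLpNorm (fun x => φ n x - u x) 2 (volume.restrict Ω)) atTop (𝓝 0)
  tendsto_grad : ∀ i, Tendsto (fun n => eLpNorm (fun x => partialD i (φ n) x - G x i) 2
    (volume.restrict Ω)) atTop (𝓝 0)
  ae_tendsto : ∀ᵐ x ∂(volume.restrict (Ω : Set Plane)), Tendsto (fun n => φ n x) atTop (𝓝 (u x))

/-- L² convergence implies convergence in measure, so a subsequence also converges a.e. This is what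
lets nonlinear functions of the approximants pass to the limit. -/
theorem MemH10.exists_approx {u : Plane → ℝ} (h : MemH10 Ω u) :
    ∃ (G : Plane → Plane) (φ : ℕ → 𝓓(Ω, ℝ)), H10Approx Ω u G φ := by
  obtain ⟨hu, G, hG, hG2, φ, hφ, hφG⟩ := h
  have hm : TendstoInMeasure (volume.restrict (Ω : Set Plane)) (fun n => (φ n : Plane → ℝ)) atTop u :=
    tendstoInMeasure_of_tendsto_eLpNorm (p := 2) two_ne_zero
      (fun n => (φ n).continuous.aestronglyMeasurable) hu.1 hφ
  obtain ⟨ns, hns, hae⟩ := hm.exists_seq_tendsto_ae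
  exact ⟨G, fun n => φ (ns n), hu, hG, hG2, hφ.comp hns.tendsto_atTop,
    fun i => (hφG i).comp hns.tendsto_atTop, hae⟩

theorem partialD_neg (i : Fin 2) (f : Plane → ℝ) (x : Plane) :
    partialD i (fun y => -f y) x = -partialD i f x := by
  simp [partialD, fderiv_fun_neg]

theorem HasWeakPartial.neg {u g : Plane → ℝ} {i : Fin 2} (h : HasWeakPartial Ω i u g) :
    HasWeakPartial Ω i (fun x => -u x) (fun x => -g x) := by
  refine ⟨h.1.neg, h.2.1.neg, fun φ => ?_⟩
  simp only [neg_mul, integral_neg, h.2.2 φ]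

theorem HasWeakGradient.neg {u : Plane → ℝ} {G : Plane → Plane} (h : HasWeakGradient Ω u G) :
    HasWeakGradient Ω (fun x => -u x) (fun x => -G x) := fun i => (h i).neg

theorem HasWeakLaplacian.neg {u w : Plane → ℝ} (h : HasWeakLaplacian Ω u w) :
    HasWeakLaplacian Ω (fun x => -u x) (fun x => -w x) := by
  refine ⟨h.1.neg, h.2.1.neg, fun φ => ?_⟩
  simp only [neg_mul, integral_neg, h.2.2 φ]

/-- The condition ∇u · ∇Δu ≥ 0 is invariant under u ↦ -u, so each statement about {u > 0} has a
mirror image on {u < 0}. -/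
theorem H10Approx.neg {u : Plane → ℝ} {G : Plane → Plane} {φ : ℕ → 𝓓(Ω, ℝ)}
    (h : H10Approx Ω u G φ) : H10Approx Ω (fun x => -u x) (fun x => -G x) (fun n => -φ n) := by
  have hc : ∀ n, ⇑(-φ n) = fun x => -φ n x := fun n => rfl
  refine ⟨h.memLp.neg, h.grad.neg, fun i => (h.memLp_grad i).neg, ?_, fun i => ?_, ?_⟩
  · refine h.tendsto.congr fun n => ?_
    rw [← eLpNorm_neg]
    congr 1
    ext x
    simp
    ring
  · refine (h.tendsto_grad i).congr fun n => ?_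
    rw [← eLpNorm_neg]
    congr 1
    ext x
    simp [hc, partialD_neg]
    ring
  · filter_upwards [h.ae_tendsto] with x hx
    exact hx.neg

end H10

/-! ### Nonlinear test functions: the sign of Δu and superharmonicity of u⁺ -/

section Testing

variable {Ω : Opens Plane}

theorem exists_bound_deriv_smoothTransition : ∃ M : ℝ, ∀ s, |deriv Real.smoothTransition s| ≤ M := by
  have hc : Continuous (deriv Real.smoothTransition) :=
    (Real.smoothTransition.contDiff (n := 1)).continuous_deriv (by simp)
  obtain ⟨M, hM⟩ := isCompact_Icc.exists_bound_of_continuousOn (s := Set.Icc (0 : ℝ) 1) hc.continuousOn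
  refine ⟨M, fun s => ?_⟩
  have hM0 : 0 ≤ M := (norm_nonneg _).trans (hM 0 (by simp))
  by_cases hs : s ∈ Set.Icc (0 : ℝ) 1
  · exact hM s hs
  · have : deriv Real.smoothTransition s = 0 := by
      rw [Set.mem_Icc, not_and_or, not_le, not_le] at hs
      rcases hs with hs | hs
      · have : Real.smoothTransition =ᶠ[𝓝 s] fun _ => 0 := by
          filter_upwards [gt_mem_nhds hs] with t ht
          exact Real.smoothTransition.zero_of_nonpos (le_of_lt ht)
        rw [this.deriv_eq]
        simp
      · have : Real.smoothTransition =ᶠ[𝓝 s] fun _ => 1 := by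
          filter_upwards [lt_mem_nhds hs] with t ht
          exact Real.smoothTransition.one_of_one_le (le_of_lt ht)
        rw [this.deriv_eq]
        simp
    simpa [this] using hM0

theorem deriv_smoothTransition_nonneg (s : ℝ) : 0 ≤ deriv Real.smoothTransition s :=
  Real.smoothTransition.monotone.deriv_nonneg

/-- The weak formulation of `Δu = w`, tested with the product of a test function and a bounded
function of a Sobolev function. -/
theorem HasWeakLaplacian.integral_test_mul {u w v : Plane → ℝ} {G Gv : Plane → Plane}
    (hw : HasWeakLaplacian Ω u w) (hG : HasWeakGradient Ω u G)
    (hG2 : ∀ i, MemLp (fun x => G x i) 2 (volume.restrict (Ω : Set Plane)))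
    (hv : HasWeakGradient Ω v Gv)
    (hv2 : ∀ i, MemLp (fun x => Gv x i) 2 (volume.restrict (Ω : Set Plane)))
    {k : ℝ → ℝ} {A M : ℝ} (hk : ContDiff ℝ (⊤ : ℕ∞) k) (hA : ∀ s, |k s| ≤ A)
    (hM : ∀ s, |deriv k s| ≤ M) (φ : 𝓓(Ω, ℝ)) :
    (∫ x in Ω, k (v x) * ∑ i, G x i * partialD i φ x) +
      ∫ x in Ω, (φ x * deriv k (v x)) * ∑ i, G x i * Gv x i =
      -∫ x in Ω, k (v x) * (w x * φ x) := by
  set K := tsupport φ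
  have hK : IsCompact K := φ.hasCompactSupport
  have hKΩ : K ⊆ Ω := φ.tsupport_subset
  have hμ : volume.restrict K ≤ volume.restrict (Ω : Set Plane) := Measure.restrict_mono hKΩ le_rfl
  have hkc : Continuous k := hk.continuous
  have hk'c : Continuous (deriv k) := hk.continuous_deriv (by simp)
  -- Only `v` needs smoothing: φ k(v'ₙ) is then a test function in Green's formula. Since ∇v'ₙ
  -- converges in L² on the support of φ and ∇u is in L², their product converges in L¹.
  obtain ⟨v', hvs, hva, -, hvd⟩ := exists_smooth_approx (hv 0).1 hK hKΩ
  obtain ⟨B, hB⟩ := φ.exists_bound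
  have hφ0 : ∀ x ∉ K, φ x = 0 := fun x hx => image_eq_zero_of_notMem_tsupport hx
  have hφ0' : ∀ i, ∀ x ∉ K, partialD i φ x = 0 := fun i x hx => by
    by_contra hne
    exact hx (support_partialD_subset _ _ hne)
  have hGK : ∀ i, MemLp (fun x => G x i) 2 (volume.restrict K) := fun i => (hG2 i).mono_measure hμ
  have hvK : ∀ i, MemLp (fun x => Gv x i) 2 (volume.restrict K) := fun i => (hv2 i).mono_measure hμ
  have hvd2 : ∀ i, Tendsto (fun n => eLpNorm (fun x => partialD i (v' n) x - Gv x i) 2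
        (volume.restrict K)) atTop (𝓝 0) := by
    intro i
    have := hvd i _ (hv i) 2 (by norm_num) fun L hL hLΩ => by
      simpa using (hv2 i).mono_measure (Measure.restrict_mono hLΩ le_rfl)
    simpa using this
  have hcm : ∀ i n, AEStronglyMeasurable (partialD i (v' n)) (volume.restrict K) := fun i n =>
    (contDiff_partialD (hvs n) i).continuous.aestronglyMeasurable
  have hcl : ∀ i n, MemLp (partialD i (v' n)) 2 (volume.restrict K) := by
    intro i n
    have hci : IsFiniteMeasure (volume.restrict K) := ⟨by simpa using hK.measure_lt_top⟩
    obtain ⟨C, hC⟩ := hK.exists_bound_of_continuousOn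
      (contDiff_partialD (hvs n) i).continuous.continuousOn
    exact MemLp.of_bound (hcm i n) C ((ae_restrict_iff' hK.measurableSet).2
      (Eventually.of_forall hC))
  have hf1 : Integrable (fun x => ∑ i, G x i * partialD i φ x) (volume.restrict K) :=
    integrable_finsetSum _ fun i _ =>
      ((hG i).2.1.integrable_mul_testFunction (φ.partial i)).mono_measure hμ
  have hf3 : Integrable (fun x => w x * φ x) (volume.restrict K) :=
    (hw.2.1.integrable_mul_testFunction φ).mono_measure hμ
  have lim1 : Tendsto (fun n => ∫ x in K, k (v' n x) * ∑ i, G x i * partialD i φ x) atTop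
      (𝓝 (∫ x in K, k (v x) * ∑ i, G x i * partialD i φ x)) := by
    refine tendsto_integral_bdd_mul_L1 (M := A)
      (fun n => (hkc.comp (hvs n).continuous).aestronglyMeasurable) (fun n x => hA _) ?_
      (fun n => hf1) hf1 (by simp)
    filter_upwards [hva] with x hx using (hkc.tendsto _).comp hx
  have lim3 : Tendsto (fun n => ∫ x in K, k (v' n x) * (w x * φ x)) atTop
      (𝓝 (∫ x in K, k (v x) * (w x * φ x))) := by
    refine tendsto_integral_bdd_mul_L1 (M := A)
      (fun n => (hkc.comp (hvs n).continuous).aestronglyMeasurable) (fun n x => hA _) ?_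
      (fun n => hf3) hf3 (by simp)
    filter_upwards [hva] with x hx using (hkc.tendsto _).comp hx
  have hbd : ∀ s x, |φ x * deriv k s| ≤ B * M := fun s x => by
    rw [abs_mul]
    exact mul_le_mul (hB x) (hM _) (abs_nonneg _) ((norm_nonneg _).trans (hB x))
  have hvm : AEStronglyMeasurable v (volume.restrict K) := (hv 0).1.aestronglyMeasurable.mono_measure hμ
  have int2 : ∀ i (n : ℕ), Integrable (fun x => (φ x * deriv k (v' n x)) * (partialD i (v' n) x * G x i))
      (volume.restrict K) := fun i n =>
    ((hcl i n).integrable_mul_two (hGK i)).bdd_mul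
      (φ.continuous.mul (hk'c.comp (hvs n).continuous)).aestronglyMeasurable
      (Eventually.of_forall fun x => hbd _ x)
  have lim2 : Tendsto (fun n => ∑ i, ∫ x in K, (φ x * deriv k (v' n x)) * (partialD i (v' n) x * G x i))
      atTop (𝓝 (∑ i, ∫ x in K, (φ x * deriv k (v x)) * (Gv x i * G x i))) := by
    refine tendsto_finsetSum _ fun i _ => ?_
    refine tendsto_integral_bdd_mul_L1 (M := B * M)
      (fun n => (φ.continuous.mul (hk'c.comp (hvs n).continuous)).aestronglyMeasurable)
      (fun n x => hbd _ x) ?_ (fun n => (hcl i n).integrable_mul_two (hGK i))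
      ((hvK i).integrable_mul_two (hGK i))
      (tendsto_eLpNorm_one_mul (fun n => (hcm i n).sub (hvK i).1) (hGK i) (hvd2 i))
    filter_upwards [hva] with x hx using ((hk'c.tendsto _).comp hx).const_mul _
  have int1 : ∀ n, Integrable (fun x => k (v' n x) * ∑ i, G x i * partialD i φ x)
      (volume.restrict K) := fun n =>
    hf1.bdd_mul (hkc.comp (hvs n).continuous).aestronglyMeasurable (Eventually.of_forall fun x => hA _)
  have key : ∀ n, (∫ x in K, k (v' n x) * ∑ i, G x i * partialD i φ x) +
      ∑ i, ∫ x in K, (φ x * deriv k (v' n x)) * (partialD i (v' n) x * G x i) =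
      -∫ x in K, k (v' n x) * (w x * φ x) := by
    intro n
    have hks : ContDiff ℝ (⊤ : ℕ∞) (fun x => k (v' n x)) := hk.comp (hvs n)
    have h1 := hw.integral_gradient hG (φ.mulSmooth _ hks)
    have hp : ∀ i x, partialD i (φ.mulSmooth _ hks) x =
        partialD i φ x * k (v' n x) + φ x * (deriv k (v' n x) * partialD i (v' n) x) := by
      intro i x
      rw [TestFunction.coe_mulSmooth, partialD_mul (φ.differentiable x)
        (hks.differentiable (by simp) x), partialD_comp (hk.differentiable (by simp) _)
        ((hvs n).differentiable (by simp) x)]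
    simp only [hp] at h1
    simp only [TestFunction.coe_mulSmooth] at h1
    rw [setIntegral_eq_setIntegral_tsupport φ, setIntegral_eq_setIntegral_tsupport φ] at h1
    · rw [← integral_finsetSum _ fun i _ => int2 i n, ← integral_add (int1 n)
        (integrable_finsetSum _ fun i _ => int2 i n)]
      refine Eq.trans (integral_congr_ae (Eventually.of_forall fun x => ?_)) (h1.trans
        (congrArg _ (integral_congr_ae (Eventually.of_forall fun x => ?_))))
      · simp only [Fin.sum_univ_two]; ring
      · simp only; ring
    · intro x hx
      simp [hφ0 x hx]
    · intro x hx
      simp [hφ0 x hx, hφ0' _ x hx]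
  have e := tendsto_nhds_unique ((lim1.add lim2).congr key) lim3.neg
  rw [setIntegral_eq_setIntegral_tsupport φ, setIntegral_eq_setIntegral_tsupport φ,
    setIntegral_eq_setIntegral_tsupport φ, ← e]
  · congr 1
    rw [← integral_finsetSum]
    · refine integral_congr_ae (Eventually.of_forall fun x => ?_)
      simp only [Fin.sum_univ_two]; ring
    · intro i _
      exact ((hvK i).integrable_mul_two (hGK i)).bdd_mul
        (φ.continuous.aestronglyMeasurable.mul (hk'c.comp_aestronglyMeasurable hvm))
        (Eventually.of_forall fun x => hbd _ x)
  · intro x hx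
    simp [hφ0 x hx]
  · intro x hx
    simp [hφ0 x hx]
  · intro x hx
    simp [hφ0' _ x hx]

/-- This is Fatou's lemma: the nonnegative limit has integral at most `r₀`, hence zero. It spares
proving convergence, or even boundedness in L¹, of the integrands themselves. -/
theorem ae_nonpos_of_integral_le_of_tendsto {α : Type*} [MeasurableSpace α] {μ : Measure α}
    {p : ℕ → α → ℝ} {p₀ : α → ℝ} {r : ℕ → ℝ} {r₀ : ℝ} (hp : ∀ n, Integrable (p n) μ)
    (hp0 : ∀ n x, 0 ≤ p n x) (hle : ∀ n, ∫ x, p n x ∂μ ≤ r n) (hr : Tendsto r atTop (𝓝 r₀))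
    (hr0 : r₀ ≤ 0) (hlim : ∀ᵐ x ∂μ, Tendsto (fun n => p n x) atTop (𝓝 (p₀ x))) :
    ∀ᵐ x ∂μ, p₀ x ≤ 0 := by
  have hpm : AEMeasurable p₀ μ := aemeasurable_of_tendsto_metrizable_ae atTop
    (fun n => (hp n).1.aemeasurable) hlim
  have h1 : ∫⁻ x, ENNReal.ofReal (p₀ x) ∂μ ≤ 0 := by
    calc ∫⁻ x, ENNReal.ofReal (p₀ x) ∂μ
        = ∫⁻ x, liminf (fun n => ENNReal.ofReal (p n x)) atTop ∂μ := by
          refine lintegral_congr_ae ?_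
          filter_upwards [hlim] with x hx
          exact ((ENNReal.continuous_ofReal.tendsto _).comp hx).liminf_eq.symm
      _ ≤ liminf (fun n => ∫⁻ x, ENNReal.ofReal (p n x) ∂μ) atTop :=
          lintegral_liminf_le' fun n => (hp n).1.aemeasurable.ennreal_ofReal
      _ ≤ liminf (fun n => ENNReal.ofReal (r n)) atTop := by
          refine liminf_le_liminf (Eventually.of_forall fun n => ?_)
          rw [← ofReal_integral_eq_lintegral_ofReal (hp n) (Eventually.of_forall (hp0 n))]
          exact ENNReal.ofReal_le_ofReal (hle n)
      _ = ENNReal.ofReal r₀ := ((ENNReal.continuous_ofReal.tendsto _).comp hr).liminf_eq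
      _ = 0 := ENNReal.ofReal_of_nonpos hr0
      _ ≤ 0 := le_rfl
  have h2 := (lintegral_eq_zero_iff' hpm.ennreal_ofReal).1 (le_antisymm h1 zero_le)
  filter_upwards [h2] with x hx
  simpa using hx

/-- If `∇u · ∇Δu ≥ 0` and `u` vanishes on the boundary, then `Δu ≤ 0` where `u > 0`. -/
theorem H10Approx.laplacian_nonpos_of_pos {u w : Plane → ℝ} {G Gw : Plane → Plane}
    {φ : ℕ → 𝓓(Ω, ℝ)} (h : H10Approx Ω u G φ) (hw : HasWeakLaplacian Ω u w)
    (hGw : HasWeakGradient Ω w Gw)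
    (hGw2 : ∀ i, MemLp (fun x => Gw x i) 2 (volume.restrict (Ω : Set Plane)))
    (hin : ∀ᵐ x ∂(volume.restrict (Ω : Set Plane)), 0 ≤ ∑ i, G x i * Gw x i) :
    ∀ᵐ x ∂(volume.restrict (Ω : Set Plane)), 0 < u x → w x ≤ 0 := by
  set T := Real.smoothTransition
  obtain ⟨M, hM⟩ := exists_bound_deriv_smoothTransition
  have hTs : ContDiff ℝ (⊤ : ℕ∞) T := Real.smoothTransition.contDiff
  have hTc : Continuous T := hTs.continuous
  have hT'c : Continuous (deriv T) := hTs.continuous_deriv (by simp)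
  have hT1 : ∀ s, |T s| ≤ 1 := fun s => by
    rw [abs_of_nonneg (Real.smoothTransition.nonneg s)]
    exact Real.smoothTransition.le_one s
  have hT0 : ∀ s, 0 ≤ T s := Real.smoothTransition.nonneg
  have hM0 : 0 ≤ M := (abs_nonneg _).trans (hM 0)
  have hwm : AEStronglyMeasurable w (volume.restrict (Ω : Set Plane)) := hw.2.1.aestronglyMeasurable
  -- The test function is T(w) T(φₙ). Because T vanishes on the negative axis, it selects {w > 0}
  -- and, in the limit, {u > 0}; T' ≥ 0 supplies the signs.
  set χ : ℕ → 𝓓(Ω, ℝ) := fun n => (φ n).comp T hTs Real.smoothTransition.zero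
  have hχ : ∀ n x, χ n x = T (φ n x) := fun n x => rfl
  have hχ' : ∀ n i x, partialD i (χ n) x = deriv T (φ n x) * partialD i (φ n) x := fun n i x =>
    partialD_comp (hTs.differentiable (by simp) _) ((φ n).differentiable x) i
  have hInt : ∀ n i, Integrable (fun x => partialD i (φ n) x * G x i)
      (volume.restrict (Ω : Set Plane)) := fun n i =>
    (((φ n).partial i).memLp 2 _).integrable_mul_two (h.memLp_grad i)
  have lim : Tendsto (fun n => ∑ i, ∫ x in Ω, (T (w x) * deriv T (φ n x)) *
      (partialD i (φ n) x * G x i)) atTop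
      (𝓝 (∑ i, ∫ x in Ω, (T (w x) * deriv T (u x)) * (G x i * G x i))) := by
    refine tendsto_finsetSum _ fun i _ => ?_
    refine tendsto_integral_bdd_mul_L1 (M := 1 * M) (fun n => ?_) (fun n x => ?_) ?_
      (fun n => hInt n i) ((h.memLp_grad i).integrable_mul_two (h.memLp_grad i))
      (tendsto_eLpNorm_one_mul (fun n => ?_) (h.memLp_grad i) (h.tendsto_grad i))
    · exact (hTc.comp_aestronglyMeasurable hwm).mul
        (hT'c.comp (φ n).continuous).aestronglyMeasurable
    · rw [abs_mul]
      exact mul_le_mul (hT1 _) (hM _) (abs_nonneg _) zero_le_one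
    · filter_upwards [h.ae_tendsto] with x hx using ((hT'c.tendsto _).comp hx).const_mul _
    · exact ((φ n).partial i).continuous.aestronglyMeasurable.sub (h.memLp_grad i).1
  -- After the term with ∇u · ∇w ≥ 0 is dropped, ∫ w T(w) T(φₙ) is at most `r n`, whose limit is -∫
  -- T(w) T'(u) |∇u|² ≤ 0.
  have res := ae_nonpos_of_integral_le_of_tendsto (μ := volume.restrict (Ω : Set Plane))
    (p := fun n x => T (w x) * (w x * χ n x)) (p₀ := fun x => T (w x) * (w x * T (u x)))
    (r := fun n => -∑ i, ∫ x in Ω, (T (w x) * deriv T (φ n x)) * (partialD i (φ n) x * G x i))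
    (r₀ := -∑ i, ∫ x in Ω, (T (w x) * deriv T (u x)) * (G x i * G x i)) ?_ ?_ ?_ lim.neg ?_ ?_
  · filter_upwards [res] with x hx hux
    by_contra hw0
    rw [not_le] at hw0
    have := Real.smoothTransition.pos_of_pos hux
    have := Real.smoothTransition.pos_of_pos hw0
    have : 0 < T (w x) * (w x * T (u x)) := by positivity
    linarith
  · intro n
    exact (hw.2.1.integrable_mul_testFunction (χ n)).bdd_mul
      (hTc.comp_aestronglyMeasurable hwm) (Eventually.of_forall fun x => hT1 _)
  · intro n x
    rcases le_total (w x) 0 with h0 | h0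
    · simp [T, Real.smoothTransition.zero_of_nonpos h0]
    · rw [hχ]
      have := hT0 (w x)
      have := hT0 (φ n x)
      positivity
  · intro n
    have h1 := hw.integral_test_mul h.grad h.memLp_grad hGw hGw2 hTs hT1 hM (χ n)
    have h2 : 0 ≤ ∫ x in Ω, (χ n x * deriv T (w x)) * ∑ i, G x i * Gw x i := by
      refine integral_nonneg_of_ae ?_
      filter_upwards [hin] with x hx
      exact mul_nonneg (mul_nonneg (hT0 _) (deriv_smoothTransition_nonneg _)) hx
    have h3 : ∫ x in Ω, T (w x) * ∑ i, G x i * partialD i (χ n) x =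
        ∑ i, ∫ x in Ω, (T (w x) * deriv T (φ n x)) * (partialD i (φ n) x * G x i) := by
      rw [← integral_finsetSum]
      · refine integral_congr_ae (Eventually.of_forall fun x => ?_)
        simp only [Fin.sum_univ_two, hχ']; ring
      · intro i _
        refine (hInt n i).bdd_mul (c := 1 * M) ((hTc.comp_aestronglyMeasurable hwm).mul
          (hT'c.comp (φ n).continuous).aestronglyMeasurable) (Eventually.of_forall fun x => ?_)
        rw [norm_mul]
        exact mul_le_mul (hT1 _) (hM _) (abs_nonneg _) zero_le_one
    linarith
  · rw [neg_nonpos]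
    refine Finset.sum_nonneg fun i _ => integral_nonneg fun x => ?_
    exact mul_nonneg (mul_nonneg (hT0 _) (deriv_smoothTransition_nonneg _)) (mul_self_nonneg _)
  · filter_upwards [h.ae_tendsto] with x hx
    exact (((hTc.tendsto _).comp hx).const_mul _).const_mul _

/-- If `∇u · ∇Δu ≥ 0`, with `∇u = 0` wherever `∇Δu = 0`, and `u` vanishes on the boundary,
then the positive part of `u` is superharmonic. -/
theorem H10Approx.superharmonic_posPart {u w : Plane → ℝ} {G Gw : Plane → Plane}
    {φ : ℕ → 𝓓(Ω, ℝ)} (h : H10Approx Ω u G φ) (hw : HasWeakLaplacian Ω u w)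
    (hGw : HasWeakGradient Ω w Gw)
    (hGw2 : ∀ i, MemLp (fun x => Gw x i) 2 (volume.restrict (Ω : Set Plane)))
    (hin : ∀ᵐ x ∂(volume.restrict (Ω : Set Plane)), 0 ≤ ∑ i, G x i * Gw x i)
    (hzero : ∀ᵐ x ∂(volume.restrict (Ω : Set Plane)), Gw x = 0 → G x = 0)
    (η : 𝓓(Ω, ℝ)) (hη : ∀ x, 0 ≤ η x) :
    ∫ x in Ω, max (u x) 0 * ∑ i, partialD i (partialD i η) x ≤ 0 := by
  set T := Real.smoothTransition
  obtain ⟨M, hM⟩ := exists_bound_deriv_smoothTransition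
  have hTs : ContDiff ℝ (⊤ : ℕ∞) T := Real.smoothTransition.contDiff
  have hT0 : ∀ s, 0 ≤ T s := Real.smoothTransition.nonneg
  have hT1 : ∀ s, |T s| ≤ 1 := fun s => by
    rw [abs_of_nonneg (hT0 s)]
    exact Real.smoothTransition.le_one s
  have hwm : AEStronglyMeasurable w (volume.restrict (Ω : Set Plane)) := hw.2.1.aestronglyMeasurable
  have hpos := h.laplacian_nonpos_of_pos hw hGw hGw2 hin
  have hneg : ∀ᵐ x ∂(volume.restrict (Ω : Set Plane)), u x < 0 → 0 ≤ w x := by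
    have := h.neg.laplacian_nonpos_of_pos hw.neg hGw.neg (fun i => (hGw2 i).neg)
      (by filter_upwards [hin] with x hx; simpa using hx)
    filter_upwards [this] with x hx hux
    have := hx (by linarith)
    linarith
  -- A smooth nonincreasing approximation of the indicator of (-∞, 0), exactly zero for s ≥ 0.
  set k : ℕ → ℝ → ℝ := fun n s => T ((n : ℝ) * (-s))
  have hk : ∀ n, ContDiff ℝ (⊤ : ℕ∞) (k n) := fun n =>
    hTs.comp (contDiff_const.mul contDiff_neg)
  have hk' : ∀ n s, deriv (k n) s = -(n * deriv T (n * (-s))) := by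
    intro n s
    have h1 : HasDerivAt (fun s : ℝ => (n : ℝ) * (-s)) ((n : ℝ) * (-1)) s :=
      ((hasDerivAt_id s).neg).const_mul (n : ℝ)
    have h2 := ((hTs.differentiable (by simp) ((n : ℝ) * (-s))).hasDerivAt.comp s h1).deriv
    rw [show k n = T ∘ fun s : ℝ => (n : ℝ) * (-s) from rfl, h2]
    ring
  have hf : Integrable (fun x => ∑ i, G x i * partialD i η x) (volume.restrict (Ω : Set Plane)) :=
    integrable_finsetSum _ fun i _ => (h.grad i).2.1.integrable_mul_testFunction (η.partial i)
  -- In the identity tested with η kₙ(w), the term with kₙ'(w) ∇u · ∇w is nonpositive since kₙ' ≤ 0,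
  -- and -∫ kₙ(w) w η is nonnegative since kₙ(w) is supported in {w < 0}.
  have hstep : ∀ n, 0 ≤ ∫ x in Ω, k n (w x) * ∑ i, G x i * partialD i η x := by
    intro n
    have h1 := hw.integral_test_mul h.grad h.memLp_grad hGw hGw2 (hk n) (A := 1) (M := n * M)
      (fun s => hT1 _) (fun s => by
        rw [hk', abs_neg, abs_mul, abs_of_nonneg (by positivity : (0 : ℝ) ≤ n)]
        exact mul_le_mul_of_nonneg_left (hM _) (by positivity)) η
    have h2 : ∫ x in Ω, (η x * deriv (k n) (w x)) * ∑ i, G x i * Gw x i ≤ 0 := by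
      refine integral_nonpos_of_ae ?_
      filter_upwards [hin] with x hx
      refine mul_nonpos_of_nonpos_of_nonneg (mul_nonpos_of_nonneg_of_nonpos (hη x) ?_) hx
      rw [hk', neg_nonpos]
      exact mul_nonneg (by positivity) (deriv_smoothTransition_nonneg _)
    have h3 : ∫ x in Ω, k n (w x) * (w x * η x) ≤ 0 := by
      refine integral_nonpos fun x => ?_
      rcases le_total (w x) 0 with h0 | h0
      · exact mul_nonpos_of_nonneg_of_nonpos (hT0 _) (mul_nonpos_of_nonpos_of_nonneg h0 (hη x))
      · have : k n (w x) = 0 := Real.smoothTransition.zero_of_nonpos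
          (mul_nonpos_of_nonneg_of_nonpos (by positivity) (by linarith))
        simp [this]
    linarith
  have lim : Tendsto (fun n => ∫ x in Ω, k n (w x) * ∑ i, G x i * partialD i η x) atTop
      (𝓝 (∫ x in Ω, (if 0 < -w x then 1 else 0) * ∑ i, G x i * partialD i η x)) := by
    refine tendsto_integral_bdd_mul_L1 (M := 1)
      (fun n => (hk n).continuous.comp_aestronglyMeasurable hwm) (fun n x => hT1 _)
      (Eventually.of_forall fun x => tendsto_smoothTransition_mul _) (fun n => hf) hf (by simp)
  have hfin := ge_of_tendsto lim (Eventually.of_forall hstep)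
  have hpp : ∀ i, HasWeakPartial Ω i (fun x => max (u x) 0)
      (fun x => (if 0 < u x then 1 else 0) * G x i) := fun i => (h.grad i).posPart
  have e1 : ∫ x in Ω, max (u x) 0 * ∑ i, partialD i (partialD i η) x =
      -∫ x in Ω, ∑ i, ((if 0 < u x then 1 else 0) * G x i) * partialD i η x := by
    simp only [Finset.mul_sum]
    rw [integral_finsetSum, integral_finsetSum, ← Finset.sum_neg_distrib]
    · exact Finset.sum_congr rfl fun i _ => (hpp i).2.2 (η.partial i)
    · exact fun i _ => (hpp i).2.1.integrable_mul_testFunction (η.partial i)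
    · exact fun i _ => (hpp i).1.integrable_mul_testFunction ((η.partial i).partial i)
  have hz1 : ∀ᵐ x ∂(volume.restrict (Ω : Set Plane)), u x = 0 → ∀ i, G x i = 0 := by
    filter_upwards [ae_all_iff.2 fun i => (h.grad i).ae_eq_zero_of_eq_zero] with x hx hux i
    exact hx i hux
  have hz2 : ∀ᵐ x ∂(volume.restrict (Ω : Set Plane)), w x = 0 → Gw x = 0 := by
    filter_upwards [ae_all_iff.2 fun i => (hGw i).ae_eq_zero_of_eq_zero] with x hx hux
    ext i
    exact hx i hux
  rw [e1, neg_nonpos]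
  refine hfin.trans (le_of_eq (integral_congr_ae ?_))
  -- The indicators of {w < 0} and {u > 0} agree a.e. except where ∇u = 0. If u > 0 then w ≤ 0, and
  -- w = 0 forces ∇w = 0 and so ∇u = 0; if u < 0 then w ≥ 0; if u = 0 then ∇u = 0.
  filter_upwards [hpos, hneg, hz1, hz2, hzero] with x h1 h2 h3 h4 h5
  simp only [mul_assoc, ← Finset.mul_sum]
  by_cases hu : 0 < u x
  · rcases (h1 hu).lt_or_eq with hlt | heq
    · simp [hu, hlt]
    · simp [h5 (h4 heq)]
  · rcases (not_lt.1 hu).lt_or_eq with hlt | heq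
    · simp [hu, not_lt.2 (h2 hlt)]
    · simp [h3 heq]

end Testing

/-! ### A radial bump profile and its Laplacian -/

section RadialProfile

/-- A smooth decreasing profile, positive on `(-∞, 1)` and zero on `[1, ∞)`. -/
noncomputable def radialProfile (t : ℝ) : ℝ := expNegInvGlue (1 - t)

theorem contDiff_radialProfile : ContDiff ℝ (⊤ : ℕ∞) radialProfile :=
  expNegInvGlue.contDiff.comp (contDiff_const.sub contDiff_id)

theorem contDiff_deriv_radialProfile : ContDiff ℝ (⊤ : ℕ∞) (deriv radialProfile) :=
  (contDiff_infty_iff_deriv.1 contDiff_radialProfile).2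

theorem contDiff_deriv_deriv_radialProfile : ContDiff ℝ (⊤ : ℕ∞) (deriv (deriv radialProfile)) :=
  (contDiff_infty_iff_deriv.1 contDiff_deriv_radialProfile).2

theorem radialProfile_nonneg (t : ℝ) : 0 ≤ radialProfile t := expNegInvGlue.nonneg _

theorem radialProfile_of_one_le {t : ℝ} (ht : 1 ≤ t) : radialProfile t = 0 :=
  expNegInvGlue.zero_of_nonpos (by linarith)

theorem deriv_radialProfile (t : ℝ) :
    deriv radialProfile t = -(((1 - t)⁻¹) ^ 2 * expNegInvGlue (1 - t)) := by
  have h1 := expNegInvGlue.hasDerivAt_polynomial_eval_inv_mul 1 (1 - t)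
  have h2 : HasDerivAt (fun t : ℝ => 1 - t) (-1) t := by
    simpa using (hasDerivAt_id t).const_sub 1
  have h3 := (h1.comp t h2).deriv
  simp only [Function.comp_def, Polynomial.eval_one, one_mul] at h3
  change deriv (fun t => expNegInvGlue (1 - t)) t = _
  rw [h3]
  simp

theorem deriv_radialProfile_nonpos (t : ℝ) : deriv radialProfile t ≤ 0 := by
  rw [deriv_radialProfile, neg_nonpos]
  exact mul_nonneg (sq_nonneg _) (expNegInvGlue.nonneg _)

theorem deriv_radialProfile_neg {t : ℝ} (ht : t < 1) : deriv radialProfile t < 0 := by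
  rw [deriv_radialProfile, neg_lt_zero]
  have h : 0 < 1 - t := by linarith
  have := expNegInvGlue.pos_of_pos h
  positivity

theorem deriv_radialProfile_of_one_le {t : ℝ} (ht : 1 ≤ t) : deriv radialProfile t = 0 := by
  rw [deriv_radialProfile, expNegInvGlue.zero_of_nonpos (by linarith)]
  simp

theorem exists_bound_deriv_radialProfile : ∃ C : ℝ, 0 ≤ C ∧ ∀ t, 0 ≤ t → |deriv radialProfile t| ≤ C := by
  obtain ⟨C, hC⟩ := isCompact_Icc.exists_bound_of_continuousOn (s := Set.Icc (0 : ℝ) 1)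
    contDiff_deriv_radialProfile.continuous.continuousOn
  have hC0 : 0 ≤ C := (norm_nonneg _).trans (hC 0 (by simp))
  refine ⟨C, hC0, fun t ht => ?_⟩
  rcases le_total t 1 with h1 | h1
  · exact hC t ⟨ht, h1⟩
  · simpa [deriv_radialProfile_of_one_le h1] using hC0

theorem partialD_norm_sub_sq (s : ℝ) (x y : Plane) (i : Fin 2) :
    partialD i (fun y => s * ‖y - x‖ ^ 2) y = 2 * s * (y i - x i) := by
  have h1 : HasFDerivAt (fun y : Plane => ‖y - x‖ ^ 2) (2 • innerSL ℝ (y - x)) y := by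
    have := (hasStrictFDerivAt_norm_sq (y - x)).hasFDerivAt.comp y ((hasFDerivAt_id y).sub_const x)
    simpa [Function.comp_def] using! this
  rw [partialD_const_mul h1.differentiableAt, partialD, h1.fderiv]
  simp [EuclideanSpace.inner_single_right]
  ring

theorem partialD_coord_sub (c : ℝ) (x y : Plane) (i : Fin 2) :
    partialD i (fun y => c * (y i - x i)) y = c := by
  have h1 : HasFDerivAt (fun y : Plane => y i - x i) (EuclideanSpace.proj i : Plane →L[ℝ] ℝ) y :=
    (EuclideanSpace.proj i : Plane →L[ℝ] ℝ).hasFDerivAt.sub_const _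
  rw [partialD_const_mul h1.differentiableAt, partialD, h1.fderiv]
  simp

/-- With h the profile and t = ‖y - x‖², the right side is 4s times the derivative in s of s h'(s
t); the two first-order terms 2s h' add up to 4s h' because the dimension is two. Thus the scale
derivative of a weighted mean of u is an integral of u against a Laplacian. -/
theorem laplacian_radialProfile (s : ℝ) (x y : Plane) :
    ∑ i, partialD i (partialD i fun y => radialProfile (s * ‖y - x‖ ^ 2)) y =
      4 * s * (deriv radialProfile (s * ‖y - x‖ ^ 2) +
        s * ‖y - x‖ ^ 2 * deriv (deriv radialProfile) (s * ‖y - x‖ ^ 2)) := by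
  have hN : ContDiff ℝ (⊤ : ℕ∞) fun y : Plane => s * ‖y - x‖ ^ 2 :=
    contDiff_const.mul ((contDiff_norm_sq ℝ).comp (contDiff_id.sub contDiff_const))
  have hNd : Differentiable ℝ fun y : Plane => s * ‖y - x‖ ^ 2 := hN.differentiable (by simp)
  have h1 : ∀ i, (partialD i fun y => radialProfile (s * ‖y - x‖ ^ 2)) =
      fun y => deriv radialProfile (s * ‖y - x‖ ^ 2) * (2 * s * (y i - x i)) := by
    intro i
    ext y
    rw [partialD_comp (contDiff_radialProfile.differentiable (by simp) _) (hNd y),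
      partialD_norm_sub_sq]
  have hcd : ∀ i, DifferentiableAt ℝ (fun y : Plane => 2 * s * (y i - x i)) y := fun i =>
    (((EuclideanSpace.proj i : Plane →L[ℝ] ℝ).differentiableAt).sub_const _).const_mul _
  have h2 : ∀ i, partialD i (partialD i fun y => radialProfile (s * ‖y - x‖ ^ 2)) y =
      deriv (deriv radialProfile) (s * ‖y - x‖ ^ 2) * (2 * s * (y i - x i)) * (2 * s * (y i - x i)) +
      deriv radialProfile (s * ‖y - x‖ ^ 2) * (2 * s) := by
    intro i
    have hpd : DifferentiableAt ℝ (fun y => deriv radialProfile (s * ‖y - x‖ ^ 2)) y :=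
      (contDiff_deriv_radialProfile.differentiable (by simp) _).comp y (hNd y)
    rw [h1, partialD_mul hpd (hcd i), partialD_comp (contDiff_deriv_radialProfile.differentiable (by simp) _) (hNd y),
      partialD_norm_sub_sq, partialD_coord_sub]
  have h3 : ‖y - x‖ ^ 2 = (y 0 - x 0) ^ 2 + (y 1 - x 1) ^ 2 := by
    rw [EuclideanSpace.norm_sq_eq]
    simp [Fin.sum_univ_two]
  simp only [h2, Fin.sum_univ_two]
  rw [h3]
  ring

end RadialProfile

/-! ### The strong minimum principle for superharmonic functions -/

section StrongMinimum

variable {Ω : Opens Plane}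

/-- The function `u` is superharmonic in the sense of distributions. -/
def IsWeaklySuperharmonic (Ω : Opens Plane) (u : Plane → ℝ) : Prop :=
  ∀ η : 𝓓(Ω, ℝ), (∀ x, 0 ≤ η x) → ∫ x in Ω, u x * ∑ i, partialD i (partialD i η) x ≤ 0

/-- The weighted mean of `u` over the ball of radius `s ^ (-1/2)` about `x`. -/
noncomputable def radialMean (u : Plane → ℝ) (x : Plane) (R s : ℝ) : ℝ :=
  ∫ y in Metric.closedBall x R, u y * (-(s * deriv radialProfile (s * ‖y - x‖ ^ 2)))

/-- Differentiation under the integral sign: the derivative of the weight is continuous in (s, ‖y -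
x‖²), so it is bounded on the compact set [s - 1, s + 1] × [0, R²], and `u` is integrable. -/
theorem hasDerivAt_radialMean {u : Plane → ℝ} {x : Plane} {R : ℝ}
    (hu : IntegrableOn u (Metric.closedBall x R)) (s : ℝ) :
    HasDerivAt (radialMean u x R) (∫ y in Metric.closedBall x R, u y *
      (-(deriv radialProfile (s * ‖y - x‖ ^ 2) +
        s * ‖y - x‖ ^ 2 * deriv (deriv radialProfile) (s * ‖y - x‖ ^ 2)))) s := by
  set D : ℝ → ℝ → ℝ := fun s t => -(deriv radialProfile (s * t) +
    s * t * deriv (deriv radialProfile) (s * t)) with hD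
  have c1 := contDiff_deriv_radialProfile.continuous
  have c2 := contDiff_deriv_deriv_radialProfile.continuous
  have hDc : Continuous fun p : ℝ × ℝ => D p.1 p.2 := by
    simp only [hD]
    fun_prop
  obtain ⟨C, hC⟩ := (isCompact_Icc.prod isCompact_Icc).exists_bound_of_continuousOn
    (s := Set.Icc (s - 1) (s + 1) ×ˢ Set.Icc (0 : ℝ) (R ^ 2)) hDc.continuousOn
  have hcy : Continuous fun y : Plane => ‖y - x‖ ^ 2 := by fun_prop
  have hm := hu.aestronglyMeasurable
  refine (hasDerivAt_integral_of_dominated_loc_of_deriv_le (μ := volume.restrict (Metric.closedBall x R))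
    (F := fun s y => u y * (-(s * deriv radialProfile (s * ‖y - x‖ ^ 2))))
    (F' := fun s y => u y * D s (‖y - x‖ ^ 2)) (bound := fun y => ‖u y‖ * C)
    (s := Metric.ball s 1) (Metric.ball_mem_nhds s one_pos) ?_ ?_ ?_ ?_ ?_ ?_).2
  · refine Eventually.of_forall fun s => hm.mul (Continuous.aestronglyMeasurable ?_)
    fun_prop
  · refine hu.mul_continuousOn (Continuous.continuousOn ?_) (isCompact_closedBall x R)
    fun_prop
  · exact hm.mul (hDc.comp (continuous_const.prodMk hcy)).aestronglyMeasurable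
  · filter_upwards [ae_restrict_mem measurableSet_closedBall] with y hy s' hs'
    rw [norm_mul]
    refine mul_le_mul_of_nonneg_left (hC (s', ‖y - x‖ ^ 2) ⟨?_, ?_⟩) (norm_nonneg _)
    · rw [Metric.mem_ball, Real.dist_eq, abs_lt] at hs'
      constructor <;> simp only <;> linarith
    · rw [mem_closedBall_iff_norm] at hy
      exact ⟨by positivity, pow_le_pow_left₀ (norm_nonneg _) hy 2⟩
  · exact hu.norm.mul_const C
  · refine Eventually.of_forall fun y s' _ => ?_
    have h1 : HasDerivAt (fun s : ℝ => s * ‖y - x‖ ^ 2) (‖y - x‖ ^ 2) s' := by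
      simpa using (hasDerivAt_id s').mul_const (‖y - x‖ ^ 2)
    have h2 := (contDiff_deriv_radialProfile.differentiable (by simp)
      (s' * ‖y - x‖ ^ 2)).hasDerivAt.comp s' h1
    have h3 := ((hasDerivAt_id s').mul h2).neg.const_mul (u y)
    convert! h3 using 1
    simp only [hD, id, Function.comp_apply]
    ring

/-- The integrand is -1/(4s) times u Δζ, where ζ(y) is the profile at s ‖y - x‖². For s ≥ 1 / R²
this ζ is a nonnegative test function supported in the ball of radius R, so superharmonicity gives
the sign: the means grow as the balls shrink. -/
theorem IsWeaklySuperharmonic.deriv_radialMean_nonneg {u : Plane → ℝ} (h : IsWeaklySuperharmonic Ω u)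
    {x : Plane} {R s : ℝ} (hR : 0 < R) (hball : Metric.closedBall x R ⊆ Ω) (hs : 1 / R ^ 2 ≤ s) :
    0 ≤ ∫ y in Metric.closedBall x R, u y * (-(deriv radialProfile (s * ‖y - x‖ ^ 2) +
        s * ‖y - x‖ ^ 2 * deriv (deriv radialProfile) (s * ‖y - x‖ ^ 2))) := by
  have hs0 : 0 < s := lt_of_lt_of_le (by positivity) hs
  set ζ : Plane → ℝ := fun y => radialProfile (s * ‖y - x‖ ^ 2) with hζ
  have hsupp : Function.support ζ ⊆ Metric.closedBall x R := by
    intro y hy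
    by_contra hne
    rw [mem_closedBall_iff_norm, not_le] at hne
    apply hy
    apply radialProfile_of_one_le
    rw [div_le_iff₀ (by positivity)] at hs
    have : R ^ 2 ≤ ‖y - x‖ ^ 2 := pow_le_pow_left₀ hR.le hne.le 2
    nlinarith
  have hts : tsupport ζ ⊆ Metric.closedBall x R := closure_minimal hsupp Metric.isClosed_closedBall
  set η : 𝓓(Ω, ℝ) := ⟨ζ, contDiff_radialProfile.comp
    (contDiff_const.mul ((contDiff_norm_sq ℝ).comp (contDiff_id.sub contDiff_const))),
    HasCompactSupport.of_support_subset_isCompact (isCompact_closedBall _ _) hsupp,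
    hts.trans hball⟩
  have h1 := h η fun y => radialProfile_nonneg _
  have h2 : ∀ y, ∑ i, partialD i (partialD i η) y = 4 * s * (deriv radialProfile (s * ‖y - x‖ ^ 2) +
        s * ‖y - x‖ ^ 2 * deriv (deriv radialProfile) (s * ‖y - x‖ ^ 2)) :=
    fun y => laplacian_radialProfile s x y
  have h3 : ∫ y in Ω, u y * ∑ i, partialD i (partialD i η) y =
      ∫ y in Metric.closedBall x R, u y * ∑ i, partialD i (partialD i η) y := by
    refine setIntegral_eq_of_subset_of_forall_sdiff_eq_zero Ω.isOpen.measurableSet hball fun y hy => ?_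
    have : ∀ i, partialD i (partialD i η) y = 0 := fun i => by
      by_contra hne
      exact hy.2 (hts (closure_minimal (support_partialD_subset _ _) (isClosed_tsupport _)
        (support_partialD_subset _ _ hne)))
    simp [this]
  rw [h3] at h1
  have h4 : ∫ y in Metric.closedBall x R, u y * (-(deriv radialProfile (s * ‖y - x‖ ^ 2) +
        s * ‖y - x‖ ^ 2 * deriv (deriv radialProfile) (s * ‖y - x‖ ^ 2))) =
      -(1 / (4 * s)) * ∫ y in Metric.closedBall x R, u y * ∑ i, partialD i (partialD i η) y := by
    rw [← integral_const_mul]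
    refine integral_congr_ae (Eventually.of_forall fun y => ?_)
    simp only [h2]
    field_simp
  rw [h4]
  exact mul_nonneg_of_nonpos_of_nonpos (by rw [neg_nonpos]; positivity) h1

theorem radialMean_nonneg {u : Plane → ℝ} (hu0 : ∀ y, 0 ≤ u y) (x : Plane) (R : ℝ) {s : ℝ}
    (hs : 0 ≤ s) : 0 ≤ radialMean u x R s := by
  refine integral_nonneg fun y => mul_nonneg (hu0 y) ?_
  rw [Left.nonneg_neg_iff]
  exact mul_nonpos_of_nonneg_of_nonpos hs (deriv_radialProfile_nonpos _)

/-- The radial means are nonnegative, nondecreasing in s, and dominated by averages over balls of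
radius s^(-1/2), which tend to 0 as s → ∞. So they vanish for every s ≥ 1 / R². At s = 1 / r² the
weight is strictly positive on the ball of radius r, which forces u = 0 there. -/
theorem IsWeaklySuperharmonic.ae_eq_zero_of_tendsto_average {u : Plane → ℝ}
    (h : IsWeaklySuperharmonic Ω u) (hu : LocallyIntegrableOn u Ω) (hu0 : ∀ y, 0 ≤ u y)
    {x : Plane} {R : ℝ} (hball : Metric.closedBall x R ⊆ Ω)
    (hx : Tendsto (fun r => ⨍ y in Metric.closedBall x r, u y) (𝓝[>] 0) (𝓝 0))
    {r : ℝ} (hr0 : 0 < r) (hr : r < R) :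
    ∀ᵐ y ∂(volume : Measure Plane), y ∈ Metric.ball x r → u y = 0 := by
  have hR : 0 < R := hr0.trans hr
  have hui : IntegrableOn u (Metric.closedBall x R) :=
    hu.integrableOn_compact_subset hball (isCompact_closedBall _ _)
  have hmono : MonotoneOn (radialMean u x R) (Set.Ici (1 / R ^ 2)) := by
    refine monotoneOn_of_deriv_nonneg (convex_Ici _)
      (fun s _ => (hasDerivAt_radialMean hui s).continuousAt.continuousWithinAt)
      (fun s _ => (hasDerivAt_radialMean hui s).differentiableAt.differentiableWithinAt)
      fun s hs => ?_
    rw [(hasDerivAt_radialMean hui s).deriv]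
    exact h.deriv_radialMean_nonneg hR hball (interior_subset hs)
  obtain ⟨C, hC0, hC⟩ := exists_bound_deriv_radialProfile
  -- The weight is at most C / ρ² and lives on the ball of radius ρ, whose area is ρ² times that of
  -- the unit ball.
  have hbound : ∀ ρ : ℝ, 0 < ρ → ρ ≤ R → radialMean u x R (1 / ρ ^ 2) ≤
      C * volume.real (Metric.ball (0 : Plane) 1) * ⨍ y in Metric.closedBall x ρ, u y := by
    intro ρ hρ hρR
    have hsub : Metric.closedBall x ρ ⊆ Metric.closedBall x R := Metric.closedBall_subset_closedBall hρR
    have e1 : radialMean u x R (1 / ρ ^ 2) = ∫ y in Metric.closedBall x ρ,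
        u y * (-(1 / ρ ^ 2 * deriv radialProfile (1 / ρ ^ 2 * ‖y - x‖ ^ 2))) := by
      refine setIntegral_eq_of_subset_of_forall_sdiff_eq_zero measurableSet_closedBall hsub
        fun y hy => ?_
      rw [deriv_radialProfile_of_one_le]
      · simp
      · have := hy.2
        rw [mem_closedBall_iff_norm, not_le] at this
        rw [one_div, ← div_eq_inv_mul, le_div_iff₀ (by positivity), one_mul]
        exact pow_le_pow_left₀ hρ.le this.le 2
    have hc1 := contDiff_deriv_radialProfile.continuous
    have e2 : radialMean u x R (1 / ρ ^ 2) ≤ ∫ y in Metric.closedBall x ρ, u y * (1 / ρ ^ 2 * C) := by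
      rw [e1]
      refine integral_mono ?_ ((hui.mono_set hsub).mul_const _) fun y => ?_
      · refine (hui.mono_set hsub).mul_continuousOn (Continuous.continuousOn ?_)
          (isCompact_closedBall x ρ)
        fun_prop
      · refine mul_le_mul_of_nonneg_left ?_ (hu0 y)
        rw [← mul_neg]
        exact mul_le_mul_of_nonneg_left ((neg_le_abs _).trans (hC _ (by positivity))) (by positivity)
    refine e2.trans (le_of_eq ?_)
    rw [integral_mul_const, setAverage_eq, Measure.addHaar_real_closedBall _ _ hρ.le]
    have hv : 0 < volume.real (Metric.ball (0 : Plane) 1) :=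
      ENNReal.toReal_pos (Metric.measure_ball_pos volume _ one_pos).ne' measure_ball_lt_top.ne
    simp only [finrank_euclideanSpace, Fintype.card_fin, smul_eq_mul]
    field_simp
  have hle : ∀ s, 1 / R ^ 2 ≤ s → radialMean u x R s ≤ 0 := by
    intro s hs
    have hs0 : 0 < s := lt_of_lt_of_le (by positivity) hs
    have hlim := hx.const_mul (C * volume.real (Metric.ball (0 : Plane) 1))
    rw [mul_zero] at hlim
    refine ge_of_tendsto hlim ?_
    have hev : ∀ᶠ ρ : ℝ in 𝓝[>] 0, ρ < min R (1 / Real.sqrt s) :=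
      (gt_mem_nhds (lt_min hR (by positivity))).filter_mono nhdsWithin_le_nhds
    filter_upwards [hev, self_mem_nhdsWithin] with ρ hρ hρ0
    have hρ0 : 0 < ρ := hρ0
    have hρs : s ≤ 1 / ρ ^ 2 := by
      have h1 := (hρ.trans_le (min_le_right _ _)).le
      rw [le_div_iff₀ (by positivity)] at h1 ⊢
      have h2 : (ρ * Real.sqrt s) ^ 2 ≤ 1 := pow_le_one₀ (by positivity) h1
      rw [mul_pow, Real.sq_sqrt hs0.le] at h2
      linarith
    exact (hmono hs (hs.trans hρs) hρs).trans (hbound ρ hρ0 (hρ.trans_le (min_le_left _ _)).le)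
  have hsr : 1 / R ^ 2 ≤ 1 / r ^ 2 := one_div_le_one_div_of_le (by positivity)
    (pow_le_pow_left₀ hr0.le hr.le 2)
  have hzero : radialMean u x R (1 / r ^ 2) = 0 :=
    le_antisymm (hle _ hsr) (radialMean_nonneg hu0 x R (by positivity))
  have hc1 := contDiff_deriv_radialProfile.continuous
  unfold radialMean at hzero
  rw [integral_eq_zero_iff_of_nonneg] at hzero
  · have := (ae_restrict_iff' measurableSet_closedBall).1 hzero
    filter_upwards [this] with y hy hyr
    rw [mem_ball_iff_norm] at hyr
    have h1 := hy (by rw [mem_closedBall_iff_norm]; exact (hyr.trans hr).le)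
    simp only [Pi.zero_apply, mul_eq_zero, neg_eq_zero] at h1
    have h2 : deriv radialProfile (1 / r ^ 2 * ‖y - x‖ ^ 2) < 0 := by
      apply deriv_radialProfile_neg
      rw [one_div, ← div_eq_inv_mul, div_lt_one (by positivity)]
      exact pow_lt_pow_left₀ hyr (norm_nonneg _) two_ne_zero
    rcases h1 with h1 | h1 | h1
    · exact h1
    · exact absurd h1 (by positivity)
    · exact absurd h1 h2.ne
  · intro y
    refine mul_nonneg (hu0 y) ?_
    rw [Left.nonneg_neg_iff]
    exact mul_nonpos_of_nonneg_of_nonpos (by positivity) (deriv_radialProfile_nonpos _)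
  · refine hui.mul_continuousOn (Continuous.continuousOn ?_) (isCompact_closedBall x R)
    fun_prop

/-- If u is not a.e. positive on the small ball, it vanishes on a set of positive measure there,
which contains a Lebesgue point x, and the averages of u about x tend to 0. The ball of radius 3R
about x lies in the ball of radius 4R about x₀, and that of radius 2R about x contains the ball of
radius R about x₀. -/
theorem IsWeaklySuperharmonic.ball_dichotomy {u : Plane → ℝ}
    (h : IsWeaklySuperharmonic Ω u) (hu : LocallyIntegrableOn u Ω) (hu0 : ∀ y, 0 ≤ u y)
    {x₀ : Plane} {R : ℝ} (hR : 0 < R) (hball : Metric.closedBall x₀ (4 * R) ⊆ Ω) :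
    (∀ᵐ y ∂(volume : Measure Plane), y ∈ Metric.ball x₀ R → u y = 0) ∨
      ∀ᵐ y ∂(volume : Measure Plane), y ∈ Metric.ball x₀ R → 0 < u y := by
  by_cases hpos : ∀ᵐ y ∂(volume : Measure Plane), y ∈ Metric.ball x₀ R → 0 < u y
  · exact Or.inr hpos
  left
  set B := Metric.closedBall x₀ (4 * R)
  have hfi : Integrable (B.indicator u) :=
    (hu.integrableOn_compact_subset hball (isCompact_closedBall _ _)).integrable_indicator
      measurableSet_closedBall
  have hleb := (Besicovitch.vitaliFamily (volume : Measure Plane)).ae_tendsto_average_norm_sub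
    hfi.locallyIntegrable
  have hfreq : ∃ᵐ y ∂(volume : Measure Plane), ¬ (y ∈ Metric.ball x₀ R → 0 < u y) :=
    not_eventually.1 hpos
  obtain ⟨x, hx1, hx2⟩ := (hfreq.and_eventually hleb).exists
  push Not at hx1
  have hux : u x = 0 := le_antisymm hx1.2 (hu0 x)
  have hd : dist x x₀ < R := Metric.mem_ball.1 hx1.1
  have hxB : Metric.closedBall x (3 * R) ⊆ B := by
    apply Metric.closedBall_subset_closedBall'
    linarith
  have ht : Tendsto (fun r => ⨍ y in Metric.closedBall x r, u y) (𝓝[>] 0) (𝓝 0) := by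
    refine (hx2.comp (Besicovitch.tendsto_filterAt volume x)).congr' ?_
    have hev : ∀ᶠ r : ℝ in 𝓝[>] 0, r < R := (gt_mem_nhds hR).filter_mono nhdsWithin_le_nhds
    filter_upwards [hev] with r hr
    simp only [Function.comp_apply]
    refine setAverage_congr_fun measurableSet_closedBall (Eventually.of_forall fun y hy => ?_)
    have hyB : y ∈ B := hxB (Metric.closedBall_subset_closedBall (by linarith) hy)
    have hxB' : x ∈ B := hxB (Metric.mem_closedBall_self (by linarith))
    rw [Set.indicator_of_mem hyB, Set.indicator_of_mem hxB', hux, sub_zero,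
      Real.norm_of_nonneg (hu0 y)]
  have := h.ae_eq_zero_of_tendsto_average hu hu0 (hxB.trans hball) ht (r := 2 * R) (by linarith)
    (by linarith)
  filter_upwards [this] with y hy hyR
  apply hy
  rw [Metric.mem_ball] at hyR ⊢
  have := dist_triangle y x₀ x
  rw [dist_comm x₀ x] at this
  linarith

/-- The strong minimum principle. -/
theorem IsWeaklySuperharmonic.ae_eq_zero_or_ae_pos {u : Plane → ℝ}
    (h : IsWeaklySuperharmonic Ω u) (hu : LocallyIntegrableOn u Ω) (hu0 : ∀ y, 0 ≤ u y)
    (hΩ : IsPreconnected (Ω : Set Plane)) :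
    (∀ᵐ y ∂(volume.restrict (Ω : Set Plane)), u y = 0) ∨
      ∀ᵐ y ∂(volume.restrict (Ω : Set Plane)), 0 < u y := by
  have glob : ∀ P : Plane → Prop, (∀ x ∈ (Ω : Set Plane), ∃ r > 0,
      ∀ᵐ y ∂(volume : Measure Plane), y ∈ Metric.ball x r → P y) →
      ∀ᵐ y ∂(volume.restrict (Ω : Set Plane)), P y := by
    intro P hP
    rw [ae_restrict_iff' Ω.isOpen.measurableSet, ae_iff]
    refine measure_null_of_locally_null _ fun x hx => ?_
    have hxΩ : x ∈ (Ω : Set Plane) := by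
      by_contra hne
      exact hx fun h' => absurd h' hne
    obtain ⟨r, hr, hae⟩ := hP x hxΩ
    refine ⟨_, inter_mem_nhdsWithin _ (Metric.ball_mem_nhds x hr), ?_⟩
    rw [ae_iff] at hae
    refine measure_mono_null ?_ hae
    rintro y ⟨hy1, hy2⟩ hy3
    exact hy1 fun _ => hy3 hy2
  -- The points near which u = 0 a.e. and those near which u > 0 a.e. form two open sets. They cover
  -- Ω by the dichotomy on balls and are disjoint because balls have positive measure, so
  -- connectedness leaves only one of them.
  set V : (Plane → Prop) → Set Plane := fun P => {x | ∃ r > 0,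
      ∀ᵐ y ∂(volume : Measure Plane), y ∈ Metric.ball x r → P y} with hV
  have hVo : ∀ P, IsOpen (V P) := by
    intro P
    rw [Metric.isOpen_iff]
    rintro x ⟨r, hr, hae⟩
    refine ⟨r / 2, by positivity, fun z hz => ⟨r / 2, by positivity, ?_⟩⟩
    filter_upwards [hae] with y hy hyz
    apply hy
    rw [Metric.mem_ball] at *
    linarith [dist_triangle y z x]
  have hcov : (Ω : Set Plane) ⊆ V (fun y => u y = 0) ∪ V (fun y => 0 < u y) := by
    intro x hx
    obtain ⟨ε, hε, hεΩ⟩ := Metric.isOpen_iff.1 Ω.isOpen x hx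
    have hb : Metric.closedBall x (4 * (ε / 8)) ⊆ Ω :=
      (Metric.closedBall_subset_ball (by linarith)).trans hεΩ
    rcases h.ball_dichotomy hu hu0 (by positivity : 0 < ε / 8) hb with h1 | h1
    · exact Or.inl ⟨ε / 8, by positivity, h1⟩
    · exact Or.inr ⟨ε / 8, by positivity, h1⟩
  have hdisj : (Ω : Set Plane) ∩ (V (fun y => u y = 0) ∩ V (fun y => 0 < u y)) = ∅ := by
    rw [Set.eq_empty_iff_forall_notMem]
    rintro x ⟨-, ⟨r₁, hr₁, h₁⟩, ⟨r₂, hr₂, h₂⟩⟩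
    have : volume (Metric.ball x (min r₁ r₂)) = 0 := by
      refine measure_mono_null (t := {y | ¬ (¬ (y ∈ Metric.ball x (min r₁ r₂)))}) (fun y hy => by simpa using hy) ?_
      rw [← ae_iff]
      filter_upwards [h₁, h₂] with y hy₁ hy₂ hy
      have e1 := hy₁ (Metric.ball_subset_ball (min_le_left _ _) hy)
      have e2 := hy₂ (Metric.ball_subset_ball (min_le_right _ _) hy)
      exact e2.ne' e1
    exact (Metric.measure_ball_pos volume x (lt_min hr₁ hr₂)).ne' this
  rcases isPreconnected_iff_subset_of_disjoint.1 hΩ _ _ (hVo _) (hVo _) hcov hdisj with h1 | h1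
  · exact Or.inl (glob _ fun x hx => h1 hx)
  · exact Or.inr (glob _ fun x hx => h1 hx)

end StrongMinimum

/-! ### Translation estimates and Poincaré's inequality -/

section Translation

variable {Ω : Opens Plane}

/-- Cauchy–Schwarz against the constant 1, from expanding ∫ (m g - I)² ≥ 0 with m the total mass and
I = ∫ g. -/
theorem sq_integral_le_measureReal_mul {α : Type*} [MeasurableSpace α] {μ : Measure α}
    [IsFiniteMeasure μ] {g : α → ℝ} (hg : Integrable g μ) (hg2 : Integrable (fun x => g x ^ 2) μ) :
    (∫ x, g x ∂μ) ^ 2 ≤ μ.real Set.univ * ∫ x, g x ^ 2 ∂μ := by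
  set m := μ.real Set.univ with hm
  set I := ∫ x, g x ∂μ with hI
  set J := ∫ x, g x ^ 2 ∂μ with hJ
  have hm0 : 0 ≤ m := measureReal_nonneg
  have h1 : 0 ≤ ∫ x, (m * g x - I) ^ 2 ∂μ := integral_nonneg fun x => sq_nonneg _
  have h2 : ∫ x, (m * g x - I) ^ 2 ∂μ = m ^ 2 * J - 2 * m * I * I + m * I ^ 2 := by
    have e : ∀ x, (m * g x - I) ^ 2 = (m ^ 2 * g x ^ 2 - 2 * m * I * g x) + I ^ 2 := fun x => by ring
    have hInt : Integrable (fun x => m ^ 2 * g x ^ 2 - 2 * m * I * g x) μ :=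
      (hg2.const_mul _).sub (hg.const_mul _)
    simp only [e]
    rw [integral_add hInt (integrable_const _), integral_sub (hg2.const_mul _) (hg.const_mul _), integral_const_mul, integral_const_mul,
      integral_const, smul_eq_mul]
  rw [h2] at h1
  rcases hm0.eq_or_lt with h0 | h0
  · have hμ : μ = 0 := by
      rw [← Measure.measure_univ_eq_zero]
      exact (measureReal_eq_zero_iff (measure_ne_top _ _)).1 (hm ▸ h0.symm)
    simp [hI, hJ, hμ]
  · by_contra hlt
    rw [not_le] at hlt
    nlinarith [mul_lt_mul_of_pos_left hlt h0]

/-- The Dirichlet energy of a function, over the whole plane. -/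
noncomputable def energy (φ : Plane → ℝ) : ℝ := ∫ x, ∑ i, partialD i φ x ^ 2

theorem TestFunction.continuous_partialD (φ : 𝓓(Ω, ℝ)) (i : Fin 2) : Continuous (partialD i φ) :=
  (φ.partial i).continuous

theorem TestFunction.integrable_partialD_mul (φ χ : 𝓓(Ω, ℝ)) (i : Fin 2) (μ : Measure Plane)
    [IsFiniteMeasureOnCompacts μ] :
    Integrable (fun x => partialD i φ x * partialD i χ x) μ :=
  ((φ.partial i).memLp 2 μ).integrable_mul_two ((χ.partial i).memLp 2 μ)

theorem TestFunction.integrable_sum_partialD_sq (φ : 𝓓(Ω, ℝ)) (μ : Measure Plane)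
    [IsFiniteMeasureOnCompacts μ] :
    Integrable (fun x => ∑ i, partialD i φ x ^ 2) μ := by
  refine integrable_finsetSum _ fun i _ => ?_
  simpa only [sq] using φ.integrable_partialD_mul φ i μ

theorem energy_nonneg (φ : Plane → ℝ) : 0 ≤ energy φ :=
  integral_nonneg fun _ => Finset.sum_nonneg fun _ _ => sq_nonneg _

theorem fderiv_apply_sq_le (φ : Plane → ℝ) (x z : Plane) :
    (fderiv ℝ φ x z) ^ 2 ≤ ‖z‖ ^ 2 * ∑ i, partialD i φ x ^ 2 := by
  have hz : z = ∑ i, z i • EuclideanSpace.single i (1 : ℝ) := by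
    ext j
    fin_cases j <;> simp
  have h1 : fderiv ℝ φ x z = ∑ i, z i * partialD i φ x := by
    conv_lhs => rw [hz]
    simp [partialD]
  rw [h1, EuclideanSpace.norm_sq_eq]
  simp only [Real.norm_eq_abs, sq_abs]
  exact Finset.sum_mul_sq_le_sq_mul_sq _ _ _

/-- The increment is the integral of the directional derivative along the segment from x to x + z;
Cauchy–Schwarz applies twice, in t and in the coordinates of z. -/
theorem TestFunction.sq_translate_sub_le (φ : 𝓓(Ω, ℝ)) (x z : Plane) :
    (φ (x + z) - φ x) ^ 2 ≤
      ∫ t in Set.Ioc (0 : ℝ) 1, ‖z‖ ^ 2 * ∑ i, partialD i φ (x + t • z) ^ 2 := by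
  have hfc : Continuous (fderiv ℝ φ) := φ.contDiff.continuous_fderiv (by simp)
  have hc : Continuous fun t : ℝ => fderiv ℝ φ (x + t • z) z := by fun_prop
  have hpc := fun i => φ.continuous_partialD i
  have hd : ∀ t : ℝ, HasDerivAt (fun t : ℝ => φ (x + t • z)) (fderiv ℝ φ (x + t • z) z) t := by
    intro t
    have h1 : HasDerivAt (fun t : ℝ => x + t • z) z t := by
      simpa using ((hasDerivAt_id t).smul_const z).const_add x
    exact (φ.differentiable _).hasFDerivAt.comp_hasDerivAt t h1
  have h2 := intervalIntegral.integral_eq_sub_of_hasDerivAt (a := 0) (b := 1) (fun t _ => hd t)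
    (hc.intervalIntegrable _ _)
  simp only [one_smul, zero_smul, add_zero] at h2
  rw [← h2, intervalIntegral.integral_of_le zero_le_one]
  have hi : ∀ {f : ℝ → ℝ}, Continuous f → IntegrableOn f (Set.Ioc 0 1) := fun hf =>
    hf.integrableOn_Ioc
  refine (sq_integral_le_measureReal_mul (hi hc) (hi (hc.pow 2))).trans ?_
  simp only [measureReal_restrict_apply_univ, Real.volume_real_Ioc, sub_zero, max_eq_left zero_le_one,
    one_mul]
  refine integral_mono (hi (hc.pow 2)) (hi ?_) fun t => fderiv_apply_sq_le _ _ _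
  fun_prop

theorem TestFunction.lintegral_sq_translate_sub_le (φ : 𝓓(Ω, ℝ)) (z : Plane) :
    ∫⁻ x, ENNReal.ofReal ((φ (x + z) - φ x) ^ 2) ≤ ENNReal.ofReal (‖z‖ ^ 2 * energy φ) := by
  have hpc := fun i => φ.continuous_partialD i
  set g : Plane → ℝ := fun x => ‖z‖ ^ 2 * ∑ i, partialD i φ x ^ 2 with hg
  have hgc : Continuous g := by simp only [hg]; fun_prop
  have hg0 : ∀ x, 0 ≤ g x := fun x =>
    mul_nonneg (sq_nonneg _) (Finset.sum_nonneg fun i _ => sq_nonneg _)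
  have hgi : Integrable g := (φ.integrable_sum_partialD_sq volume).const_mul _
  calc ∫⁻ x, ENNReal.ofReal ((φ (x + z) - φ x) ^ 2)
      ≤ ∫⁻ x, ∫⁻ t in Set.Ioc (0 : ℝ) 1, ENNReal.ofReal (g (x + t • z)) := by
        refine lintegral_mono fun x => ?_
        have hc : Continuous fun t : ℝ => g (x + t • z) := by fun_prop
        rw [← ofReal_integral_eq_lintegral_ofReal hc.integrableOn_Ioc
          (Eventually.of_forall fun t => hg0 _)]
        exact ENNReal.ofReal_le_ofReal (φ.sq_translate_sub_le x z)
    _ = ∫⁻ t in Set.Ioc (0 : ℝ) 1, ∫⁻ x, ENNReal.ofReal (g (x + t • z)) := by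
        refine lintegral_lintegral_swap (Measurable.aemeasurable ?_)
        refine (Continuous.measurable ?_).ennreal_ofReal
        fun_prop
    _ = ∫⁻ t in Set.Ioc (0 : ℝ) 1, ∫⁻ x, ENNReal.ofReal (g x) := by
        refine lintegral_congr fun t => ?_
        exact lintegral_add_right_eq_self (fun x => ENNReal.ofReal (g x)) (t • z)
    _ = ENNReal.ofReal (‖z‖ ^ 2 * energy φ) := by
        rw [← ofReal_integral_eq_lintegral_ofReal hgi (Eventually.of_forall hg0)]
        simp [hg, energy, integral_const_mul]

theorem TestFunction.integrable_translate_sub_sq (φ : 𝓓(Ω, ℝ)) (z : Plane) :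
    Integrable fun x => (φ (x + z) - φ x) ^ 2 := by
  have h1 : MemLp (fun x => φ (x + z)) 2 volume :=
    (φ.memLp 2 volume).comp_measurePreserving (measurePreserving_add_right volume z)
  simpa only [sq] using! (h1.sub (φ.memLp 2 volume)).integrable_mul_two (h1.sub (φ.memLp 2 volume))

theorem TestFunction.integral_sq_translate_sub_le (φ : 𝓓(Ω, ℝ)) (z : Plane) :
    ∫ x, (φ (x + z) - φ x) ^ 2 ≤ ‖z‖ ^ 2 * energy φ := by
  have h := φ.lintegral_sq_translate_sub_le z
  rw [← ofReal_integral_eq_lintegral_ofReal (φ.integrable_translate_sub_sq z)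
    (Eventually.of_forall fun x => sq_nonneg _)] at h
  exact (ENNReal.ofReal_le_ofReal_iff (mul_nonneg (sq_nonneg _) (energy_nonneg _))).1 h

theorem TestFunction.integrable_sq (φ : 𝓓(Ω, ℝ)) (μ : Measure Plane) [IsFiniteMeasureOnCompacts μ] :
    Integrable (fun x => φ x ^ 2) μ := by
  simpa only [sq] using (φ.memLp 2 μ).integrable_mul_two (φ.memLp 2 μ)

/-- Poincaré's inequality on a bounded domain. -/
theorem exists_poincare_const (hb : Bornology.IsBounded (Ω : Set Plane)) :
    ∃ C : ℝ, 0 < C ∧ ∀ φ : 𝓓(Ω, ℝ), ∫ x, φ x ^ 2 ≤ C * energy φ := by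
  obtain ⟨ρ, hρ0, hρ⟩ := hb.exists_pos_norm_lt
  -- A translation so long that the supports of φ and of its translate are disjoint. The cross term
  -- then vanishes, and ∫ φ² is at most the translation increment in L².
  set z : Plane := EuclideanSpace.single 0 (2 * ρ)
  have hz : ‖z‖ = 2 * ρ := by simp [z, abs_of_pos hρ0]
  refine ⟨(2 * ρ) ^ 2, by positivity, fun φ => ?_⟩
  have hzero : ∀ x, φ (x + z) * φ x = 0 := by
    intro x
    by_contra hne
    rw [mul_eq_zero, not_or] at hne
    have h1 := hρ _ (φ.tsupport_subset (subset_tsupport _ hne.1))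
    have h2 := hρ _ (φ.tsupport_subset (subset_tsupport _ hne.2))
    have h3 : ‖z‖ ≤ ‖x + z‖ + ‖x‖ := by
      have := norm_sub_le (x + z) x
      simpa using this
    linarith
  have h1 := φ.integral_sq_translate_sub_le z
  have h2 : ∫ x, φ x ^ 2 ≤ ∫ x, (φ (x + z) - φ x) ^ 2 := by
    refine integral_mono (φ.integrable_sq volume) (φ.integrable_translate_sub_sq z) fun x => ?_
    have : (φ (x + z) - φ x) ^ 2 = φ (x + z) ^ 2 - 2 * (φ (x + z) * φ x) + φ x ^ 2 := by ring
    simp only [this, hzero]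
    nlinarith [sq_nonneg (φ (x + z))]
  rw [hz] at h1
  exact h2.trans h1

/-- The left side is the square of the mean of φ(x) - φ(y) over the ball, to which Cauchy–Schwarz
applies; any two points of the ball differ by some z with ‖z‖ ≤ 2r. -/
theorem TestFunction.sq_sub_average_le (φ : 𝓓(Ω, ℝ)) {r : ℝ} (hr : 0 < r) {x c : Plane}
    (hx : x ∈ Metric.closedBall c r) :
    (φ x - ⨍ y in Metric.closedBall c r, φ y) ^ 2 ≤
      (volume.real (Metric.closedBall (0 : Plane) r))⁻¹ *
        ∫ z in Metric.closedBall (0 : Plane) (2 * r), (φ (x + z) - φ x) ^ 2 := by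
  set B := Metric.closedBall c r with hB
  have hBc : IsCompact B := isCompact_closedBall c r
  have hfin : IsFiniteMeasure (volume.restrict B) := ⟨by simpa using hBc.measure_lt_top⟩
  have hm : volume.real (Metric.closedBall (0 : Plane) r) = volume.real B := by
    simp [hB, measureReal_def, Measure.addHaar_closedBall_center]
  set m := volume.real B with hmd
  have hm0 : 0 < m := ENNReal.toReal_pos (Metric.measure_closedBall_pos volume c hr).ne'
    hBc.measure_lt_top.ne
  have hcont := φ.continuous
  have hi : ∀ {f : Plane → ℝ}, Continuous f → IntegrableOn f B := fun hf =>
    hf.continuousOn.integrableOn_compact hBc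
  have c1 : Continuous fun y => φ x - φ y := by fun_prop
  have h1 := sq_integral_le_measureReal_mul (μ := volume.restrict B) (hi c1) (hi (c1.pow 2))
  have h2 : ∫ y in B, (φ x - φ y) = m * (φ x - ⨍ y in B, φ y) := by
    rw [integral_sub (integrable_const _) (hi hcont), setAverage_eq]
    simp only [integral_const, measureReal_restrict_apply_univ, smul_eq_mul, ← hmd]
    field_simp
  rw [h2, measureReal_restrict_apply_univ, ← hmd] at h1
  have h3 : ∫ y in B, (φ x - φ y) ^ 2 ≤
      ∫ z in Metric.closedBall (0 : Plane) (2 * r), (φ (x + z) - φ x) ^ 2 := by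
    have hmp : MeasurePreserving (fun z : Plane => x + z) volume volume :=
      measurePreserving_add_left volume x
    have he : MeasurableEmbedding (fun z : Plane => x + z) := measurableEmbedding_addLeft x
    have e := hmp.setIntegral_preimage_emb he (fun y => (φ x - φ y) ^ 2) B
    rw [← e]
    have e2 : ∀ z, (φ x - φ (x + z)) ^ 2 = (φ (x + z) - φ x) ^ 2 := fun z => by ring
    simp only [e2]
    refine setIntegral_mono_set ?_ (Eventually.of_forall fun z => sq_nonneg _) ?_
    · refine ContinuousOn.integrableOn_compact (isCompact_closedBall _ _) ?_
      fun_prop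
    · refine LE.le.eventuallyLE fun z hz => ?_
      have hz' : x + z ∈ Metric.closedBall c r := hz
      rw [mem_closedBall_iff_norm] at hz' hx
      rw [mem_closedBall_zero_iff]
      have : z = (x + z - c) - (x - c) := by abel
      rw [this]
      exact (norm_sub_le _ _).trans (by linarith)
  rw [hm, inv_mul_eq_div, le_div_iff₀ hm0]
  nlinarith

/-- A function is small in `L²` if its gradient is not too large and its means over small balls
are small. -/
theorem TestFunction.integral_sq_le_of_average_le (φ : 𝓓(Ω, ℝ))
    (hb : Bornology.IsBounded (Ω : Set Plane)) {r δ : ℝ} (hr : 0 < r)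
    (h : ∀ x ∈ (Ω : Set Plane), ∃ c, x ∈ Metric.closedBall c r ∧
      |⨍ y in Metric.closedBall c r, φ y| ≤ δ) :
    ∫ x in Ω, φ x ^ 2 ≤ 32 * r ^ 2 * energy φ + 2 * δ ^ 2 * volume.real (Ω : Set Plane) := by
  set m := volume.real (Metric.closedBall (0 : Plane) r) with hm
  have hm0 : 0 < m := ENNReal.toReal_pos (Metric.measure_closedBall_pos volume 0 hr).ne'
    (isCompact_closedBall _ _).measure_lt_top.ne
  set Q := Metric.closedBall (0 : Plane) (2 * r) with hQ
  have hQc : IsCompact Q := isCompact_closedBall _ _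
  have hQm : volume.real Q = 4 * m := by
    rw [hm, hQ, Measure.addHaar_real_closedBall _ _ (by positivity),
      Measure.addHaar_real_closedBall _ _ hr.le]
    simp only [finrank_euclideanSpace, Fintype.card_fin]
    ring
  have hΩv : volume (Ω : Set Plane) < ⊤ := hb.measure_lt_top
  have hfin : IsFiniteMeasure (volume.restrict (Ω : Set Plane)) := ⟨by simpa using hΩv⟩
  have hcont := φ.continuous
  set D : Plane → ℝ := fun x => ∫ z in Q, (φ (x + z) - φ x) ^ 2 with hD
  have hD0 : ∀ x, 0 ≤ D x := fun x => integral_nonneg fun z => sq_nonneg _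
  have hDl : ∀ x, ENNReal.ofReal (D x) = ∫⁻ z in Q, ENNReal.ofReal ((φ (x + z) - φ x) ^ 2) := by
    intro x
    refine ofReal_integral_eq_lintegral_ofReal ?_ (Eventually.of_forall fun z => sq_nonneg _)
    refine ContinuousOn.integrableOn_compact hQc ?_
    fun_prop
  have hpt : ∀ x ∈ (Ω : Set Plane), φ x ^ 2 ≤ 2 * m⁻¹ * D x + 2 * δ ^ 2 := by
    intro x hx
    obtain ⟨c, hc, hA⟩ := h x hx
    have h1 := φ.sq_sub_average_le hr hc
    have h2 : (⨍ y in Metric.closedBall c r, φ y) ^ 2 ≤ δ ^ 2 := sq_le_sq' (abs_le.1 hA).1 (abs_le.1 hA).2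
    set A := ⨍ y in Metric.closedBall c r, φ y
    have h3 : φ x ^ 2 ≤ 2 * (φ x - A) ^ 2 + 2 * A ^ 2 := by nlinarith [sq_nonneg (φ x - 2 * A)]
    have h4 : (φ x - A) ^ 2 ≤ m⁻¹ * D x := h1
    linarith
  -- `Q` has area 4m and each translation by z in `Q` costs at most (2r)² times the energy. With the
  -- factor 2 / m from the pointwise bound, this gives the constant 32 r².
  have hDint : ∫⁻ x in Ω, ENNReal.ofReal (D x) ≤ ENNReal.ofReal (16 * m * r ^ 2 * energy φ) := by
    calc ∫⁻ x in Ω, ENNReal.ofReal (D x) ≤ ∫⁻ x, ENNReal.ofReal (D x) :=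
          setLIntegral_le_lintegral _ _
      _ = ∫⁻ x, ∫⁻ z in Q, ENNReal.ofReal ((φ (x + z) - φ x) ^ 2) := by simp only [hDl]
      _ = ∫⁻ z in Q, ∫⁻ x, ENNReal.ofReal ((φ (x + z) - φ x) ^ 2) := by
          refine lintegral_lintegral_swap (Measurable.aemeasurable ?_)
          refine (Continuous.measurable ?_).ennreal_ofReal
          fun_prop
      _ ≤ ∫⁻ z in Q, ENNReal.ofReal ((2 * r) ^ 2 * energy φ) := by
          refine setLIntegral_mono' hQc.measurableSet fun z hz => ?_
          refine (φ.lintegral_sq_translate_sub_le z).trans (ENNReal.ofReal_le_ofReal ?_)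
          rw [hQ, mem_closedBall_zero_iff] at hz
          exact mul_le_mul_of_nonneg_right (pow_le_pow_left₀ (norm_nonneg _) hz 2) (energy_nonneg _)
      _ = ENNReal.ofReal (16 * m * r ^ 2 * energy φ) := by
          rw [setLIntegral_const, ← ofReal_measureReal hQc.measure_lt_top.ne, hQm,
            ← ENNReal.ofReal_mul (mul_nonneg (sq_nonneg _) (energy_nonneg _))]
          congr 1
          ring
  have hfinal : ENNReal.ofReal (∫ x in Ω, φ x ^ 2) ≤
      ENNReal.ofReal (32 * r ^ 2 * energy φ + 2 * δ ^ 2 * volume.real (Ω : Set Plane)) := by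
    rw [ofReal_integral_eq_lintegral_ofReal (φ.integrable_sq _)
      (Eventually.of_forall fun x => sq_nonneg _)]
    calc ∫⁻ x in Ω, ENNReal.ofReal (φ x ^ 2)
        ≤ ∫⁻ x in Ω, (ENNReal.ofReal (2 * m⁻¹) * ENNReal.ofReal (D x) + ENNReal.ofReal (2 * δ ^ 2)) := by
          refine setLIntegral_mono' Ω.isOpen.measurableSet fun x hx => ?_
          rw [← ENNReal.ofReal_mul (by positivity), ← ENNReal.ofReal_add
            (mul_nonneg (by positivity) (hD0 x)) (by positivity)]
          exact ENNReal.ofReal_le_ofReal (hpt x hx)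
      _ = ENNReal.ofReal (2 * m⁻¹) * (∫⁻ x in Ω, ENNReal.ofReal (D x)) +
          ENNReal.ofReal (2 * δ ^ 2) * volume (Ω : Set Plane) := by
          rw [lintegral_add_right _ measurable_const, lintegral_const_mul' _ _ ENNReal.ofReal_ne_top,
            setLIntegral_const]
      _ ≤ ENNReal.ofReal (2 * m⁻¹) * ENNReal.ofReal (16 * m * r ^ 2 * energy φ) +
          ENNReal.ofReal (2 * δ ^ 2) * ENNReal.ofReal (volume.real (Ω : Set Plane)) := by
          gcongr
          rw [ofReal_measureReal hΩv.ne]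
      _ = _ := by
          have hE := energy_nonneg φ
          rw [← ENNReal.ofReal_mul (by positivity), ← ENNReal.ofReal_mul (by positivity),
            ← ENNReal.ofReal_add (by positivity) (by positivity)]
          congr 1
          field_simp
          ring
  exact (ENNReal.ofReal_le_ofReal_iff (by have := energy_nonneg φ; positivity)).1 hfinal

end Translation

/-! ### Rellich compactness and the minimizer of the Rayleigh quotient -/

section Rayleigh

variable {Ω : Opens Plane}

theorem inner_toLp_toLp {α : Type*} [MeasurableSpace α] {μ : Measure α} {f g : α → ℝ}
    (hf : MemLp f 2 μ) (hg : MemLp g 2 μ) :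
    inner ℝ (hf.toLp f) (hg.toLp g) = ∫ x, f x * g x ∂μ := by
  rw [L2.inner_def]
  refine integral_congr_ae ?_
  filter_upwards [hf.coeFn_toLp, hg.coeFn_toLp] with x h1 h2
  rw [h1, h2]
  simp [mul_comm]

theorem norm_toLp_sq {α : Type*} [MeasurableSpace α] {μ : Measure α} {f : α → ℝ}
    (hf : MemLp f 2 μ) : ‖hf.toLp f‖ ^ 2 = ∫ x, f x ^ 2 ∂μ := by
  rw [← real_inner_self_eq_norm_sq, inner_toLp_toLp]
  simp only [sq]

theorem TestFunction.setIntegral_eq (φ : 𝓓(Ω, ℝ)) {f : Plane → ℝ}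
    (hf : ∀ x ∉ tsupport φ, f x = 0) : ∫ x in Ω, f x = ∫ x, f x :=
  setIntegral_eq_integral_of_forall_compl_eq_zero fun x hx =>
    hf x fun h => hx (φ.tsupport_subset h)

theorem TestFunction.partialD_eq_zero (φ : 𝓓(Ω, ℝ)) (i : Fin 2) {x : Plane} (hx : x ∉ tsupport φ) :
    partialD i φ x = 0 := by
  by_contra hne
  exact hx (support_partialD_subset _ _ hne)

theorem TestFunction.energy_eq_setIntegral (φ : 𝓓(Ω, ℝ)) :
    energy φ = ∫ x in Ω, ∑ i, partialD i φ x ^ 2 :=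
  (φ.setIntegral_eq fun x hx => by simp [φ.partialD_eq_zero _ hx]).symm

theorem TestFunction.setIntegral_sq (φ : 𝓓(Ω, ℝ)) : ∫ x in Ω, φ x ^ 2 = ∫ x, φ x ^ 2 :=
  φ.setIntegral_eq fun x hx => by simp [image_eq_zero_of_notMem_tsupport hx]

theorem TestFunction.partialD_add_smul (φ χ : 𝓓(Ω, ℝ)) (t : ℝ) (i : Fin 2) (x : Plane) :
    partialD i ⇑(φ + t • χ) x = partialD i φ x + t * partialD i χ x := by
  have : (⇑(φ + t • χ) : Plane → ℝ) = fun y => φ y + t * χ y := rfl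
  rw [this, partialD_add (φ.differentiable x) ((χ.differentiable x).const_mul t),
    partialD_const_mul (χ.differentiable x)]

theorem TestFunction.energy_add_smul (φ χ : 𝓓(Ω, ℝ)) (t : ℝ) :
    energy ⇑(φ + t • χ) = energy φ + 2 * t * (∑ i, ∫ x in Ω, partialD i φ x * partialD i χ x) +
      t ^ 2 * energy χ := by
  simp only [TestFunction.energy_eq_setIntegral, TestFunction.partialD_add_smul]
  have hi : ∀ i : Fin 2, Integrable (fun x => partialD i φ x * partialD i χ x)
      (volume.restrict (Ω : Set Plane)) := fun i => φ.integrable_partialD_mul χ i _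
  have hs : Integrable (fun x => ∑ i, partialD i φ x * partialD i χ x)
      (volume.restrict (Ω : Set Plane)) := integrable_finsetSum _ fun i _ => hi i
  have hs2 : Integrable (fun x => ∑ i, partialD i φ x ^ 2 +
      2 * t * ∑ i, partialD i φ x * partialD i χ x) (volume.restrict (Ω : Set Plane)) :=
    (φ.integrable_sum_partialD_sq _).add (hs.const_mul _)
  rw [← integral_finsetSum _ fun i _ => hi i, ← integral_const_mul,
    ← integral_const_mul, ← integral_add (φ.integrable_sum_partialD_sq _) (hs.const_mul _),
    ← integral_add hs2 ((χ.integrable_sum_partialD_sq _).const_mul _)]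
  refine integral_congr_ae (Eventually.of_forall fun x => ?_)
  simp only [Fin.sum_univ_two]
  ring

theorem TestFunction.integral_sq_add_smul (φ χ : 𝓓(Ω, ℝ)) (t : ℝ) :
    ∫ x in Ω, (φ + t • χ) x ^ 2 = (∫ x in Ω, φ x ^ 2) + 2 * t * (∫ x in Ω, φ x * χ x) +
      t ^ 2 * ∫ x in Ω, χ x ^ 2 := by
  have hφχ : Integrable (fun x => φ x * χ x) (volume.restrict (Ω : Set Plane)) :=
    (φ.memLp 2 _).integrable_mul_two (χ.memLp 2 _)
  have hInt : Integrable (fun x => φ x ^ 2 + 2 * t * (φ x * χ x))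
      (volume.restrict (Ω : Set Plane)) := (φ.integrable_sq _).add (hφχ.const_mul _)
  rw [← integral_const_mul, ← integral_const_mul, ← integral_add (φ.integrable_sq _)
    (hφχ.const_mul _), ← integral_add hInt ((χ.integrable_sq _).const_mul _)]
  refine integral_congr_ae (Eventually.of_forall fun x => ?_)
  have : (φ + t • χ) x = φ x + t * χ x := rfl
  simp only [this]
  ring

theorem TestFunction.sub_eq_add_smul (φ χ : 𝓓(Ω, ℝ)) : φ - χ = φ + (-1 : ℝ) • χ := by
  ext x
  change φ x - χ x = φ x + (-1) * χ x
  ring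

theorem TestFunction.energy_sub_le (φ χ : 𝓓(Ω, ℝ)) :
    energy ⇑(φ - χ) ≤ 2 * energy φ + 2 * energy χ := by
  have h1 := φ.energy_add_smul χ (-1)
  have h2 := φ.energy_add_smul χ 1
  have h3 := energy_nonneg ⇑(φ + (1 : ℝ) • χ)
  rw [← TestFunction.sub_eq_add_smul] at h1
  linarith

theorem TestFunction.sq_average_le (φ : 𝓓(Ω, ℝ)) {r : ℝ} (hr : 0 < r) (c : Plane) :
    (⨍ y in Metric.closedBall c r, φ y) ^ 2 ≤
      (volume.real (Metric.closedBall (0 : Plane) r))⁻¹ * ∫ x in Ω, φ x ^ 2 := by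
  set B := Metric.closedBall c r with hB
  have hBc : IsCompact B := isCompact_closedBall c r
  have hfin : IsFiniteMeasure (volume.restrict B) := ⟨by simpa using hBc.measure_lt_top⟩
  have hm : volume.real (Metric.closedBall (0 : Plane) r) = volume.real B := by
    simp [hB, measureReal_def, Measure.addHaar_closedBall_center]
  rw [hm]
  set m := volume.real B with hmd
  have hm0 : 0 < m := ENNReal.toReal_pos (Metric.measure_closedBall_pos volume c hr).ne'
    hBc.measure_lt_top.ne
  have h1 := sq_integral_le_measureReal_mul (μ := volume.restrict B)
    (φ.continuous.continuousOn.integrableOn_compact hBc) (φ.integrable_sq _)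
  rw [measureReal_restrict_apply_univ, ← hmd] at h1
  have h2 : ∫ x in B, φ x ^ 2 ≤ ∫ x in Ω, φ x ^ 2 := by
    rw [φ.setIntegral_sq]
    exact setIntegral_le_integral (φ.integrable_sq _) (Eventually.of_forall fun x => sq_nonneg _)
  rw [setAverage_eq, ← hmd, smul_eq_mul, mul_pow]
  have h3 : (∫ x in B, φ x) ^ 2 ≤ m * ∫ x in Ω, φ x ^ 2 :=
    h1.trans (mul_le_mul_of_nonneg_left h2 hm0.le)
  calc m⁻¹ ^ 2 * (∫ x in B, φ x) ^ 2 ≤ m⁻¹ ^ 2 * (m * ∫ x in Ω, φ x ^ 2) :=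
        mul_le_mul_of_nonneg_left h3 (by positivity)
    _ = m⁻¹ * ∫ x in Ω, φ x ^ 2 := by field_simp

theorem TestFunction.average_sub (φ χ : 𝓓(Ω, ℝ)) (c : Plane) (r : ℝ) :
    ⨍ y in Metric.closedBall c r, (φ - χ) y =
      (⨍ y in Metric.closedBall c r, φ y) - ⨍ y in Metric.closedBall c r, χ y := by
  simp only [setAverage_eq, smul_eq_mul]
  rw [← mul_sub, ← integral_sub
    (φ.continuous.continuousOn.integrableOn_compact (isCompact_closedBall c r))
    (χ.continuous.continuousOn.integrableOn_compact (isCompact_closedBall c r))]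
  rfl

/-- Rellich's theorem: the test functions on a bounded domain with bounded `W^{1,2}` norm form a
totally bounded set in `L²`. -/
theorem totallyBounded_testFunctions (hb : Bornology.IsBounded (Ω : Set Plane)) (M : ℝ) :
    TotallyBounded {f : Lp ℝ 2 (volume.restrict (Ω : Set Plane)) | ∃ φ : 𝓓(Ω, ℝ),
      f = (φ.memLp 2 _).toLp φ ∧ ∫ x in Ω, φ x ^ 2 ≤ 1 ∧ energy φ ≤ M} := by
  refine Metric.totallyBounded_of_finite_discretization fun ε hε => ?_
  set N := max M 0
  have hN0 : 0 ≤ N := le_max_right _ _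
  have hMN : M ≤ N := le_max_left _ _
  set V := volume.real (Ω : Set Plane)
  have hV0 : 0 ≤ V := measureReal_nonneg
  -- A difference of two such functions has energy at most 4N. The radii are chosen so that 32 r² ·
  -- 4N and 2 δ² V are both below ε² / 2.
  set r := Real.sqrt (ε ^ 2 / (256 * (N + 1)))
  set δ := Real.sqrt (ε ^ 2 / (4 * (V + 1)))
  have hr : 0 < r := Real.sqrt_pos.2 (by positivity)
  have hδ : 0 < δ := Real.sqrt_pos.2 (by positivity)
  have hr2 : r ^ 2 = ε ^ 2 / (256 * (N + 1)) := Real.sq_sqrt (by positivity)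
  have hδ2 : δ ^ 2 = ε ^ 2 / (4 * (V + 1)) := Real.sq_sqrt (by positivity)
  obtain ⟨t, htf, ht⟩ := Metric.totallyBounded_iff.1
    (hb.isCompact_closure.totallyBounded.subset subset_closure) r hr
  have : Fintype t := htf.fintype
  -- The discretization records the means over a finite cover of Ω by balls of radius r. These
  -- vectors are bounded, so finitely many points are δ / 2-dense among them; functions sent to the
  -- same point have means within δ of each other.
  set a : 𝓓(Ω, ℝ) → (t → ℝ) := fun φ c => ⨍ y in Metric.closedBall (c : Plane) r, φ y
  set m := volume.real (Metric.closedBall (0 : Plane) r)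
  have hm0 : 0 ≤ m := measureReal_nonneg
  obtain ⟨s, hsf, hs⟩ := Metric.totallyBounded_iff.1
    (isCompact_closedBall (0 : t → ℝ) (Real.sqrt m⁻¹)).totallyBounded (δ / 2) (by positivity)
  have : Fintype s := hsf.fintype
  have hcover : ∀ φ : 𝓓(Ω, ℝ), ∫ x in Ω, φ x ^ 2 ≤ 1 → ∃ y : s, dist (a φ) y < δ / 2 := by
    intro φ hφ
    have h1 : a φ ∈ Metric.closedBall (0 : t → ℝ) (Real.sqrt m⁻¹) := by
      rw [mem_closedBall_zero_iff, pi_norm_le_iff_of_nonneg (Real.sqrt_nonneg _)]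
      intro c
      refine Real.le_sqrt_of_sq_le ?_
      rw [Real.norm_eq_abs, sq_abs]
      refine (φ.sq_average_le hr c).trans ?_
      exact mul_le_of_le_one_right (by positivity) hφ
    obtain ⟨y, hy, hy'⟩ := Set.mem_iUnion₂.1 (hs h1)
    exact ⟨⟨y, hy⟩, hy'⟩
  choose Φ hΦ1 hΦ2 hΦ3 using fun f : {f : Lp ℝ 2 (volume.restrict (Ω : Set Plane)) |
    ∃ φ : 𝓓(Ω, ℝ), f = (φ.memLp 2 _).toLp φ ∧ ∫ x in Ω, φ x ^ 2 ≤ 1 ∧ energy φ ≤ M} => f.2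
  choose F hF using fun f => hcover (Φ f) (hΦ2 f)
  refine ⟨s, inferInstance, F, fun f g hfg => ?_⟩
  have hd : dist (a (Φ f)) (a (Φ g)) < δ := by
    have h1 := hF f
    have h2 := hF g
    rw [← hfg] at h2
    linarith [dist_triangle_right (a (Φ f)) (a (Φ g)) (F f)]
  have key := (Φ f - Φ g).integral_sq_le_of_average_le hb hr (δ := δ) fun x hx => by
    obtain ⟨c, hc, hxc⟩ := Set.mem_iUnion₂.1 (ht hx)
    refine ⟨c, Metric.ball_subset_closedBall hxc, ?_⟩
    rw [TestFunction.average_sub, ← Real.dist_eq]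
    exact ((dist_le_pi_dist (a (Φ f)) (a (Φ g)) ⟨c, hc⟩).trans hd.le)
  have hE : energy ⇑(Φ f - Φ g) ≤ 4 * N := by
    have := (Φ f).energy_sub_le (Φ g)
    linarith [hΦ3 f, hΦ3 g]
  have hdist : dist (f : Lp ℝ 2 (volume.restrict (Ω : Set Plane))) g ^ 2 =
      ∫ x in Ω, (Φ f - Φ g) x ^ 2 := by
    rw [dist_eq_norm, hΦ1 f, hΦ1 g, ← MemLp.toLp_sub, norm_toLp_sq]
    rfl
  have hfin : dist (f : Lp ℝ 2 (volume.restrict (Ω : Set Plane))) g ^ 2 < ε ^ 2 := by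
    rw [hdist]
    refine key.trans_lt ?_
    have h1 : 32 * r ^ 2 * energy ⇑(Φ f - Φ g) < ε ^ 2 / 2 := by
      calc 32 * r ^ 2 * energy ⇑(Φ f - Φ g) ≤ 32 * r ^ 2 * (4 * N) :=
            mul_le_mul_of_nonneg_left hE (by positivity)
        _ < ε ^ 2 / 2 := by
            rw [hr2]
            have : 32 * (ε ^ 2 / (256 * (N + 1))) * (4 * N) = ε ^ 2 / 2 * (N / (N + 1)) := by
              field_simp; ring
            rw [this]
            refine mul_lt_of_lt_one_right (by positivity) ?_
            rw [div_lt_one (by positivity)]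
            linarith
    have h2 : 2 * δ ^ 2 * V < ε ^ 2 / 2 := by
      rw [hδ2]
      have : 2 * (ε ^ 2 / (4 * (V + 1))) * V = ε ^ 2 / 2 * (V / (V + 1)) := by
        field_simp; ring
      rw [this]
      refine mul_lt_of_lt_one_right (by positivity) ?_
      rw [div_lt_one (by positivity)]
      linarith
    linarith
  exact lt_of_pow_lt_pow_left₀ 2 hε.le hfin

theorem eq_zero_of_forall_quadratic_nonneg {a c : ℝ} (h : ∀ t : ℝ, 0 ≤ 2 * t * a + t ^ 2 * c) :
    a = 0 := by
  by_contra ha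
  have hc : 0 < |c| + 1 := by positivity
  have h1 := h (-a / (|c| + 1))
  have h2 : 2 * (-a / (|c| + 1)) * a + (-a / (|c| + 1)) ^ 2 * c =
      a ^ 2 / (|c| + 1) ^ 2 * (c - 2 * (|c| + 1)) := by
    field_simp
    ring
  rw [h2] at h1
  have h3 : 0 < a ^ 2 / (|c| + 1) ^ 2 := by positivity
  have h4 : c - 2 * (|c| + 1) < 0 := by
    have := le_abs_self c
    have := abs_nonneg c
    linarith
  exact absurd h1 (not_le.2 (mul_neg_of_pos_of_neg h3 h4))

/-- The infimum of the Rayleigh quotient over the test functions. -/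
noncomputable def rayleighInf (Ω : Opens Plane) : ℝ :=
  sInf {q : ℝ | ∃ φ : 𝓓(Ω, ℝ), ∫ x in Ω, φ x ^ 2 = 1 ∧ energy φ = q}

theorem bddBelow_rayleigh (Ω : Opens Plane) :
    BddBelow {q : ℝ | ∃ φ : 𝓓(Ω, ℝ), ∫ x in Ω, φ x ^ 2 = 1 ∧ energy φ = q} :=
  ⟨0, by rintro q ⟨φ, -, rfl⟩; exact energy_nonneg _⟩

theorem TestFunction.exists_normalized (φ : 𝓓(Ω, ℝ)) (h : 0 < ∫ x in Ω, φ x ^ 2) :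
    ∃ χ : 𝓓(Ω, ℝ), ∫ x in Ω, χ x ^ 2 = 1 ∧ energy χ = energy φ / ∫ x in Ω, φ x ^ 2 := by
  set I := ∫ x in Ω, φ x ^ 2
  refine ⟨(0 : 𝓓(Ω, ℝ)) + (Real.sqrt I)⁻¹ • φ, ?_, ?_⟩
  · rw [TestFunction.integral_sq_add_smul]
    have h0 : ∀ x, (0 : 𝓓(Ω, ℝ)) x = 0 := fun x => rfl
    simp only [h0, inv_pow, Real.sq_sqrt h.le]
    simp only [ne_eq, OfNat.ofNat_ne_zero, not_false_eq_true, zero_pow, integral_zero, zero_mul,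
      mul_zero, add_zero, zero_add]
    exact inv_mul_cancel₀ h.ne'
  · rw [TestFunction.energy_add_smul]
    have h0 : ∀ i x, partialD i ⇑(0 : 𝓓(Ω, ℝ)) x = 0 := fun i x => by
      have : (⇑(0 : 𝓓(Ω, ℝ)) : Plane → ℝ) = fun _ => 0 := rfl
      simp [this, partialD]
    have hE : energy ⇑(0 : 𝓓(Ω, ℝ)) = 0 := by
      unfold energy
      simp only [h0]
      simp
    simp only [hE, h0, inv_pow, Real.sq_sqrt h.le]
    simp only [zero_mul, integral_zero, Finset.sum_const_zero, mul_zero, zero_add]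
    rw [div_eq_inv_mul]

theorem TestFunction.rayleighInf_mul_le (φ : 𝓓(Ω, ℝ)) :
    rayleighInf Ω * ∫ x in Ω, φ x ^ 2 ≤ energy φ := by
  have h0 : 0 ≤ ∫ x in Ω, φ x ^ 2 := integral_nonneg fun x => sq_nonneg _
  rcases h0.eq_or_lt with h | h
  · rw [← h, mul_zero]
    exact energy_nonneg _
  · obtain ⟨χ, h1, h2⟩ := φ.exists_normalized h
    rw [← le_div_iff₀ h]
    exact csInf_le (bddBelow_rayleigh Ω) ⟨χ, h1, h2⟩

/-- The infimum of the Rayleigh quotient is an eigenvalue. -/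
theorem isDirichletEigenvalue_rayleighInf (hb : Bornology.IsBounded (Ω : Set Plane))
    (φ₀ : 𝓓(Ω, ℝ)) (hφ₀ : 0 < ∫ x in Ω, φ₀ x ^ 2) : IsDirichletEigenvalue Ω (rayleighInf Ω) := by
  set m := rayleighInf Ω with hm
  set μ := volume.restrict (Ω : Set Plane) with hμ
  obtain ⟨χ₀, hχ₀, -⟩ := φ₀.exists_normalized hφ₀
  obtain ⟨q, hqa, hqt, hq⟩ := exists_seq_tendsto_sInf
    (S := {q : ℝ | ∃ φ : 𝓓(Ω, ℝ), ∫ x in Ω, φ x ^ 2 = 1 ∧ energy φ = q}) ⟨_, χ₀, hχ₀, rfl⟩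
    (bddBelow_rayleigh Ω)
  choose φ' hφ'1 hφ'2 using hq
  have hcomp : IsCompact (closure {f : Lp ℝ 2 μ | ∃ φ : 𝓓(Ω, ℝ),
      f = (φ.memLp 2 _).toLp φ ∧ ∫ x in Ω, φ x ^ 2 ≤ 1 ∧ energy φ ≤ q 0}) :=
    (totallyBounded_testFunctions hb (q 0)).closure.isCompact_of_isClosed isClosed_closure
  obtain ⟨U, -, ns, hns, hU⟩ := hcomp.tendsto_subseq
    (x := fun n => ((φ' n).memLp 2 μ).toLp (φ' n))
    fun n => subset_closure ⟨φ' n, rfl, (hφ'1 n).le, by rw [hφ'2]; exact hqa (Nat.zero_le n)⟩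
  set φ : ℕ → 𝓓(Ω, ℝ) := fun n => φ' (ns n)
  have hφ1 : ∀ n, ∫ x in Ω, φ n x ^ 2 = 1 := fun n => hφ'1 _
  have hφE : Tendsto (fun n => energy (φ n)) atTop (𝓝 m) := by
    have := hqt.comp hns.tendsto_atTop
    refine this.congr fun n => ?_
    simp only [Function.comp_apply, φ, hφ'2]
  set X : ℕ → Lp ℝ 2 μ := fun n => ((φ n).memLp 2 μ).toLp (φ n)
  have hpm : ∀ i n, MemLp (partialD i (φ n)) 2 μ := fun i n => ((φ n).partial i).memLp 2 μ
  set Y : Fin 2 → ℕ → Lp ℝ 2 μ := fun i n => (hpm i n).toLp (partialD i (φ n))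
  have hX : Tendsto X atTop (𝓝 U) := hU
  have hXd : ∀ n k, dist (X n) (X k) ^ 2 = ∫ x in Ω, (φ n - φ k) x ^ 2 := by
    intro n k
    rw [dist_eq_norm, ← MemLp.toLp_sub, norm_toLp_sq]
    rfl
  have hYd : ∀ i n k, dist (Y i n) (Y i k) ^ 2 ≤ energy ⇑(φ n - φ k) := by
    intro i n k
    simp only [Y]
    rw [dist_eq_norm, ← MemLp.toLp_sub, norm_toLp_sq, TestFunction.energy_eq_setIntegral,
      TestFunction.sub_eq_add_smul]
    refine integral_mono ?_ ((φ n + (-1 : ℝ) • φ k).integrable_sum_partialD_sq _) fun x => ?_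
    · have := (hpm i n).sub (hpm i k)
      simpa only [sq] using this.integrable_mul_two this
    · simp only [TestFunction.partialD_add_smul, Pi.sub_apply]
      refine le_trans (le_of_eq ?_) (Finset.single_le_sum
        (f := fun i => (partialD i (φ n) x + -1 * partialD i (φ k) x) ^ 2)
        (fun j _ => sq_nonneg _) (Finset.mem_univ i))
      ring
  -- The parallelogram identity, with E(φₙ + φₖ) ≥ m ∫ (φₙ + φₖ)² = m (4 - ∫ (φₙ - φₖ)²). As both
  -- energies tend to m and φₙ converges in L², the gradients form a Cauchy sequence, so convergence
  -- is strong in W^{1,2}.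
  have hpar : ∀ n k, energy ⇑(φ n - φ k) ≤
      2 * energy (φ n) + 2 * energy (φ k) - 4 * m + m * dist (X n) (X k) ^ 2 := by
    intro n k
    have h1 := (φ n).energy_add_smul (φ k) (-1)
    have h2 := (φ n).energy_add_smul (φ k) 1
    have h3 := (φ n + (1 : ℝ) • φ k).rayleighInf_mul_le
    have h4 := (φ n).integral_sq_add_smul (φ k) (-1)
    have h5 := (φ n).integral_sq_add_smul (φ k) 1
    rw [hXd]
    rw [← TestFunction.sub_eq_add_smul] at h1 h4
    rw [hφ1, hφ1] at h4 h5
    have h6 : ∫ x in Ω, (φ n + (1 : ℝ) • φ k) x ^ 2 = 4 - ∫ x in Ω, (φ n - φ k) x ^ 2 := by linarith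
    rw [h6] at h3
    linarith
  have hYc : ∀ i, CauchySeq (Y i) := by
    intro i
    rw [cauchySeq_iff_tendsto_dist_atTop_0]
    have hXc := cauchySeq_iff_tendsto_dist_atTop_0.1 hX.cauchySeq
    have hf : Tendsto (fun p : ℕ × ℕ => energy (φ p.1)) atTop (𝓝 m) := by
      rw [← prod_atTop_atTop_eq]
      exact hφE.comp tendsto_fst
    have hs : Tendsto (fun p : ℕ × ℕ => energy (φ p.2)) atTop (𝓝 m) := by
      rw [← prod_atTop_atTop_eq]
      exact hφE.comp tendsto_snd
    have hlim : Tendsto (fun p : ℕ × ℕ => Real.sqrt (2 * energy (φ p.1) + 2 * energy (φ p.2) - 4 * m +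
        m * dist (X p.1) (X p.2) ^ 2)) atTop (𝓝 0) := by
      have h1 := ((((hf.const_mul 2).add (hs.const_mul 2)).sub_const (4 * m)).add
        ((hXc.pow 2).const_mul m)).sqrt
      convert h1 using 2
      rw [show 2 * m + 2 * m - 4 * m + m * 0 ^ 2 = 0 by ring, Real.sqrt_zero]
    refine squeeze_zero (fun _ => dist_nonneg) (fun p => ?_) hlim
    exact Real.le_sqrt_of_sq_le ((hYd i p.1 p.2).trans (hpar p.1 p.2))
  choose g hg using fun i => cauchySeq_tendsto_of_complete (hYc i)
  have hUm : MemLp U 2 μ := Lp.memLp U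
  have hgm : ∀ i, MemLp (g i) 2 μ := fun i => Lp.memLp (g i)
  have innU : ∀ χ : 𝓓(Ω, ℝ), Tendsto (fun n => ∫ x in Ω, φ n x * χ x) atTop
      (𝓝 (∫ x in Ω, U x * χ x)) := by
    intro χ
    have h1 := hX.inner (tendsto_const_nhds (x := (χ.memLp 2 μ).toLp χ)) (𝕜 := ℝ)
    have h2 : inner ℝ U ((χ.memLp 2 μ).toLp χ) = ∫ x in Ω, U x * χ x := by
      rw [← inner_toLp_toLp hUm (χ.memLp 2 μ), Lp.toLp_coeFn]
    rw [h2] at h1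
    exact h1.congr fun n => inner_toLp_toLp _ _
  have inng : ∀ i, ∀ χ : 𝓓(Ω, ℝ), Tendsto (fun n => ∫ x in Ω, partialD i (φ n) x * χ x) atTop
      (𝓝 (∫ x in Ω, g i x * χ x)) := by
    intro i χ
    have h1 := (hg i).inner (tendsto_const_nhds (x := (χ.memLp 2 μ).toLp χ)) (𝕜 := ℝ)
    have h2 : inner ℝ (g i) ((χ.memLp 2 μ).toLp χ) = ∫ x in Ω, g i x * χ x := by
      rw [← inner_toLp_toLp (hgm i) (χ.memLp 2 μ), Lp.toLp_coeFn]
    rw [h2] at h1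
    exact h1.congr fun n => inner_toLp_toLp _ _
  set G : Plane → Plane := fun x => WithLp.toLp 2 fun i => g i x
  have hG : HasWeakGradient Ω U G := by
    intro i
    refine ⟨hUm.locallyIntegrableOn_opens one_le_two, (hgm i).locallyIntegrableOn_opens one_le_two,
      fun χ => ?_⟩
    refine tendsto_nhds_unique (innU (χ.partial i)) ((inng i χ).neg.congr fun n => ?_)
    rw [TestFunction.coe_partial, χ.setIntegral_eq, χ.setIntegral_eq,
      integral_mul_partialD χ ((φ n).contDiff.of_le (by simp))]
    · intro x hx
      simp [χ.partialD_eq_zero i hx]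
    · intro x hx
      simp [image_eq_zero_of_notMem_tsupport hx]
  -- The Euler–Lagrange equation: the Rayleigh inequality for φₙ + tχ passes to the limit as a
  -- quadratic in t that is nonnegative for all t and vanishes at t = 0, so its linear coefficient
  -- is zero.
  have hEL : ∀ χ : 𝓓(Ω, ℝ), ∑ i, ∫ x in Ω, g i x * partialD i χ x = m * ∫ x in Ω, U x * χ x := by
    intro χ
    have hquad : ∀ t : ℝ, 0 ≤ 2 * t * ((∑ i, ∫ x in Ω, g i x * partialD i χ x) -
        m * ∫ x in Ω, U x * χ x) + t ^ 2 * (energy χ - m * ∫ x in Ω, χ x ^ 2) := by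
      intro t
      have h1 : ∀ n, m * (1 + 2 * t * (∫ x in Ω, φ n x * χ x) + t ^ 2 * ∫ x in Ω, χ x ^ 2) ≤
          energy (φ n) + 2 * t * (∑ i, ∫ x in Ω, partialD i (φ n) x * partialD i χ x) +
          t ^ 2 * energy χ := by
        intro n
        have := (φ n + t • χ).rayleighInf_mul_le
        rwa [TestFunction.energy_add_smul, TestFunction.integral_sq_add_smul, hφ1] at this
      have l1 : Tendsto (fun n => m * (1 + 2 * t * (∫ x in Ω, φ n x * χ x) +
          t ^ 2 * ∫ x in Ω, χ x ^ 2)) atTop (𝓝 (m * (1 + 2 * t * (∫ x in Ω, U x * χ x) +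
          t ^ 2 * ∫ x in Ω, χ x ^ 2))) :=
        ((((innU χ).const_mul (2 * t)).const_add 1).add_const _).const_mul m
      have l2 : Tendsto (fun n => energy (φ n) +
          2 * t * (∑ i, ∫ x in Ω, partialD i (φ n) x * partialD i χ x) + t ^ 2 * energy χ) atTop
          (𝓝 (m + 2 * t * (∑ i, ∫ x in Ω, g i x * partialD i χ x) + t ^ 2 * energy χ)) :=
        (hφE.add ((tendsto_finsetSum _ fun i _ => inng i (χ.partial i)).const_mul _)).add_const _
      have h2 := le_of_tendsto_of_tendsto' l1 l2 h1
      linarith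
    have := eq_zero_of_forall_quadratic_nonneg hquad
    linarith
  have hlimE : ∀ {f : ℕ → Plane → ℝ} (hf : ∀ n, MemLp (f n) 2 μ) (f₀ : Lp ℝ 2 μ),
      Tendsto (fun n => (hf n).toLp (f n)) atTop (𝓝 f₀) →
      Tendsto (fun n => eLpNorm (fun x => f n x - f₀ x) 2 μ) atTop (𝓝 0) := by
    intro f hf f₀ h
    rw [Lp.tendsto_Lp_iff_tendsto_eLpNorm'] at h
    refine h.congr fun n => eLpNorm_congr_ae ?_
    filter_upwards [(hf n).coeFn_toLp] with x hx
    simp [hx]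
  refine ⟨U, ⟨hUm, G, hG, hgm, φ, hlimE _ U hX, fun i => hlimE _ (g i) (hg i)⟩, ?_, ?_⟩
  · intro hzero
    have hU0 : U = 0 := Lp.ext (by
      filter_upwards [hzero, Lp.coeFn_zero ℝ 2 μ] with x h1 h2
      rw [h1, h2, Pi.zero_apply])
    -- The normalization survives strong L² convergence, so the limit is not zero.
    have h1 := (hX.norm.pow 2)
    have h2 : ∀ n, ‖X n‖ ^ 2 = 1 := fun n => by rw [norm_toLp_sq, hφ1]
    simp only [h2, hU0, norm_zero] at h1
    have := tendsto_nhds_unique h1 tendsto_const_nhds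
    norm_num at this
  · have hUl := hUm.locallyIntegrableOn_opens one_le_two
    refine ⟨hUl, (hUm.const_mul (-m)).locallyIntegrableOn_opens one_le_two, fun χ => ?_⟩
    have e1 : ∫ x in Ω, U x * ∑ i, partialD i (partialD i χ) x =
        -∑ i, ∫ x in Ω, g i x * partialD i χ x := by
      simp only [Finset.mul_sum]
      rw [integral_finsetSum, ← Finset.sum_neg_distrib]
      · exact Finset.sum_congr rfl fun i _ => (hG i).2.2 (χ.partial i)
      · exact fun i _ => hUl.integrable_mul_testFunction ((χ.partial i).partial i)
    rw [e1, hEL χ, ← neg_mul, ← integral_const_mul]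
    refine integral_congr_ae (Eventually.of_forall fun x => ?_)
    simp only
    ring

end Rayleigh

/-! ### Nonlinear functions of an element of H₀¹ -/

section Composition

variable {Ω : Opens Plane}

/-- Squares converge in L¹ by Hölder's inequality applied to fₙ² - f₀² = (fₙ - f₀)(fₙ - f₀ + 2f₀).
-/
theorem tendsto_integral_bdd_mul_sq {α : Type*} [MeasurableSpace α] {μ : Measure α}
    {a f : ℕ → α → ℝ} {a₀ f₀ : α → ℝ} {M : ℝ} (ha : ∀ n, AEStronglyMeasurable (a n) μ)
    (hM : ∀ n x, |a n x| ≤ M) (hlim : ∀ᵐ x ∂μ, Tendsto (fun n => a n x) atTop (𝓝 (a₀ x)))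
    (hf : ∀ n, MemLp (f n) 2 μ) (hf₀ : MemLp f₀ 2 μ)
    (hL : Tendsto (fun n => eLpNorm (fun x => f n x - f₀ x) 2 μ) atTop (𝓝 0)) :
    Tendsto (fun n => ∫ x, a n x * f n x ^ 2 ∂μ) atTop (𝓝 (∫ x, a₀ x * f₀ x ^ 2 ∂μ)) := by
  refine tendsto_integral_bdd_mul_L1 ha hM hlim (fun n => (hf n).integrable_sq) hf₀.integrable_sq ?_
  have hb : ∀ n, eLpNorm (fun x => f n x ^ 2 - f₀ x ^ 2) 1 μ ≤
      eLpNorm (fun x => f n x - f₀ x) 2 μ *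
        (eLpNorm (fun x => f n x - f₀ x) 2 μ + eLpNorm (fun x => 2 * f₀ x) 2 μ) := by
    intro n
    have hd : AEStronglyMeasurable (fun x => f n x - f₀ x) μ := (hf n).1.sub hf₀.1
    have hc : AEStronglyMeasurable (fun x => 2 * f₀ x) μ := hf₀.1.const_mul 2
    have hs : AEStronglyMeasurable (fun x => f n x - f₀ x + 2 * f₀ x) μ := hd.add hc
    have h1 : eLpNorm ((fun x => f n x - f₀ x) • (fun x => f n x - f₀ x + 2 * f₀ x)) 1 μ ≤
        eLpNorm (fun x => f n x - f₀ x) 2 μ * eLpNorm (fun x => f n x - f₀ x + 2 * f₀ x) 2 μ :=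
      eLpNorm_smul_le_mul_eLpNorm hs hd
    have h2 : (fun x => f n x ^ 2 - f₀ x ^ 2) =
        (fun x => f n x - f₀ x) • (fun x => f n x - f₀ x + 2 * f₀ x) := by
      ext x
      simp only [Pi.smul_apply', smul_eq_mul]
      ring
    rw [h2]
    exact h1.trans (mul_le_mul_right (eLpNorm_add_le hd hc one_le_two) _)
  have h2 : eLpNorm (fun x => 2 * f₀ x) 2 μ ≠ ∞ := (hf₀.const_mul 2).2.ne
  have hlim2 := ENNReal.Tendsto.mul hL (Or.inr (by simpa using h2))
    (hL.add_const (eLpNorm (fun x => 2 * f₀ x) 2 μ)) (Or.inr (by simp))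
  rw [zero_mul] at hlim2
  exact tendsto_of_tendsto_of_tendsto_of_le_of_le tendsto_const_nhds hlim2 (fun _ => zero_le) hb

variable {u w : Plane → ℝ} {G : Plane → Plane} {φ : ℕ → 𝓓(Ω, ℝ)}

theorem TestFunction.partialD_comp_apply (φ : 𝓓(Ω, ℝ)) {h : ℝ → ℝ} (hh : ContDiff ℝ (⊤ : ℕ∞) h)
    (h0 : h 0 = 0) (i : Fin 2) (x : Plane) :
    partialD i (φ.comp h hh h0) x = deriv h (φ x) * partialD i φ x :=
  partialD_comp (hh.differentiable (by simp) _) (φ.differentiable x) i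

theorem H10Approx.memLp_comp (H : H10Approx Ω u G φ) {h : ℝ → ℝ} {M : ℝ}
    (hh : ContDiff ℝ (⊤ : ℕ∞) h) (h0 : h 0 = 0) (hM : ∀ s, |deriv h s| ≤ M) :
    MemLp (fun x => h (u x)) 2 (volume.restrict (Ω : Set Plane)) := by
  refine (H.memLp.const_mul M).mono (hh.continuous.comp_aestronglyMeasurable H.memLp.1)
    (Eventually.of_forall fun x => ?_)
  have := abs_le_mul_abs_of_deriv_le (hh.of_le (by simp)) hM (u x) 0
  simp only [h0, sub_zero] at this
  rw [norm_mul]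
  exact this.trans (mul_le_mul_of_nonneg_right (le_abs_self M) (abs_nonneg _))

theorem H10Approx.tendsto_comp (H : H10Approx Ω u G φ) {h : ℝ → ℝ} {M : ℝ}
    (hh : ContDiff ℝ (⊤ : ℕ∞) h) (hM : ∀ s, |deriv h s| ≤ M) :
    Tendsto (fun n => eLpNorm (fun x => h (φ n x) - h (u x)) 2 (volume.restrict (Ω : Set Plane)))
      atTop (𝓝 0) := by
  have hb : ∀ n, eLpNorm (fun x => h (φ n x) - h (u x)) 2 (volume.restrict (Ω : Set Plane)) ≤
      ENNReal.ofReal M * eLpNorm (fun x => φ n x - u x) 2 (volume.restrict (Ω : Set Plane)) :=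
    fun n => eLpNorm_le_mul_eLpNorm_of_ae_le_mul (Eventually.of_forall fun x =>
      abs_le_mul_abs_of_deriv_le (hh.of_le (by simp)) hM _ _) 2
  have hl := ENNReal.Tendsto.const_mul H.tendsto (Or.inr (ENNReal.ofReal_ne_top (r := M)))
  rw [mul_zero] at hl
  exact tendsto_of_tendsto_of_tendsto_of_le_of_le tendsto_const_nhds hl (fun _ => zero_le) hb

/-- A Poincaré inequality for the test functions extends to smooth functions of an element
of `H₀¹`. -/
theorem H10Approx.mul_integral_comp_sq_le (H : H10Approx Ω u G φ) {K : ℝ}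
    (hK : ∀ χ : 𝓓(Ω, ℝ), K * ∫ x in Ω, χ x ^ 2 ≤ energy χ) {h : ℝ → ℝ} {M : ℝ}
    (hh : ContDiff ℝ (⊤ : ℕ∞) h) (h0 : h 0 = 0) (hM : ∀ s, |deriv h s| ≤ M) :
    K * ∫ x in Ω, h (u x) ^ 2 ≤ ∑ i, ∫ x in Ω, deriv h (u x) ^ 2 * G x i ^ 2 := by
  have hc : Continuous (deriv h) := hh.continuous_deriv (by simp)
  have l1 : Tendsto (fun n => ∫ x in Ω, (1 : ℝ) * h (φ n x) ^ 2) atTop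
      (𝓝 (∫ x in Ω, (1 : ℝ) * h (u x) ^ 2)) :=
    tendsto_integral_bdd_mul_sq (M := 1) (fun n => aestronglyMeasurable_const) (by simp)
      (Eventually.of_forall fun x => tendsto_const_nhds)
      (fun n => ((φ n).comp h hh h0).memLp 2 _) (H.memLp_comp hh h0 hM) (H.tendsto_comp hh hM)
  have l2 : Tendsto (fun n => ∑ i, ∫ x in Ω, deriv h (φ n x) ^ 2 * partialD i (φ n) x ^ 2) atTop
      (𝓝 (∑ i, ∫ x in Ω, deriv h (u x) ^ 2 * G x i ^ 2)) := by
    refine tendsto_finsetSum _ fun i _ => tendsto_integral_bdd_mul_sq (M := M ^ 2)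
      (fun n => ((hc.comp (φ n).continuous).pow 2).aestronglyMeasurable) (fun n x => ?_) ?_
      (fun n => ((φ n).partial i).memLp 2 _) (H.memLp_grad i) (H.tendsto_grad i)
    · rw [abs_pow]
      exact pow_le_pow_left₀ (abs_nonneg _) (hM _) 2
    · filter_upwards [H.ae_tendsto] with x hx
      exact ((hc.tendsto _).comp hx).pow 2
  simp only [one_mul] at l1
  refine le_of_tendsto_of_tendsto' (l1.const_mul K) l2 fun n => ?_
  refine (hK ((φ n).comp h hh h0)).trans (le_of_eq ?_)
  rw [TestFunction.energy_eq_setIntegral, integral_finsetSum]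
  · refine Finset.sum_congr rfl fun i _ => integral_congr_ae (Eventually.of_forall fun x => ?_)
    simp only [TestFunction.partialD_comp_apply, mul_pow]
  · intro i _
    exact ((((φ n).comp h hh h0).partial i).memLp 2 _).integrable_sq

/-- Green's formula for the test function `h ∘ u`. -/
theorem H10Approx.integral_deriv_comp_mul_sq (H : H10Approx Ω u G φ) (hw : HasWeakLaplacian Ω u w)
    (hw2 : MemLp w 2 (volume.restrict (Ω : Set Plane))) {h : ℝ → ℝ} {M : ℝ}
    (hh : ContDiff ℝ (⊤ : ℕ∞) h) (h0 : h 0 = 0) (hM : ∀ s, |deriv h s| ≤ M) :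
    ∑ i, ∫ x in Ω, deriv h (u x) * G x i ^ 2 = -∫ x in Ω, w x * h (u x) := by
  have hc : Continuous (deriv h) := hh.continuous_deriv (by simp)
  have hpm : ∀ n i, MemLp (partialD i (φ n)) 2 (volume.restrict (Ω : Set Plane)) := fun n i =>
    ((φ n).partial i).memLp 2 _
  have l1 : Tendsto (fun n => ∑ i, ∫ x in Ω, deriv h (φ n x) * (partialD i (φ n) x * G x i)) atTop
      (𝓝 (∑ i, ∫ x in Ω, deriv h (u x) * (G x i * G x i))) := by
    refine tendsto_finsetSum _ fun i _ => tendsto_integral_bdd_mul_L1 (M := M)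
      (fun n => (hc.comp (φ n).continuous).aestronglyMeasurable) (fun n x => hM _) ?_
      (fun n => (hpm n i).integrable_mul_two (H.memLp_grad i))
      ((H.memLp_grad i).integrable_mul_two (H.memLp_grad i))
      (tendsto_eLpNorm_one_mul (fun n => (hpm n i).1.sub (H.memLp_grad i).1) (H.memLp_grad i)
        (H.tendsto_grad i))
    filter_upwards [H.ae_tendsto] with x hx using (hc.tendsto _).comp hx
  have hcm : ∀ n, MemLp (fun x => h (φ n x)) 2 (volume.restrict (Ω : Set Plane)) := fun n =>
    ((φ n).comp h hh h0).memLp 2 _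
  have l2 : Tendsto (fun n => ∫ x in Ω, (1 : ℝ) * (h (φ n x) * w x)) atTop
      (𝓝 (∫ x in Ω, (1 : ℝ) * (h (u x) * w x))) :=
    tendsto_integral_bdd_mul_L1 (M := 1) (fun n => aestronglyMeasurable_const) (by simp)
      (Eventually.of_forall fun x => tendsto_const_nhds)
      (fun n => (hcm n).integrable_mul_two hw2) ((H.memLp_comp hh h0 hM).integrable_mul_two hw2)
      (tendsto_eLpNorm_one_mul (fun n => (hcm n).1.sub (H.memLp_comp hh h0 hM).1) hw2
        (H.tendsto_comp hh hM))
  have e : ∀ n, ∑ i, ∫ x in Ω, deriv h (φ n x) * (partialD i (φ n) x * G x i) =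
      -∫ x in Ω, (1 : ℝ) * (h (φ n x) * w x) := by
    intro n
    have h1 := hw.integral_gradient H.grad ((φ n).comp h hh h0)
    rw [integral_finsetSum] at h1
    · refine Eq.trans (Finset.sum_congr rfl fun i _ => integral_congr_ae
        (Eventually.of_forall fun x => ?_)) (h1.trans (congrArg _ (integral_congr_ae
        (Eventually.of_forall fun x => ?_))))
      · simp only [TestFunction.partialD_comp_apply]
        ring
      · simp only [TestFunction.coe_comp]
        ring
    · intro i _
      exact (H.memLp_grad i).integrable_mul_two ((((φ n).comp h hh h0).partial i).memLp 2 _)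
  have := tendsto_nhds_unique (l1.congr e) l2.neg
  simpa only [sq, one_mul, mul_comm (w _)] using this

end Composition

/-! ### The first eigenvalue and the maximum principle below it -/

section FirstEigenvalue

variable {Ω : Opens Plane} {u w : Plane → ℝ} {G : Plane → Plane} {φ : ℕ → 𝓓(Ω, ℝ)}

/-- Green's formula tested with the eigenfunction gives ∫ |∇u|² = ν ∫ u². The resulting lower bound
on the set of eigenvalues makes its infimum at most each of them. -/
theorem IsDirichletEigenvalue.nonneg {ν : ℝ} (h : IsDirichletEigenvalue Ω ν) : 0 ≤ ν := by
  obtain ⟨u, hu, hne, hw⟩ := h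
  obtain ⟨G, φ, H⟩ := hu.exists_approx
  have h1 := H.integral_deriv_comp_mul_sq hw (H.memLp.const_mul _) (h := id) (M := 1) contDiff_id
    rfl (by simp)
  have h2 : 0 ≤ ∑ i, ∫ x in Ω, deriv id (u x) * G x i ^ 2 :=
    Finset.sum_nonneg fun i _ => integral_nonneg fun x => by simpa using sq_nonneg (G x i)
  have h3 : -∫ x in Ω, -ν * u x * id (u x) = ν * ∫ x in Ω, u x ^ 2 := by
    rw [← integral_neg, ← integral_const_mul]
    refine integral_congr_ae (Eventually.of_forall fun x => ?_)
    simp only [id]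
    ring
  rw [h1, h3] at h2
  have h4 : 0 ≤ ∫ x in Ω, u x ^ 2 := integral_nonneg fun x => sq_nonneg _
  rcases h4.eq_or_lt with h5 | h5
  · refine absurd ?_ hne
    have := (integral_eq_zero_iff_of_nonneg (fun x => sq_nonneg (u x)) H.memLp.integrable_sq).1
      h5.symm
    filter_upwards [this] with x hx
    simpa using hx
  · exact nonneg_of_mul_nonneg_left h2 h5

theorem exists_testFunction_integral_sq_pos (hΩ : (Ω : Set Plane).Nonempty) :
    ∃ φ : 𝓓(Ω, ℝ), 0 < ∫ x in Ω, φ x ^ 2 := by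
  obtain ⟨x, hx⟩ := hΩ
  obtain ⟨f, hfs, hfc, hf, -, hfx⟩ := exists_contDiff_tsupport_subset (n := (⊤ : ℕ∞))
    (Ω.isOpen.mem_nhds hx)
  refine ⟨⟨f, hf, hfc, hfs⟩, ?_⟩
  rw [TestFunction.setIntegral_sq]
  change 0 < ∫ y, f y ^ 2
  refine (hf.continuous.pow 2).integral_pos_of_hasCompactSupport_nonneg_nonzero ?_
    (fun y => sq_nonneg _) (x := x) (by simp [hfx])
  exact hfc.comp_left (g := fun s : ℝ => s ^ 2) (by simp)

/-- The Poincaré inequality with the first Dirichlet eigenvalue as its constant. -/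
theorem TestFunction.firstDirichletEigenvalue_mul_le (hΩ : (Ω : Set Plane).Nonempty)
    (hb : Bornology.IsBounded (Ω : Set Plane)) (χ : 𝓓(Ω, ℝ)) :
    firstDirichletEigenvalue Ω * ∫ x in Ω, χ x ^ 2 ≤ energy χ := by
  obtain ⟨φ₀, hφ₀⟩ := exists_testFunction_integral_sq_pos hΩ
  refine le_trans (mul_le_mul_of_nonneg_right ?_ (integral_nonneg fun x => sq_nonneg _))
    χ.rayleighInf_mul_le
  exact csInf_le ⟨0, fun ν hν => hν.nonneg⟩ (isDirichletEigenvalue_rayleighInf hb φ₀ hφ₀)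

/-- The maximum principle below the first eigenvalue: if `u` vanishes on the boundary and
`Δu ≥ -μu` where `u > 0`, with `μ < λ₁`, then `u ≤ 0`. -/
theorem H10Approx.ae_nonpos_of_lt_eigenvalue (H : H10Approx Ω u G φ) {K μ : ℝ}
    (hK : ∀ χ : 𝓓(Ω, ℝ), K * ∫ x in Ω, χ x ^ 2 ≤ energy χ) (hμ : μ < K)
    (hw : HasWeakLaplacian Ω u w) (hw2 : MemLp w 2 (volume.restrict (Ω : Set Plane)))
    (hle : ∀ᵐ x ∂(volume.restrict (Ω : Set Plane)), 0 < u x → -μ * u x ≤ w x) :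
    ∀ᵐ x ∂(volume.restrict (Ω : Set Plane)), u x ≤ 0 := by
  have hu2 := H.memLp.integrable_sq
  have hsp : ∀ c : ℕ, MemLp (fun x => smoothPos c (u x)) 2 (volume.restrict (Ω : Set Plane)) :=
    fun c => H.memLp_comp (contDiff_smoothPos c) (smoothPos_zero _) (abs_deriv_smoothPos_le c)
  -- With h = `smoothPos c` one has 0 ≤ h' ≤ 1, so h'² ≤ h' and K ∫ h(u)² ≤ ∫ h'(u)² |∇u|² ≤ ∫ h'(u)
  -- |∇u|² = -∫ w h(u) ≤ μ ∫ u h(u). As c → ∞ this becomes K ∫ (u⁺)² ≤ μ ∫ (u⁺)², and μ < K forces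
  -- u⁺ = 0.
  have hstep : ∀ c : ℕ, K * ∫ x in Ω, smoothPos c (u x) ^ 2 ≤
      μ * ∫ x in Ω, u x * smoothPos c (u x) := by
    intro c
    have h1 := H.mul_integral_comp_sq_le hK (contDiff_smoothPos c) (smoothPos_zero _)
      (abs_deriv_smoothPos_le c)
    have h2 := H.integral_deriv_comp_mul_sq hw hw2 (contDiff_smoothPos c) (smoothPos_zero _)
      (abs_deriv_smoothPos_le c)
    have hTc : Continuous fun s : ℝ => Real.smoothTransition (c * s) :=
      Real.smoothTransition.continuous.comp (continuous_const.mul continuous_id)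
    have hTm : AEStronglyMeasurable (fun x => Real.smoothTransition (c * u x))
        (volume.restrict (Ω : Set Plane)) := hTc.comp_aestronglyMeasurable H.memLp.1
    have hT : ∀ s, |Real.smoothTransition s| ≤ 1 := fun s => by
      rw [abs_of_nonneg (Real.smoothTransition.nonneg _)]
      exact Real.smoothTransition.le_one _
    simp only [deriv_smoothPos] at h1 h2
    have h3 : ∑ i, ∫ x in Ω, Real.smoothTransition (c * u x) ^ 2 * G x i ^ 2 ≤
        ∑ i, ∫ x in Ω, Real.smoothTransition (c * u x) * G x i ^ 2 := by
      refine Finset.sum_le_sum fun i _ => integral_mono ?_ ?_ fun x => ?_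
      · refine (H.memLp_grad i).integrable_sq.bdd_mul (c := 1) (hTm.pow 2)
          (Eventually.of_forall fun x => ?_)
        rw [norm_pow]
        exact pow_le_one₀ (norm_nonneg _) (hT _)
      · exact (H.memLp_grad i).integrable_sq.bdd_mul (c := 1) hTm (Eventually.of_forall fun x => hT _)
      · refine mul_le_mul_of_nonneg_right ?_ (sq_nonneg _)
        have ha := Real.smoothTransition.nonneg (c * u x)
        have hb := Real.smoothTransition.le_one (c * u x)
        nlinarith
    have h4 : -∫ x in Ω, w x * smoothPos c (u x) ≤ μ * ∫ x in Ω, u x * smoothPos c (u x) := by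
      rw [← integral_neg, ← integral_const_mul]
      refine integral_mono_ae (hw2.integrable_mul_two (hsp c)).neg
        ((H.memLp.integrable_mul_two (hsp c)).const_mul μ) ?_
      filter_upwards [hle] with x hx
      by_cases hux : 0 < u x
      · have := mul_le_mul_of_nonneg_right (hx hux)
          (smoothPos_nonneg (c := c) (by positivity) (u x))
        linarith
      · simp [smoothPos_of_nonpos (c := c) (by positivity) (not_lt.1 hux)]
    linarith
  have hbd : ∀ (c : ℕ) x, |smoothPos c (u x)| ≤ |u x| := fun c x => abs_smoothPos_le _ _
  have l1 : Tendsto (fun c : ℕ => ∫ x in Ω, smoothPos c (u x) ^ 2) atTop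
      (𝓝 (∫ x in Ω, max (u x) 0 ^ 2)) := by
    refine tendsto_integral_of_dominated_convergence (fun x => u x ^ 2)
      (fun c => (hsp c).1.pow 2) hu2 (fun c => Eventually.of_forall fun x => ?_)
      (Eventually.of_forall fun x => (tendsto_smoothPos (u x)).pow 2)
    rw [norm_pow, ← sq_abs (u x)]
    exact pow_le_pow_left₀ (norm_nonneg _) (hbd c x) 2
  have l2 : Tendsto (fun c : ℕ => ∫ x in Ω, u x * smoothPos c (u x)) atTop
      (𝓝 (∫ x in Ω, u x * max (u x) 0)) := by
    refine tendsto_integral_of_dominated_convergence (fun x => u x ^ 2)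
      (fun c => H.memLp.1.mul (hsp c).1) hu2 (fun c => Eventually.of_forall fun x => ?_)
      (Eventually.of_forall fun x => (tendsto_smoothPos (u x)).const_mul _)
    rw [norm_mul, ← sq_abs (u x), sq]
    exact mul_le_mul_of_nonneg_left (hbd c x) (abs_nonneg _)
  have hfin := le_of_tendsto_of_tendsto' (l1.const_mul K) (l2.const_mul μ) hstep
  have hsq : ∀ s : ℝ, s * max s 0 = max s 0 ^ 2 := fun s => by
    rcases le_total s 0 with hs | hs
    · simp [max_eq_right hs]
    · simp [max_eq_left hs, sq]
  simp only [hsq] at hfin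
  have hnn : 0 ≤ ∫ x in Ω, max (u x) 0 ^ 2 := integral_nonneg fun x => sq_nonneg _
  have hz : ∫ x in Ω, max (u x) 0 ^ 2 = 0 := by
    refine le_antisymm ?_ hnn
    by_contra hne
    nlinarith [not_le.1 hne]
  have hi : Integrable (fun x => max (u x) 0 ^ 2) (volume.restrict (Ω : Set Plane)) := by
    refine hu2.mono (((continuous_id.max continuous_const).comp_aestronglyMeasurable
      H.memLp.1).pow 2) (Eventually.of_forall fun x => ?_)
    rw [norm_pow, norm_pow]
    refine pow_le_pow_left₀ (norm_nonneg _) ?_ 2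
    rw [Real.norm_eq_abs, Real.norm_eq_abs, abs_of_nonneg (le_max_right _ _)]
    exact max_le (le_abs_self _) (abs_nonneg _)
  filter_upwards [(integral_eq_zero_iff_of_nonneg (fun x => sq_nonneg (max (u x) 0)) hi).1 hz]
    with x hx
  have hx' : max (u x) 0 = 0 := by simpa using hx
  exact hx' ▸ le_max_left _ _

/-- If u ≥ c > 0 a.e., a smooth step h that vanishes at 0 and equals 1 on [c, ∞) makes h(u) equal to
1 with h'(u) ∇u = 0, contradicting Poincaré's inequality for h(u). -/
theorem H10Approx.not_ae_ge (H : H10Approx Ω u G φ) (hΩ : (Ω : Set Plane).Nonempty)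
    (hb : Bornology.IsBounded (Ω : Set Plane)) {c : ℝ} (hc : 0 < c) :
    ¬ ∀ᵐ x ∂(volume.restrict (Ω : Set Plane)), c ≤ u x := by
  intro hge
  obtain ⟨C, hC0, hC⟩ := exists_poincare_const hb
  have hK : ∀ χ : 𝓓(Ω, ℝ), C⁻¹ * ∫ x in Ω, χ x ^ 2 ≤ energy χ := fun χ => by
    rw [χ.setIntegral_sq, inv_mul_le_iff₀ hC0]
    exact hC χ
  set h : ℝ → ℝ := fun s => Real.smoothTransition (c⁻¹ * s) with hdef
  have hh : ContDiff ℝ (⊤ : ℕ∞) h :=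
    Real.smoothTransition.contDiff.comp (contDiff_const.mul contDiff_id)
  have h0 : h 0 = 0 := by simp [hdef]
  obtain ⟨M, hM⟩ := exists_bound_deriv_smoothTransition
  have hd : ∀ s, deriv h s = c⁻¹ * deriv Real.smoothTransition (c⁻¹ * s) := fun s => by
    rw [hdef, deriv_comp_mul_left, smul_eq_mul]
  have h1 : ∀ s, c ≤ s → h s = 1 := fun s hs =>
    Real.smoothTransition.one_of_one_le (by rwa [inv_mul_eq_div, le_div_iff₀ hc, one_mul])
  have hd0 : ∀ s, c ≤ s → deriv h s = 0 := fun s hs => by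
    -- The value 1 is the global maximum of `h`, so the derivative vanishes at the endpoint s = c
    -- too.
    refine IsLocalMax.deriv_eq_zero (Eventually.of_forall fun y => ?_)
    rw [h1 s hs]
    exact Real.smoothTransition.le_one _
  have key := H.mul_integral_comp_sq_le hK hh h0 (M := c⁻¹ * M) fun s => by
    rw [hd, abs_mul, abs_of_pos (inv_pos.2 hc)]
    exact mul_le_mul_of_nonneg_left (hM _) (inv_pos.2 hc).le
  have e1 : ∫ x in Ω, h (u x) ^ 2 = volume.real (Ω : Set Plane) := by
    rw [integral_congr_ae (g := fun _ => (1 : ℝ))]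
    · simp
    · filter_upwards [hge] with x hx
      simp [h1 _ hx]
  have e2 : ∀ i, ∫ x in Ω, deriv h (u x) ^ 2 * G x i ^ 2 = 0 := fun i => by
    refine integral_eq_zero_of_ae ?_
    filter_upwards [hge] with x hx
    simp [hd0 _ hx]
  have hpos : 0 < volume.real (Ω : Set Plane) := ENNReal.toReal_pos
    (Ω.isOpen.measure_pos volume hΩ).ne' hb.measure_lt_top.ne
  rw [e1] at key
  simp only [e2, Finset.sum_const_zero] at key
  exact absurd key (not_le.2 (mul_pos (inv_pos.2 hC0) hpos))

end FirstEigenvalue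

/-! ### Subtracting the boundary value -/

section SubConst

variable {Ω : Opens Plane}

theorem TestFunction.setIntegral_partialD (φ : 𝓓(Ω, ℝ)) (i : Fin 2) :
    ∫ x in Ω, partialD i φ x = 0 := by
  rw [φ.setIntegral_eq fun x hx => φ.partialD_eq_zero i hx]
  have := integral_mul_partialD φ (f := fun _ => 1) contDiff_const i
  simpa [partialD] using this

theorem TestFunction.integrable_partialD (φ : 𝓓(Ω, ℝ)) (i : Fin 2) :
    Integrable (partialD i φ) (volume.restrict (Ω : Set Plane)) :=
  memLp_one_iff_integrable.1 ((φ.partial i).memLp 1 _)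

theorem HasWeakPartial.sub_const {u g : Plane → ℝ} {i : Fin 2} (h : HasWeakPartial Ω i u g)
    (b : ℝ) : HasWeakPartial Ω i (fun x => u x - b) g := by
  refine ⟨h.1.sub (continuous_const.continuousOn.locallyIntegrableOn Ω.isOpen.measurableSet), h.2.1,
    fun φ => ?_⟩
  have hi : Integrable (fun x => u x * partialD i φ x) (volume.restrict (Ω : Set Plane)) :=
    h.1.integrable_mul_testFunction (φ.partial i)
  simp only [sub_mul]
  rw [integral_sub hi ((φ.integrable_partialD i).const_mul b), integral_const_mul, φ.setIntegral_partialD, mul_zero,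
    sub_zero]
  exact h.2.2 φ

theorem HasWeakLaplacian.sub_const {u w : Plane → ℝ} (h : HasWeakLaplacian Ω u w) (b : ℝ) :
    HasWeakLaplacian Ω (fun x => u x - b) w := by
  refine ⟨h.1.sub (continuous_const.continuousOn.locallyIntegrableOn Ω.isOpen.measurableSet), h.2.1,
    fun φ => ?_⟩
  have hi : ∀ i, Integrable (partialD i (partialD i φ)) (volume.restrict (Ω : Set Plane)) :=
    fun i => (φ.partial i).integrable_partialD i
  have hz : ∫ x in Ω, ∑ i, partialD i (partialD i φ) x = 0 := by
    rw [integral_finsetSum _ fun i _ => hi i]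
    exact Finset.sum_eq_zero fun i _ => (φ.partial i).setIntegral_partialD i
  have hu : Integrable (fun x => u x * ∑ i, partialD i (partialD i φ) x)
      (volume.restrict (Ω : Set Plane)) := by
    simp only [Finset.mul_sum]
    exact integrable_finsetSum _ fun i _ =>
      h.1.integrable_mul_testFunction ((φ.partial i).partial i)
  simp only [sub_mul]
  rw [integral_sub hu ((integrable_finsetSum _ fun i _ => hi i).const_mul b), integral_const_mul,
    hz, mul_zero, sub_zero]
  exact h.2.2 φ

end SubConst

/-! ### The two cases of Arnold's criterion -/

section Arnold

variable {Ω : Opens Plane} {u w : Plane → ℝ} {G Gw : Plane → Plane} {φ : ℕ → 𝓓(Ω, ℝ)}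

/-- If `∇u · ∇Δu ≥ 0`, with `∇u = 0` wherever `∇Δu = 0`, and `u` vanishes on the boundary of a
connected domain, then `Δu` does not change sign. -/
theorem H10Approx.laplacian_sign (H : H10Approx Ω u G φ) (hΩ : IsPreconnected (Ω : Set Plane))
    (hw : HasWeakLaplacian Ω u w) (hGw : HasWeakGradient Ω w Gw)
    (hGw2 : ∀ i, MemLp (fun x => Gw x i) 2 (volume.restrict (Ω : Set Plane)))
    (hin : ∀ᵐ x ∂(volume.restrict (Ω : Set Plane)), 0 ≤ ∑ i, G x i * Gw x i)
    (hzero : ∀ᵐ x ∂(volume.restrict (Ω : Set Plane)), Gw x = 0 → G x = 0) :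
    (∀ᵐ x ∂(volume.restrict (Ω : Set Plane)), 0 ≤ w x) ∨
      ∀ᵐ x ∂(volume.restrict (Ω : Set Plane)), w x ≤ 0 := by
  -- Stated for arbitrary data because it is applied to both u and -u.
  have hdich : ∀ {u w : Plane → ℝ} {G Gw : Plane → Plane} {φ : ℕ → 𝓓(Ω, ℝ)},
      H10Approx Ω u G φ → HasWeakLaplacian Ω u w → HasWeakGradient Ω w Gw →
      (∀ i, MemLp (fun x => Gw x i) 2 (volume.restrict (Ω : Set Plane))) →
      (∀ᵐ x ∂(volume.restrict (Ω : Set Plane)), 0 ≤ ∑ i, G x i * Gw x i) →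
      (∀ᵐ x ∂(volume.restrict (Ω : Set Plane)), Gw x = 0 → G x = 0) →
      (∀ᵐ x ∂(volume.restrict (Ω : Set Plane)), u x ≤ 0) ∨
        ∀ᵐ x ∂(volume.restrict (Ω : Set Plane)), w x ≤ 0 := by
    intro u w G Gw φ H hw hGw hGw2 hin hzero
    rcases IsWeaklySuperharmonic.ae_eq_zero_or_ae_pos (u := fun x => max (u x) 0)
      (H.superharmonic_posPart hw hGw hGw2 hin hzero) (H.grad 0).posPart.1
      (fun y => le_max_right _ _) hΩ with h0 | h0
    · left
      filter_upwards [h0] with x hx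
      exact hx ▸ le_max_left _ _
    · right
      filter_upwards [h0, H.laplacian_nonpos_of_pos hw hGw hGw2 hin] with x hx h1
      exact h1 (by simpa using hx)
  rcases hdich H hw hGw hGw2 hin hzero with hle | h
  · rcases hdich H.neg hw.neg hGw.neg (fun i => (hGw2 i).neg)
      (by filter_upwards [hin] with x hx; simpa using hx)
      (by filter_upwards [hzero] with x hx; simpa using hx) with hge | h
    · left
      -- Here u ≤ 0 and u ≥ 0 a.e., so u = 0 and its distributional Laplacian vanishes.
      have hz : ∀ᵐ x ∂(volume.restrict (Ω : Set Plane)), w x = 0 := by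
        refine hw.2.1.ae_eq_zero_of_integral_testFunction fun χ => ?_
        rw [← hw.2.2 χ]
        refine integral_eq_zero_of_ae ?_
        filter_upwards [hle, hge] with x h1 h2
        have : u x = 0 := by linarith
        simp [this]
      filter_upwards [hz] with x hx using hx.ge
    · left
      filter_upwards [h] with x hx
      linarith
  · exact Or.inr h

/-- A Lipschitz function is absolutely continuous, hence the integral of its a.e. derivative, so an
essential lower bound on the derivative controls increments. -/
theorem LipschitzWith.mul_sub_le_of_le_deriv {f : ℝ → ℝ} {K : ℝ≥0} (hf : LipschitzWith K f)
    {m s t : ℝ} (hst : s ≤ t) (hm : ∀ᵐ r ∂(volume.restrict (Set.Icc s t)), m ≤ deriv f r) :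
    m * (t - s) ≤ f t - f s := by
  have hac : AbsolutelyContinuousOnInterval f s t :=
    (hf.lipschitzOnWith (s := Set.uIcc s t)).absolutelyContinuousOnInterval
  rw [← hac.integral_deriv_eq_sub]
  have h := intervalIntegral.integral_mono_ae_restrict hst (f := fun _ => m) (g := deriv f)
    intervalIntegrable_const hac.intervalIntegrable_deriv hm
  simpa [mul_comm] using h

/-- Otherwise ψ - b or b - ψ would be bounded below by a positive constant, impossible in H₀¹. This
permits comparing f(ψ) with f(b), the slope of f being controlled only on this interval. -/
theorem H10Approx.mem_essRangeInterval {ψ : Plane → ℝ} {b : ℝ}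
    (H : H10Approx Ω (fun x => ψ x - b) G φ) (hΩ : (Ω : Set Plane).Nonempty)
    (hb : Bornology.IsBounded (Ω : Set Plane)) : b ∈ essRangeInterval Ω ψ := by
  constructor
  · by_contra hlt
    obtain ⟨c, hbc, hc⟩ := EReal.lt_iff_exists_real_btwn.1 (not_le.1 hlt)
    rw [EReal.coe_lt_coe_iff] at hbc
    refine H.not_ae_ge hΩ hb (c := c - b) (by linarith) ?_
    filter_upwards [ae_lt_of_lt_essInf hc] with x hx
    rw [EReal.coe_lt_coe_iff] at hx
    linarith
  · by_contra hlt
    obtain ⟨c, hc, hcb⟩ := EReal.lt_iff_exists_real_btwn.1 (not_le.1 hlt)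
    rw [EReal.coe_lt_coe_iff] at hcb
    refine H.neg.not_ae_ge hΩ hb (c := b - c) (by linarith) ?_
    filter_upwards [ae_lt_of_essSup_lt hc] with x hx
    rw [EReal.coe_lt_coe_iff] at hx
    linarith

theorem ordConnected_essRangeInterval (Ω : Opens Plane) (ψ : Plane → ℝ) :
    (essRangeInterval Ω ψ).OrdConnected :=
  ⟨fun _ hs _ ht _ hr => ⟨hs.1.trans (EReal.coe_le_coe_iff.2 hr.1),
    (EReal.coe_le_coe_iff.2 hr.2).trans ht.2⟩⟩

theorem ae_mem_essRangeInterval (Ω : Opens Plane) (ψ : Plane → ℝ) :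
    ∀ᵐ x ∂(volume.restrict (Ω : Set Plane)), ψ x ∈ essRangeInterval Ω ψ := by
  filter_upwards [_root_.ae_essInf_le (μ := volume.restrict (Ω : Set Plane))
    (f := fun x => (ψ x : EReal)), _root_.ae_le_essSup (μ := volume.restrict (Ω : Set Plane))
    (f := fun x => (ψ x : EReal))] with x h1 h2 using ⟨h1, h2⟩

/-- If `Δψ = f(ψ)` with `f` nonincreasing of slope above `-λ₁` on the range of `ψ`, and `ψ` constant
on the boundary, then `Δψ` does not change sign. -/
theorem H10Approx.laplacian_sign_of_antitone {ψ ω : Plane → ℝ} {b : ℝ}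
    (H : H10Approx Ω (fun x => ψ x - b) G φ) (hΩ : (Ω : Set Plane).Nonempty)
    (hb : Bornology.IsBounded (Ω : Set Plane)) (hω : HasWeakLaplacian Ω ψ ω) {f : ℝ → ℝ}
    {K : ℝ≥0} (hf : Antitone f) (hfK : LipschitzWith K f)
    (hωf : ∀ᵐ x ∂(volume.restrict (Ω : Set Plane)), ω x = f (ψ x))
    (hlt : ((-firstDirichletEigenvalue Ω : ℝ) : EReal) <
      essInf (fun s => ((deriv f s : ℝ) : EReal)) (volume.restrict (essRangeInterval Ω ψ))) :
    (∀ᵐ x ∂(volume.restrict (Ω : Set Plane)), 0 ≤ ω x) ∨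
      ∀ᵐ x ∂(volume.restrict (Ω : Set Plane)), ω x ≤ 0 := by
  -- A real slope strictly between -λ₁ and the essential infimum, which may be infinite in `EReal`;
  -- the maximum principle is applied with μ = -m < λ₁.
  obtain ⟨m, hm1, hm2⟩ := EReal.lt_iff_exists_real_btwn.1 hlt
  rw [EReal.coe_lt_coe_iff] at hm1
  have hfin : IsFiniteMeasure (volume.restrict (Ω : Set Plane)) :=
    ⟨by simpa using hb.measure_lt_top⟩
  have hder : ∀ᵐ s ∂(volume.restrict (essRangeInterval Ω ψ)), m ≤ deriv f s := by
    filter_upwards [ae_lt_of_lt_essInf hm2] with s hs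
    exact (EReal.coe_lt_coe_iff.1 hs).le
  have hsub : ∀ s ∈ essRangeInterval Ω ψ, ∀ t ∈ essRangeInterval Ω ψ, s ≤ t →
      m * (t - s) ≤ f t - f s := fun s hs t ht hst =>
    hfK.mul_sub_le_of_le_deriv hst (ae_restrict_of_ae_restrict_of_subset
      ((ordConnected_essRangeInterval Ω ψ).out hs ht) hder)
  have hbm := H.mem_essRangeInterval hΩ hb
  have hpoin := TestFunction.firstDirichletEigenvalue_mul_le hΩ hb
  have hω2 : MemLp ω 2 (volume.restrict (Ω : Set Plane)) := by
    have h0 : MemLp (fun x => (K : ℝ) * ‖ψ x - b‖) 2 (volume.restrict (Ω : Set Plane)) :=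
      H.memLp.norm.const_mul _
    have h1 : MemLp (fun x => |f b| + K * ‖ψ x - b‖) 2 (volume.restrict (Ω : Set Plane)) :=
      (memLp_const (|f b|)).add h0
    refine h1.mono hω.2.1.aestronglyMeasurable ?_
    filter_upwards [hωf] with x hx
    rw [hx, Real.norm_eq_abs, Real.norm_of_nonneg (by positivity)]
    have h2 := hfK.dist_le_mul (ψ x) b
    rw [Real.dist_eq, Real.dist_eq, ← Real.norm_eq_abs (ψ x - b)] at h2
    have h3 := abs_sub_abs_le_abs_sub (f (ψ x)) (f b)
    linarith
  have hlap := hω.sub_const b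
  -- The value f(b) decides the sign. If f(b) ≥ 0 then Δ(ψ - b) ≥ f(b) + m (ψ - b) ≥ m (ψ - b) where
  -- ψ > b, so ψ ≤ b and, by monotonicity, f(ψ) ≥ f(b). The other case is the same argument for b -
  -- ψ.
  rcases le_total 0 (f b) with hfb | hfb
  · left
    have hle := H.ae_nonpos_of_lt_eigenvalue hpoin (μ := -m) (by linarith) hlap hω2 (by
      filter_upwards [hωf, ae_mem_essRangeInterval Ω ψ] with x hx hmem hpos
      have := hsub b hbm _ hmem (by linarith)
      rw [hx]
      linarith)
    filter_upwards [hωf, hle] with x hx hx2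
    rw [hx]
    exact hfb.trans (hf (by linarith))
  · right
    have hle := H.neg.ae_nonpos_of_lt_eigenvalue hpoin (μ := -m) (by linarith) hlap.neg hω2.neg (by
      filter_upwards [hωf, ae_mem_essRangeInterval Ω ψ] with x hx hmem hpos
      have := hsub _ hmem b hbm (by linarith)
      rw [hx]
      linarith)
    filter_upwards [hωf, hle] with x hx hx2
    rw [hx]
    exact (hf (by linarith)).trans hfb

/-- The upper bound |∇ω| ≤ C |∇ψ| transfers square integrability from ∇ψ to ∇ω, as the nonlinear
test functions of ω require. -/
theorem HasWeakGradient.memLp_of_norm_le {C : ℝ} (hGw : HasWeakGradient Ω w Gw)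
    (hG : ∀ i, MemLp (fun x => G x i) 2 (volume.restrict (Ω : Set Plane)))
    (hle : ∀ᵐ x ∂(volume.restrict (Ω : Set Plane)), ‖Gw x‖ ≤ C * ‖G x‖) (i : Fin 2) :
    MemLp (fun x => Gw x i) 2 (volume.restrict (Ω : Set Plane)) := by
  have h1 : MemLp (fun x => |C| * (|G x 0| + |G x 1|)) 2 (volume.restrict (Ω : Set Plane)) :=
    ((hG 0).abs.add (hG 1).abs).const_mul _
  refine h1.mono (hGw i).2.1.aestronglyMeasurable ?_
  filter_upwards [hle] with x hx
  rw [Real.norm_of_nonneg (r := |C| * (|G x 0| + |G x 1|)) (by positivity)]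
  have h2 : ‖G x‖ ≤ |G x 0| + |G x 1| := by
    rw [EuclideanSpace.norm_eq, Fin.sum_univ_two, Real.norm_eq_abs, Real.norm_eq_abs]
    refine Real.sqrt_le_iff.2 ⟨by positivity, ?_⟩
    nlinarith [abs_nonneg (G x 0), abs_nonneg (G x 1)]
  calc ‖Gw x i‖ ≤ ‖Gw x‖ := PiLp.norm_apply_le _ i
    _ ≤ C * ‖G x‖ := hx
    _ ≤ |C| * ‖G x‖ := mul_le_mul_of_nonneg_right (le_abs_self C) (norm_nonneg _)
    _ ≤ |C| * (|G x 0| + |G x 1|) := mul_le_mul_of_nonneg_left h2 (abs_nonneg C)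

end Arnold

theorem lemma2p5 (Ω : Opens Plane) (hΩ : IsConnected (Ω : Set Plane))
    (hb : Bornology.IsBounded (Ω : Set Plane)) (ψ ω : Plane → ℝ)
    (hflow : IsSteadyFlow Ω ψ ω) (hstable : ArnoldStable Ω ψ ω) :
    (∀ᵐ x ∂(volume.restrict (Ω : Set Plane)), 0 ≤ ω x) ∨
      (∀ᵐ x ∂(volume.restrict (Ω : Set Plane)), ω x ≤ 0) := by
  obtain ⟨-, Gψ, Gω, hGψ, hGω, ⟨C, hC0, hC⟩, hcase⟩ := hstable
  obtain ⟨b, hbd⟩ := hflow.boundary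
  obtain ⟨G, φ, H⟩ := hbd.exists_approx
  rcases hcase with hpar | ⟨-, f, hf, ⟨K, hfK⟩, hωf, hlt⟩
  · have hGG : ∀ᵐ x ∂(volume.restrict (Ω : Set Plane)), G x = Gψ x :=
      H.grad.ae_unique fun i => (hGψ i).sub_const b
    refine H.laplacian_sign hΩ.isPreconnected (hflow.vorticity.sub_const b) hGω
      (hGω.memLp_of_norm_le H.memLp_grad (C := C) ?_) ?_ ?_
    · filter_upwards [hGG, hC] with x h1 h2
      rw [h1]
      exact h2.2
    · filter_upwards [hGG, hpar] with x h1 h2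
      have h3 : ∑ i, G x i * Gω x i = inner ℝ (Gψ x) (Gω x) := by
        simp [h1, PiLp.inner_apply, mul_comm]
      rw [h3, h2]
      positivity
    -- The lower bound C⁻¹ |∇ψ| ≤ |∇ω| makes ∇ψ vanish wherever ∇ω does.
    · filter_upwards [hGG, hC] with x h1 h2 h3
      have h4 := h2.1
      rw [h3, norm_zero, inv_mul_le_iff₀ hC0, mul_zero] at h4
      rw [h1]
      exact norm_le_zero_iff.1 h4
  · exact H.laplacian_sign_of_antitone hΩ.nonempty hb hflow.vorticity hf hfK hωf hlt
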